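/- Let $S=\mathbb{R}\times\mathbb{T}$, $\mathbb{T}=\mathbb{R}/2\pi\mathbb{Z}$, be the infinite cylinder, with points $z=(x,y)$, $\xi=(\xi_1,\xi_2)$ and $dz=dx\,dy$. Consider the 2D Euler equation in vorticity form $$\partial_t\theta+u\cdot\nabla\theta=0,\qquad \theta|_{t=0}=\theta_0,\qquad u(z,t)=\int_S k(z-\xi)\,\theta(\xi,t)\,d\xi,\qquad k(x,y)=\frac{(-\sin y,\ \sinh x)}{2(\cosh x-\cos y)} .$$ For a function $f$ on $S$ let $\operatorname{supp} f$ be its essential support and $d_f:=\sup_{z,\xi\in\operatorname{supp} f}|x-\xi_1|$ ($d_f:=0$ if $f=0$ a.e.). A solution with initial data $\theta_0$ means a measurable function $\theta$ on $S\times[0,\infty)$ such that: for every $T<\infty$ the functions $\theta(\cdot,t)$, $0\le t\le T$, are bounded in $L^\infty(S)$ by a common constant and have their essential supports in a common compact set; the equation holds in the sense of distributions, that is, for all $\varphi\in C_c^\infty(S\times[0,\infty))$, $$\int_0^\infty\!\!\int_S \theta\,(\partial_t\varphi+u\cdot\nabla\varphi)\,dz\,dt+\int_S\theta_0(z)\,\varphi(z,0)\,dz=0;$$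 and $\theta$ is represented so that $t\mapsto\theta(\cdot,t)$ is weak-$*$ continuous from $[0,\infty)$ to $L^\infty(S)$, which gives $\theta(\cdot,t)$ a meaning for every $t\ge 0$. **Proposition 3.1.** There is a function $C(\cdot,\cdot)$ of two real variables with the following property. Suppose that $\theta_0\in L^\infty(S)$ is non-negative and compactly supported, and that its horizontal center of mass is at $0$, i.e. $\int_S x\,\theta_0(z)\,dz=0$. Then every solution $\theta$ with initial data $\theta_0$ satisfies $$\sup_{t\ge 0}\int_S|x|\,\theta(z,t)\,dz\ \le\ C\big(d_{\theta_0},\|\theta_0\|_{L^\infty(S)}\big),$$ where each of these integrals converges absolutely. -/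

import Mathlib

open MeasureTheory Set Filter Topology
open scoped ContDiff ENNReal

namespace CylEuler

/-- The period `2π` of the vertical variable is positive; this gives the circle its Lebesgue
measure, of total mass `2π`. -/
instance fact_two_pi_pos : Fact (0 < 2 * Real.pi) := ⟨Real.two_pi_pos⟩

/-- The infinite cylinder `S = ℝ × 𝕋`, `𝕋 = ℝ / 2πℤ`, with points `z = (x, y)`.
Its `volume` is the product measure `dz = dx dy`. -/
abbrev Cylinder : Type := ℝ × AddCircle (2 * Real.pi)

/-- Sine as a function on the circle `ℝ / 2πℤ`. -/
noncomputable def sinC : AddCircle (2 * Real.pi) → ℝ := Real.sin_periodic.lift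

/-- Cosine as a function on the circle `ℝ / 2πℤ`. -/
noncomputable def cosC : AddCircle (2 * Real.pi) → ℝ := Real.cos_periodic.lift

/-- Horizontal component `k₁ = - sin y / (2 (cosh x - cos y))` of the cylindrical Biot-Savart
kernel (the denominator vanishes only at the origin of the cylinder, a null set). -/
noncomputable def k₁ (z : Cylinder) : ℝ :=
  -sinC z.2 / (2 * (Real.cosh z.1 - cosC z.2))

/-- Vertical component `k₂ = sinh x / (2 (cosh x - cos y))` of the cylindrical Biot-Savart
kernel. -/
noncomputable def k₂ (z : Cylinder) : ℝ :=
  Real.sinh z.1 / (2 * (Real.cosh z.1 - cosC z.2))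

/-- Horizontal velocity `u₁ = k₁ * f` generated by a vorticity `f` on the cylinder. -/
noncomputable def u₁ (f : Cylinder → ℝ) (z : Cylinder) : ℝ := ∫ ξ, k₁ (z - ξ) * f ξ

/-- Vertical velocity `u₂ = k₂ * f` generated by a vorticity `f` on the cylinder. -/
noncomputable def u₂ (f : Cylinder → ℝ) (z : Cylinder) : ℝ := ∫ ξ, k₂ (z - ξ) * f ξ

/-- Essential support: the points having no neighbourhood on which `f` vanishes almost
everywhere. -/
def essSupport (f : Cylinder → ℝ) : Set Cylinder :=
  {z | ∀ U ∈ 𝓝 z, ¬ ∀ᵐ ξ ∂(volume.restrict U), f ξ = 0}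

/-- `d_f`, the horizontal diameter of the essential support of `f`
(it is `0` if `f` vanishes almost everywhere). -/
noncomputable def horizDiam (f : Cylinder → ℝ) : ℝ :=
  sSup {r | ∃ z ∈ essSupport f, ∃ ξ ∈ essSupport f, r = |z.1 - ξ.1|}

/-- The `L^∞` norm on the cylinder. -/
noncomputable def supNorm (f : Cylinder → ℝ) : ℝ := (eLpNorm f ∞ volume).toReal

/-- Test functions: compactly supported functions of `(t, (x, y)) ∈ ℝ × S`, smooth on `ℝ × S`,
which means that the lift to `ℝ × (ℝ × ℝ)`, periodic in `y`, is smooth.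
Their restrictions to `t ≥ 0` are the elements of `C_c^∞([0,∞) × S)`. -/
structure IsTestFunction (φ : ℝ × Cylinder → ℝ) : Prop where
  smooth : ContDiff ℝ ∞
    (fun p : ℝ × (ℝ × ℝ) => φ (p.1, (p.2.1, (p.2.2 : AddCircle (2 * Real.pi)))))
  compactSupport : HasCompactSupport φ

/-- `∂φ/∂t`. -/
noncomputable def dt (φ : ℝ × Cylinder → ℝ) (t : ℝ) (z : Cylinder) : ℝ :=
  deriv (fun s : ℝ => φ (s, z)) t

/-- `∂φ/∂x`. -/
noncomputable def dx (φ : ℝ × Cylinder → ℝ) (t : ℝ) (z : Cylinder) : ℝ :=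
  deriv (fun s : ℝ => φ (t, (s, z.2))) z.1

/-- `∂φ/∂y`, computed along `s ↦ y + s` on the circle. -/
noncomputable def dy (φ : ℝ × Cylinder → ℝ) (t : ℝ) (z : Cylinder) : ℝ :=
  deriv (fun s : ℝ => φ (t, (z.1, z.2 + (s : AddCircle (2 * Real.pi))))) 0

/-- `θ t`, `t ≥ 0`, is a bounded, compactly supported solution in the sense of distributions of
`∂ₜθ + u · ∇θ = 0`, `u = k * θ`, with initial data `θ₀`. (Since `div u = 0`, the distribution
`u · ∇θ` is `div (u θ)`.) Bounds and supports are locally uniform in time.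
A distributional solution is determined up to a null set of times, and has exactly one weak-*
continuous representative; the field `weakStarContinuous` chooses it, so that `θ t` is meaningful
for each `t ≥ 0`. Values of `θ t` for `t < 0` play no role. -/
structure IsSolution (θ₀ : Cylinder → ℝ) (θ : ℝ → Cylinder → ℝ) : Prop where
  measurable : AEStronglyMeasurable (fun p : ℝ × Cylinder => θ p.1 p.2)
    (volume.restrict (Ici (0 : ℝ) ×ˢ (univ : Set Cylinder)))
  measurable_slice : ∀ t : ℝ, 0 ≤ t → AEStronglyMeasurable (θ t) volume
  locallyBounded : ∀ T : ℝ, ∃ M : ℝ, ∀ t ∈ Icc 0 T, ∀ᵐ z : Cylinder, |θ t z| ≤ M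
  locallyCompactSupport : ∀ T : ℝ, ∃ K : Set Cylinder, IsCompact K ∧
    ∀ t ∈ Icc 0 T, essSupport (θ t) ⊆ K
  weakStarContinuous : ∀ g : Cylinder → ℝ, Integrable g volume →
    ContinuousOn (fun t => ∫ z, θ t z * g z) (Ici 0)
  distributional : ∀ φ : ℝ × Cylinder → ℝ, IsTestFunction φ →
    (∫ t in Ioi (0 : ℝ), ∫ z : Cylinder,
        θ t z * (dt φ t z + u₁ (θ t) z * dx φ t z + u₂ (θ t) z * dy φ t z))
      + ∫ z : Cylinder, θ₀ z * φ (0, z) = 0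

end CylEuler

/-! The Green function `log (cosh x - cos y) / 2` grows like `|x| / 2`, so the interaction energy
`∫∫ θ(z) G(z - ξ) θ(ξ)` controls the first moment. Let `θ ≥ 0` have mass `m` and centre `0`. Then `m
x` is the integral of `(x - ξ₁) θ(ξ)`, hence `m |x| ≤ ∫ |x - ξ₁| θ(ξ) dξ`, and `|x| ≤ 2 G + 10 + 4
wtLoc` with `wtLoc` integrable (`abs_le_green`). Integration against `θ` bounds `m ∫ |x| θ` by `2 E
+ m (10 m + 4 ‖θ‖ ∫ wtLoc)` (`Dens.mass_mul_moment_le`). Mass, centre and energy are conserved and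
the sup norm does not grow, so everything is estimated at time `0`, where `|x - ξ₁| ≤ d` on the
support (`Dens.energy_le`, `Dens.mass_le`). Every term carries a factor `m`, which is divided out.

The labour is to obtain these facts for a distributional solution. Test functions `χ(t) g(z)` reduce
the equation to `∫ θ_t g = ∫ θ₀ g + ∫₀ᵗ rate` (`IsSolution.pairing_eq`). Mass and centre follow from
`g = 1` and `g = x`; for the latter, oddness of `k₁` makes the rate vanish. For the energy, the
denominator is regularised by `δ = σ ^ 4`. The differential of `green * θ` annihilates the
regularised velocity of the same `θ`, so over `n` time steps the energy changes by `O(σ) + O(1/n)`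
(`IsSolution.abs_energy_sub_zero_le`).

Non-negativity and the upper bound are proved by duality, without constructing a flow. A test
function is pulled back along an Euler polygon of the regularised velocity (`IsSolution.polygon`).
Composition keeps it non-negative, and incompressibility preserves its integral to second order.
Once the number of steps tends to infinity, the remaining error is `σ` times the growth `exp (H L)`
of the gradient of the test function. Here `L` is only logarithmic in `σ`, because the Biot-Savart
velocity is almost Lipschitz; for short `H` the error is a positive power of `σ` and vanishes
(`IsSolution.posTest_add`). The short steps are then iterated. The a priori bounds `M`, `R` of `θ`
on a time interval enter only errors that tend to `0`, so they do not appear in the final constant.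
-/

namespace CylEuler

/-! ### Calculus on the cylinder through its covering plane. -/

/-- The covering map of the cylinder by the plane. -/
noncomputable def proj (p : ℝ × ℝ) : Cylinder := (p.1, (p.2 : AddCircle (2 * Real.pi)))

lemma proj_add (p q : ℝ × ℝ) : proj (p + q) = proj p + proj q := by
  simp [proj]

lemma proj_sub (p q : ℝ × ℝ) : proj (p - q) = proj p - proj q := by
  simp [proj]

lemma proj_fst (p : ℝ × ℝ) : (proj p).1 = p.1 := rfl

lemma isOpenQuotientMap_proj : IsOpenQuotientMap proj := by
  have h : IsOpenQuotientMap (fun y : ℝ => (y : AddCircle (2 * Real.pi))) :=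
    QuotientAddGroup.isOpenQuotientMap_mk
  exact IsOpenQuotientMap.prodMap IsOpenQuotientMap.id h

lemma proj_surjective : Function.Surjective proj := isOpenQuotientMap_proj.surjective

section Grad

variable {E : Type} [NormedAddCommGroup E] [NormedSpace ℝ E]

/-- The periodic lift to the plane of a function on the cylinder. -/
noncomputable def lift (F : Cylinder → E) (p : ℝ × ℝ) : E := F (proj p)

/-- The differential of a function on the cylinder. -/
noncomputable def grad (F : Cylinder → E) (z : Cylinder) : ℝ × ℝ →L[ℝ] E :=
  fderiv ℝ (fun q => F (z + proj q)) 0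

/-- Smooth functions on the cylinder. -/
def Smooth (F : Cylinder → E) : Prop := ContDiff ℝ ∞ (lift F)

lemma grad_proj (F : Cylinder → E) (p : ℝ × ℝ) : grad F (proj p) = fderiv ℝ (lift F) p := by
  have h : (fun q => F (proj p + proj q)) = fun q => lift F (p + q) := by
    funext q; rw [← proj_add]; rfl
  rw [grad, h, fderiv_comp_add_left, add_zero]

lemma lift_grad (F : Cylinder → E) : lift (grad F) = fderiv ℝ (lift F) :=
  funext fun p => grad_proj F p

omit [NormedSpace ℝ E] in
lemma continuous_of_lift {F : Cylinder → E} (h : Continuous (lift F)) : Continuous F :=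
  isOpenQuotientMap_proj.isQuotientMap.continuous_iff.2 h

lemma Smooth.continuous {F : Cylinder → E} (h : Smooth F) : Continuous F :=
  continuous_of_lift (ContDiff.continuous h)

lemma Smooth.differentiable {F : Cylinder → E} (h : Smooth F) : Differentiable ℝ (lift F) :=
  ContDiff.differentiable h (by simp)

lemma Smooth.grad {F : Cylinder → E} (h : Smooth F) : Smooth (grad F) := by
  unfold Smooth at *
  rw [lift_grad]
  exact (contDiff_infty_iff_fderiv.1 h).2

lemma Smooth.hasFDerivAt {F : Cylinder → E} (h : Smooth F) (p : ℝ × ℝ) :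
    HasFDerivAt (lift F) (CylEuler.grad F (proj p)) p := by
  rw [grad_proj]; exact (h.differentiable p).hasFDerivAt

lemma grad_eq_of_hasFDerivAt {F : Cylinder → E} {p : ℝ × ℝ} {L : ℝ × ℝ →L[ℝ] E}
    (h : HasFDerivAt (lift F) L p) : grad F (proj p) = L := by
  rw [grad_proj]; exact h.fderiv

lemma Smooth.reflect {F : Cylinder → E} (h : Smooth F) (z : Cylinder) :
    Smooth (fun ξ => F (z - ξ)) := by
  obtain ⟨p, rfl⟩ := proj_surjective z
  have : lift (fun ξ => F (proj p - ξ)) = fun q => lift F (p - q) := by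
    funext q; simp [lift, proj_sub]
  rw [Smooth, this]
  exact ContDiff.comp (g := lift F) h (contDiff_const.sub contDiff_id)

lemma norm_sub_le_of_grad {F : Cylinder → E} (h : Differentiable ℝ (lift F)) {C : ℝ}
    (hC : ∀ z, ‖grad F z‖ ≤ C) (p q : ℝ × ℝ) : ‖lift F p - lift F q‖ ≤ C * ‖p - q‖ := by
  refine Convex.norm_image_sub_le_of_norm_fderiv_le (𝕜 := ℝ) (s := univ)
    (fun x _ => h x) (fun x _ => ?_) convex_univ (mem_univ _) (mem_univ _)
  rw [← grad_proj]; exact hC _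

lemma norm_grad_le_of_lipschitz {F : Cylinder → E} {C : ℝ} (hC0 : 0 ≤ C)
    (h : ∀ p q, ‖lift F p - lift F q‖ ≤ C * ‖p - q‖) (z : Cylinder) : ‖grad F z‖ ≤ C := by
  obtain ⟨p, rfl⟩ := proj_surjective z
  rw [grad_proj]
  have : LipschitzWith (Real.toNNReal C) (lift F) := by
    refine LipschitzWith.of_dist_le_mul fun p q => ?_
    rw [dist_eq_norm, dist_eq_norm, Real.coe_toNNReal C hC0]; exact h p q
  have h2 := norm_fderiv_le_of_lipschitz ℝ (x₀ := p) this
  rwa [Real.coe_toNNReal C hC0] at h2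

lemma Smooth.exists_bound {F : Cylinder → E} (h : Smooth F) (R : ℝ) :
    ∃ C, 0 ≤ C ∧ ∀ z : Cylinder, |z.1| ≤ R → ‖F z‖ ≤ C := by
  have hK : IsCompact ((Icc (-R) R) ×ˢ (univ : Set (AddCircle (2 * Real.pi)))) :=
    isCompact_Icc.prod isCompact_univ
  obtain ⟨C, hC⟩ := hK.exists_bound_of_continuousOn h.continuous.continuousOn
  exact ⟨max C 0, le_max_right _ _, fun z hz =>
    (hC z ⟨abs_le.1 hz, mem_univ _⟩).trans (le_max_left _ _)⟩

end Grad

/-! ### Bounded densities of bounded horizontal support. -/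

/-- Densities bounded by `M` and supported in `|x| ≤ R`. -/
structure Dens (M R : ℝ) (f : Cylinder → ℝ) : Prop where
  meas : AEStronglyMeasurable f volume
  bound : ∀ᵐ z, |f z| ≤ M
  supp : ∀ᵐ z : Cylinder, R < |z.1| → f z = 0

/-- The part `|x| ≤ R` of the cylinder. -/
def strip (R : ℝ) : Set Cylinder := {z | |z.1| ≤ R}

lemma measurableSet_strip (R : ℝ) : MeasurableSet (strip R) :=
  measurableSet_le (measurable_fst.abs) measurable_const

lemma volume_slab (a b : ℝ) :
    volume ((Icc a b) ×ˢ (univ : Set (AddCircle (2 * Real.pi)))) =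
      ENNReal.ofReal (b - a) * ENNReal.ofReal (2 * Real.pi) := by
  rw [Measure.volume_eq_prod, Measure.prod_prod, Real.volume_Icc, AddCircle.measure_univ]

lemma strip_eq (R : ℝ) : strip R = (Icc (-R) R) ×ˢ univ := by
  ext z; simp [strip, abs_le]

lemma volume_strip_lt_top (R : ℝ) : volume (strip R) < (⊤ : ℝ≥0∞) := by
  rw [strip_eq, volume_slab]; exact ENNReal.mul_lt_top ENNReal.ofReal_lt_top ENNReal.ofReal_lt_top

lemma volume_real_strip {R : ℝ} (hR : 0 ≤ R) : volume.real (strip R) = 4 * Real.pi * R := by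
  rw [Measure.real, strip_eq, volume_slab, ENNReal.toReal_mul, ENNReal.toReal_ofReal (by linarith),
    ENNReal.toReal_ofReal Real.two_pi_pos.le]; ring

lemma integrable_indicator_strip (R : ℝ) (c : ℝ) :
    Integrable ((strip R).indicator fun _ => c) (volume : Measure Cylinder) :=
  (integrable_indicator_iff (measurableSet_strip R)).2
    (integrableOn_const (volume_strip_lt_top R).ne)

instance : (volume : Measure Cylinder).IsAddHaarMeasure := by
  rw [Measure.volume_eq_prod]; infer_instance

namespace Dens

variable {M R : ℝ} {f : Cylinder → ℝ}

lemma abs_le_indicator (h : Dens M R f) : ∀ᵐ z, |f z| ≤ (strip R).indicator (fun _ => M) z := by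
  filter_upwards [h.bound, h.supp] with z h1 h2
  by_cases hz : z ∈ strip R
  · simpa [hz] using h1
  · rw [h2 (not_le.1 hz)]; simp [hz]

lemma M_nonneg (h : Dens M R f) : 0 ≤ M := by
  obtain ⟨z, hz⟩ := h.bound.exists
  exact (abs_nonneg _).trans hz

lemma integrable (h : Dens M R f) : Integrable f volume :=
  (integrable_indicator_strip R M).mono' h.meas h.abs_le_indicator

lemma integral_abs_le (h : Dens M R f) (hR : 0 ≤ R) : ∫ z, |f z| ≤ 4 * Real.pi * R * M := by
  calc ∫ z, |f z| ≤ ∫ z, (strip R).indicator (fun _ => M) z :=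
        integral_mono_ae h.integrable.abs (integrable_indicator_strip R M) h.abs_le_indicator
    _ = _ := by
        rw [integral_indicator (measurableSet_strip R), setIntegral_const, volume_real_strip hR,
          smul_eq_mul]

lemma integrable_smul {E : Type} [NormedAddCommGroup E] [NormedSpace ℝ E] (h : Dens M R f)
    {g : Cylinder → E} (hg : AEStronglyMeasurable g volume) {C : ℝ}
    (hC : ∀ z : Cylinder, |z.1| ≤ R → ‖g z‖ ≤ C) :
    Integrable (fun z => f z • g z) volume := by
  refine (h.integrable.abs.mul_const C).mono' (h.meas.smul hg) ?_
  filter_upwards [h.supp] with z hz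
  rw [norm_smul, Real.norm_eq_abs]
  by_cases hzR : |z.1| ≤ R
  · gcongr; exact hC z hzR
  · simp [hz (not_le.1 hzR)]

lemma norm_integral_smul_le {E : Type} [NormedAddCommGroup E] [NormedSpace ℝ E] (h : Dens M R f)
    (hR : 0 ≤ R) {g : Cylinder → E} {C : ℝ} (hC0 : 0 ≤ C)
    (hC : ∀ z : Cylinder, |z.1| ≤ R → ‖g z‖ ≤ C) :
    ‖∫ z, f z • g z‖ ≤ 4 * Real.pi * R * M * C := by
  calc ‖∫ z, f z • g z‖ ≤ ∫ z, |f z| * C := by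
        refine norm_integral_le_of_norm_le (h.integrable.abs.mul_const C) ?_
        filter_upwards [h.supp] with z hz
        rw [norm_smul, Real.norm_eq_abs]
        by_cases hzR : |z.1| ≤ R
        · gcongr; exact hC z hzR
        · simp [hz (not_le.1 hzR)]
    _ ≤ _ := by
        rw [integral_mul_const]; gcongr; exact h.integral_abs_le hR

lemma integrable_mul_weight (h : Dens M R f) {H : Cylinder → ℝ} (hH : Integrable H volume) :
    Integrable (fun ξ => |f ξ| * H ξ) volume := by
  refine hH.bdd_mul (c := M) h.meas.norm ?_
  filter_upwards [h.bound] with z hz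
  simpa using hz

/-- A singular weight is paired with the sup bound of the density. Reflection and translation
invariance of the measure make the result uniform in `z`. -/
lemma integral_weight_le (h : Dens M R f) {H : Cylinder → ℝ} (hH : Integrable H volume)
    (hH0 : ∀ z, 0 ≤ H z) (z : Cylinder) : ∫ ξ, |f ξ| * H (z - ξ) ≤ M * ∫ ξ, H ξ := by
  have hHz : Integrable (fun ξ => H (z - ξ)) volume := hH.comp_sub_left z
  rw [← integral_sub_left_eq_self H volume z, ← integral_const_mul]
  refine integral_mono_ae (h.integrable_mul_weight hHz) (hHz.const_mul M) ?_
  filter_upwards [h.bound] with ξ hξ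
  exact mul_le_mul_of_nonneg_right hξ (hH0 _)

end Dens

/-! ### Convolution of a density with a smooth kernel. -/

section Conv

variable {E : Type} [NormedAddCommGroup E] [NormedSpace ℝ E]

/-- Convolution on the cylinder of a kernel with a density. -/
noncomputable def conv (K : Cylinder → E) (f : Cylinder → ℝ) (z : Cylinder) : E :=
  ∫ ξ, f ξ • K (z - ξ)

lemma Dens.integrable_conv {M R : ℝ} {f : Cylinder → ℝ} (h : Dens M R f) {K : Cylinder → E}
    (hK : Smooth K) (z : Cylinder) : Integrable (fun ξ => f ξ • K (z - ξ)) volume := by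
  obtain ⟨C, _, hC⟩ := hK.exists_bound (|z.1| + R)
  refine h.integrable_smul (C := C)
    (hK.continuous.comp (continuous_const.sub continuous_id)).aestronglyMeasurable fun ξ hξ =>
      hC _ ?_
  exact (abs_sub _ _).trans (by linarith)

/-- The derivative falls on the kernel, so the density needs no regularity. For `q` in the unit ball
about `p`, the points `proj q - ξ` with `ξ` in the support stay in a fixed strip, which gives the
domination. -/
lemma Dens.hasFDerivAt_conv {M R : ℝ} {f : Cylinder → ℝ} (h : Dens M R f) {K : Cylinder → E}
    (hK : Smooth K) (p : ℝ × ℝ) :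
    HasFDerivAt (lift (conv K f)) (conv (grad K) f (proj p)) p := by
  obtain ⟨C, hC0, hC⟩ := hK.grad.exists_bound (|p.1| + 1 + R)
  refine hasFDerivAt_integral_of_dominated_of_fderiv_le (𝕜 := ℝ) (μ := volume)
    (F := fun q ξ => f ξ • K (proj q - ξ)) (F' := fun q ξ => f ξ • grad K (proj q - ξ))
    (bound := fun ξ => |f ξ| * C) (Metric.ball_mem_nhds p one_pos)
    (Eventually.of_forall fun q => (h.integrable_conv hK _).aestronglyMeasurable)
    (h.integrable_conv hK _) (h.integrable_conv hK.grad _).aestronglyMeasurable ?_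
    (h.integrable.abs.mul_const C) ?_
  · filter_upwards [h.supp] with ξ hξ q hq
    rw [norm_smul, Real.norm_eq_abs]
    by_cases hzR : |ξ.1| ≤ R
    · gcongr
      apply hC
      have h1 : |q.1 - p.1| < 1 := by
        have := (norm_fst_le (q - p)).trans_lt (mem_ball_iff_norm.1 hq)
        simpa using this
      calc |(proj q - ξ).1| = |p.1 + (q.1 - p.1) - ξ.1| := by simp [proj]
        _ ≤ |p.1| + |q.1 - p.1| + |ξ.1| := (abs_sub _ _).trans (by gcongr; exact abs_add_le _ _)
        _ ≤ _ := by linarith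
    · simp [hξ (not_le.1 hzR)]
  · refine Eventually.of_forall fun ξ q _ => HasFDerivAt.const_smul ?_ (f ξ)
    obtain ⟨r, rfl⟩ := proj_surjective ξ
    have h1 := hK.hasFDerivAt (q - r)
    rw [proj_sub] at h1
    have h2 := h1.comp q ((hasFDerivAt_id q).sub_const r)
    simp only [ContinuousLinearMap.comp_id] at h2
    refine h2.congr_of_eventuallyEq (Eventually.of_forall fun x => ?_)
    simp [lift, proj_sub]

lemma Dens.grad_conv {M R : ℝ} {f : Cylinder → ℝ} (h : Dens M R f) {K : Cylinder → E}
    (hK : Smooth K) : grad (conv K f) = conv (grad K) f := by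
  funext z
  obtain ⟨p, rfl⟩ := proj_surjective z
  exact grad_eq_of_hasFDerivAt (h.hasFDerivAt_conv hK p)

end Conv

/-- The target space is quantified inside the induction, since differentiating replaces `K` by `grad
K`, whose values are linear maps. -/
lemma Dens.contDiff_conv {M R : ℝ} {f : Cylinder → ℝ} (h : Dens M R f) (n : ℕ) :
    ∀ (E : Type) [NormedAddCommGroup E] [NormedSpace ℝ E] (K : Cylinder → E), Smooth K →
      ContDiff ℝ n (lift (conv K f)) := by
  induction n with
  | zero =>
    intro E _ _ K hK
    exact contDiff_zero.2 (continuous_iff_continuousAt.2 fun p =>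
      (h.hasFDerivAt_conv hK p).continuousAt)
  | succ n ih =>
    intro E _ _ K hK
    rw [Nat.cast_succ, contDiff_succ_iff_fderiv]
    refine ⟨fun p => (h.hasFDerivAt_conv hK p).differentiableAt, by simp, ?_⟩
    rw [← lift_grad, h.grad_conv hK]
    exact ih _ _ hK.grad

lemma Dens.smooth_conv {M R : ℝ} {f : Cylinder → ℝ} (h : Dens M R f) {E : Type}
    [NormedAddCommGroup E] [NormedSpace ℝ E] {K : Cylinder → E} (hK : Smooth K) :
    Smooth (conv K f) :=
  contDiff_infty.2 fun n => h.contDiff_conv n E K hK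

/-! ### The kernel, its regularisation and their pointwise bounds. -/

lemma cosC_coe (y : ℝ) : cosC (y : AddCircle (2 * Real.pi)) = Real.cos y := rfl

lemma continuous_sinC : Continuous sinC :=
  QuotientAddGroup.isOpenQuotientMap_mk.isQuotientMap.continuous_iff.2 Real.continuous_sin

lemma continuous_cosC : Continuous cosC :=
  QuotientAddGroup.isOpenQuotientMap_mk.isQuotientMap.continuous_iff.2 Real.continuous_cos

lemma sinC_sq_add_cosC_sq (y : AddCircle (2 * Real.pi)) : sinC y ^ 2 + cosC y ^ 2 = 1 := by
  induction y using QuotientAddGroup.induction_on with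
  | H y => exact Real.sin_sq_add_cos_sq y

lemma sinC_neg (y : AddCircle (2 * Real.pi)) : sinC (-y) = -sinC y := by
  induction y using QuotientAddGroup.induction_on with
  | H y => exact Real.sin_neg y

lemma cosC_neg (y : AddCircle (2 * Real.pi)) : cosC (-y) = cosC y := by
  induction y using QuotientAddGroup.induction_on with
  | H y => exact Real.cos_neg y

lemma cosC_le_one (y : AddCircle (2 * Real.pi)) : cosC y ≤ 1 := by
  nlinarith [sinC_sq_add_cosC_sq y, sq_nonneg (sinC y)]

lemma neg_one_le_cosC (y : AddCircle (2 * Real.pi)) : -1 ≤ cosC y := by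
  nlinarith [sinC_sq_add_cosC_sq y, sq_nonneg (sinC y)]

/-- `cosh x - cos y`, comparable to the squared distance to the origin. -/
noncomputable def den (z : Cylinder) : ℝ := Real.cosh z.1 - cosC z.2

lemma den_nonneg (z : Cylinder) : 0 ≤ den z := by
  have := Real.one_le_cosh z.1; have := cosC_le_one z.2; unfold den; linarith

lemma cosh_eq_den (z : Cylinder) : Real.cosh z.1 = den z + cosC z.2 := by unfold den; ring

lemma continuous_den : Continuous den :=
  (Real.continuous_cosh.comp continuous_fst).sub (continuous_cosC.comp continuous_snd)

lemma den_neg (z : Cylinder) : den (-z) = den z := by simp [den, cosC_neg]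

lemma half_sq_le_cosh_sub_one (x : ℝ) : x ^ 2 / 2 ≤ Real.cosh x - 1 := by
  have h1 : Real.cosh x = 1 + 2 * Real.sinh (x / 2) ^ 2 := by
    have h := Real.cosh_two_mul (x / 2)
    rw [mul_div_cancel₀ x two_ne_zero, Real.cosh_sq] at h
    rw [h]; ring
  have h2 : (x / 2) ^ 2 ≤ Real.sinh (x / 2) ^ 2 := by
    rw [← sq_abs, ← sq_abs (Real.sinh _), Real.abs_sinh]
    exact pow_le_pow_left₀ (abs_nonneg _) (Real.self_le_sinh_iff.2 (abs_nonneg _)) 2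
  linarith

lemma sq_add_le_den (z : Cylinder) : z.1 ^ 2 / 2 + (1 - cosC z.2) ≤ den z := by
  have := half_sq_le_cosh_sub_one z.1; unfold den; linarith

lemma sinC_sq_le (z : Cylinder) : sinC z.2 ^ 2 ≤ 2 * den z := by
  have h1 := sinC_sq_add_cosC_sq z.2
  have h2 := cosC_le_one z.2
  have h3 := neg_one_le_cosC z.2
  have h4 := sq_add_le_den z
  nlinarith [sq_nonneg z.1]

/-- `sinh² = cosh² - 1` and `cosh x ≤ den + 1`. The numerator of `K₁` obeys the same inequality, so
both components are treated by one estimate. -/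
lemma sinh_sq_le (z : Cylinder) : Real.sinh z.1 ^ 2 ≤ den z * (den z + 2) := by
  have h1 := Real.cosh_sq z.1
  have h2 := cosC_le_one z.2
  have h3 := neg_one_le_cosC z.2
  have h4 := Real.one_le_cosh z.1
  have h5 := cosh_eq_den z
  nlinarith [den_nonneg z]

/-- Horizontal component of the Biot-Savart kernel with the denominator regularised. -/
noncomputable def K₁ (δ : ℝ) (z : Cylinder) : ℝ := -sinC z.2 / (2 * (den z + δ))

/-- Vertical component of the Biot-Savart kernel with the denominator regularised. -/
noncomputable def K₂ (δ : ℝ) (z : Cylinder) : ℝ := Real.sinh z.1 / (2 * (den z + δ))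

/-- The regularised Green function. -/
noncomputable def green (δ : ℝ) (z : Cylinder) : ℝ := Real.log (den z + δ) / 2

lemma K₁_zero : K₁ 0 = k₁ := by funext z; simp [K₁, k₁, den]

lemma K₂_zero : K₂ 0 = k₂ := by funext z; simp [K₂, k₂, den]

lemma K₁_neg (δ : ℝ) (z : Cylinder) : K₁ δ (-z) = -K₁ δ z := by
  simp only [K₁, den_neg, Prod.snd_neg, sinC_neg]; ring

lemma green_neg (δ : ℝ) (z : Cylinder) : green δ (-z) = green δ z := by simp [green, den_neg]

/-- The singular weight `(cosh x - cos y) ^ (-3/4)`. -/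
noncomputable def wt (z : Cylinder) : ℝ := (den z ^ (-(1 / 4) : ℝ)) ^ 3

lemma wt_nonneg (z : Cylinder) : 0 ≤ wt z :=
  pow_nonneg (Real.rpow_nonneg (den_nonneg z) _) 3

/-- With `r = den ^ (-1/4)` the kernel has size `r ^ 2` near the origin and the weight is `r ^ 3`.
The comparisons below become polynomial inequalities in `r`. -/
lemma exists_wt_root {z : Cylinder} (h : 0 < den z) :
    ∃ r : ℝ, 0 < r ∧ den z * r ^ 4 = 1 ∧ wt z = r ^ 3 := by
  refine ⟨den z ^ (-(1 / 4) : ℝ), Real.rpow_pos_of_pos h _, ?_, rfl⟩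
  rw [← Real.rpow_natCast, ← Real.rpow_mul h.le]
  norm_num
  rw [Real.rpow_neg_one]
  exact mul_inv_cancel₀ h.ne'

lemma abs_div_le_of_sq_le {N D r δ : ℝ} (hr : 0 < r) (hDr : D * r ^ 4 = 1) (hD : 0 < D)
    (hN : N ^ 2 ≤ D * (D + 2)) (hδ : 0 ≤ δ) :
    |N / (2 * (D + δ))| ≤ 2 + r ^ 3 := by
  have hle : |N| ≤ D * (1 + 2 * r ^ 2) := by
    refine abs_le_of_sq_le_sq ?_ (by positivity)
    have : D * (D + 2) = D ^ 2 * (1 + 2 * r ^ 4) := by linear_combination (-2 * D) * hDr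
    rw [this] at hN
    refine hN.trans ?_
    rw [mul_pow]
    gcongr
    nlinarith [sq_nonneg r, sq_nonneg (r ^ 2)]
  rw [abs_div, abs_of_pos (by positivity : 0 < 2 * (D + δ)), div_le_iff₀ (by positivity)]
  have h1 : 1 + 2 * r ^ 2 ≤ 2 * (2 + r ^ 3) := by
    nlinarith [sq_nonneg (r - 1), mul_nonneg hr.le (sq_nonneg (r - 1))]
  calc |N| ≤ D * (1 + 2 * r ^ 2) := hle
    _ ≤ D * (2 * (2 + r ^ 3)) := by gcongr
    _ ≤ _ := by nlinarith [pow_pos hr 3]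

/-- With `q = σ r`, the relative error `σ⁴ / (D + σ⁴)` equals `q⁴ / (1 + q⁴) ≤ q`. One power of `r`
is thus traded for a factor `σ`: the singularity worsens from `r²` to `r³`, still integrable, and
the error is linear in `σ`. This is why `δ` is taken to be a fourth power. -/
lemma abs_div_sub_div_le {N D r σ : ℝ} (hr : 0 < r) (hDr : D * r ^ 4 = 1) (hD : 0 < D)
    (hN : N ^ 2 ≤ D * (D + 2)) (hσ : 0 < σ) :
    |N / (2 * (D + 0)) - N / (2 * (D + σ ^ 4))| ≤ σ * (2 + 2 * r ^ 3) := by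
  have hle : |N| ≤ D * (1 + 2 * r ^ 2) := by
    refine abs_le_of_sq_le_sq ?_ (by positivity)
    have : D * (D + 2) = D ^ 2 * (1 + 2 * r ^ 4) := by linear_combination (-2 * D) * hDr
    rw [this] at hN
    refine hN.trans ?_
    rw [mul_pow]
    gcongr
    nlinarith [sq_nonneg r, sq_nonneg (r ^ 2)]
  have heq : N / (2 * (D + 0)) - N / (2 * (D + σ ^ 4)) =
      N / D * ((σ * r) ^ 4 / (1 + (σ * r) ^ 4)) / 2 := by
    have h1 : D = (r ^ 4)⁻¹ := eq_inv_of_mul_eq_one_left hDr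
    rw [h1]
    field_simp
    ring
  have hq : ∀ q : ℝ, 0 < q → q ^ 4 / (1 + q ^ 4) ≤ q := by
    intro q hq
    rw [div_le_iff₀ (by positivity)]
    rcases le_total q 1 with h | h
    · nlinarith [pow_pos hq 3, pow_le_one₀ hq.le h (n := 3), pow_pos hq 5]
    · nlinarith [pow_pos hq 4]
  have hND : |N / D| ≤ 1 + 2 * r ^ 2 := by
    rw [abs_div, abs_of_pos hD, div_le_iff₀ hD]; linarith
  rw [heq, abs_div, abs_mul, abs_of_pos (by positivity : (0:ℝ) < (σ * r) ^ 4 / (1 + (σ * r) ^ 4)),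
    abs_of_pos (by norm_num : (0:ℝ) < 2), div_le_iff₀ two_pos]
  calc |N / D| * ((σ * r) ^ 4 / (1 + (σ * r) ^ 4)) ≤ (1 + 2 * r ^ 2) * (σ * r) := by
        gcongr; exact hq _ (by positivity)
    _ = σ * (r + 2 * r ^ 3) := by ring
    _ ≤ _ := by
        have : r ≤ 1 + r ^ 3 := by nlinarith [sq_nonneg (r - 1), mul_nonneg hr.le (sq_nonneg (r - 1))]
        nlinarith [pow_pos hr 3]

/-- At the origin both numerators vanish, so the kernels take the value `0` there even for `δ = 0`,
and the pointwise bounds hold without exception. -/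
lemma sinC_sinh_of_den_eq_zero {z : Cylinder} (h : den z = 0) :
    sinC z.2 = 0 ∧ Real.sinh z.1 = 0 := by
  have h1 := sinC_sq_le z
  have h2 := sinh_sq_le z
  rw [h] at h1 h2
  constructor <;> nlinarith

lemma sinC_sq_le' (z : Cylinder) : (-sinC z.2) ^ 2 ≤ den z * (den z + 2) := by
  nlinarith [sinC_sq_le z, den_nonneg z]

lemma abs_K₁_le {δ : ℝ} (hδ : 0 ≤ δ) (z : Cylinder) : |K₁ δ z| ≤ 2 + wt z := by
  rcases (den_nonneg z).eq_or_lt with h | h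
  · simp only [K₁, (sinC_sinh_of_den_eq_zero h.symm).1]; simpa using by linarith [wt_nonneg z]
  · obtain ⟨r, hr, h1, h2⟩ := exists_wt_root h
    rw [h2]; exact abs_div_le_of_sq_le hr h1 h (sinC_sq_le' z) hδ

lemma abs_K₂_le {δ : ℝ} (hδ : 0 ≤ δ) (z : Cylinder) : |K₂ δ z| ≤ 2 + wt z := by
  rcases (den_nonneg z).eq_or_lt with h | h
  · simp only [K₂, (sinC_sinh_of_den_eq_zero h.symm).2]; simpa using by linarith [wt_nonneg z]
  · obtain ⟨r, hr, h1, h2⟩ := exists_wt_root h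
    rw [h2]; exact abs_div_le_of_sq_le hr h1 h (sinh_sq_le z) hδ

lemma abs_K₁_sub_le {σ : ℝ} (hσ : 0 < σ) (z : Cylinder) :
    |K₁ 0 z - K₁ (σ ^ 4) z| ≤ σ * (2 + 2 * wt z) := by
  rcases (den_nonneg z).eq_or_lt with h | h
  · simp only [K₁, (sinC_sinh_of_den_eq_zero h.symm).1]
    have := wt_nonneg z
    simpa using by positivity
  · obtain ⟨r, hr, h1, h2⟩ := exists_wt_root h
    rw [h2]; exact abs_div_sub_div_le hr h1 h (sinC_sq_le' z) hσ

lemma abs_K₂_sub_le {σ : ℝ} (hσ : 0 < σ) (z : Cylinder) :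
    |K₂ 0 z - K₂ (σ ^ 4) z| ≤ σ * (2 + 2 * wt z) := by
  rcases (den_nonneg z).eq_or_lt with h | h
  · simp only [K₂, (sinC_sinh_of_den_eq_zero h.symm).2]
    have := wt_nonneg z
    simpa using by positivity
  · obtain ⟨r, hr, h1, h2⟩ := exists_wt_root h
    rw [h2]; exact abs_div_sub_div_le hr h1 h (sinh_sq_le z) hσ

/-! ### Integrability of the weights -/

lemma measurable_wt : Measurable wt :=
  (continuous_den.measurable.pow_const _).pow_const 3

/-- The singular part of the weight `wt`. -/
noncomputable def wtLoc : Cylinder → ℝ := (strip 1).indicator wt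

lemma wtLoc_nonneg (z : Cylinder) : 0 ≤ wtLoc z := indicator_nonneg (fun z _ => wt_nonneg z) z

lemma half_le_den {z : Cylinder} (hz : z ∉ strip 1) : 1 / 2 ≤ den z := by
  have h1 : 1 < |z.1| := not_le.1 hz
  have := sq_add_le_den z
  have := cosC_le_one z.2
  have h2 : 1 ≤ z.1 ^ 2 := by rw [← sq_abs]; nlinarith
  linarith

lemma wt_le (z : Cylinder) : wt z ≤ 2 + wtLoc z := by
  by_cases hz : z ∈ strip 1
  · simp [wtLoc, hz]
  · have h := half_le_den hz
    obtain ⟨r, hr, h1, h2⟩ := exists_wt_root (by linarith : 0 < den z)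
    simp only [wtLoc, hz, not_false_eq_true, indicator_of_notMem, add_zero]
    rw [h2]
    by_contra! h3
    have h4 : r ^ 4 ≤ 2 := by nlinarith [pow_pos hr 4]
    have h5 : 1 ≤ r := by
      by_contra! h5
      have := pow_le_one₀ hr.le h5.le (n := 3)
      linarith
    nlinarith [pow_pos hr 3]

lemma one_sub_cos_ge {y : ℝ} (hy : |y| ≤ Real.pi) : 2 / Real.pi ^ 2 * y ^ 2 ≤ 1 - Real.cos y := by
  have := Real.cos_le_one_sub_mul_cos_sq hy
  linarith

lemma integrable_circle_iff {g : AddCircle (2 * Real.pi) → ℝ}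
    (hg : AEStronglyMeasurable g volume) :
    Integrable g volume ↔
      IntegrableOn (fun y : ℝ => g y) (Ioc (-Real.pi) (-Real.pi + 2 * Real.pi)) volume :=
  ((AddCircle.measurePreserving_mk (2 * Real.pi) (-Real.pi)).integrable_comp hg).symm

lemma integrableOn_abs_rpow (s : ℝ) (hs : -1 < s) (a : ℝ) :
    IntegrableOn (fun x : ℝ => |x| ^ s) (Icc (-a) a) volume := by
  have h0 : IntegrableOn (fun x : ℝ => |x| ^ s) (Icc 0 a) volume := by
    rw [integrableOn_Icc_iff_integrableOn_Ioc]
    by_cases ha : 0 ≤ a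
    · have := (intervalIntegral.intervalIntegrable_rpow' hs (a := 0) (b := a))
      rw [intervalIntegrable_iff_integrableOn_Ioc_of_le ha] at this
      refine this.congr_fun (fun x hx => ?_) measurableSet_Ioc
      simp only [abs_of_pos hx.1]
    · rw [Ioc_eq_empty (by linarith)]; simp
  have h1 : IntegrableOn (fun x : ℝ => |x| ^ s) (Icc (-a) 0) volume := by
    have := (Measure.measurePreserving_neg (volume : Measure ℝ)).integrableOn_comp_preimage
      (Homeomorph.neg ℝ).measurableEmbedding (f := fun x : ℝ => |x| ^ s) (s := Icc 0 a)
    have h2 := this.2 h0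
    simpa [Function.comp_def] using h2
  refine (h1.union h0).mono_set fun x hx => ?_
  rcases le_total x 0 with h | h
  · exact Or.inl ⟨hx.1, h⟩
  · exact Or.inr ⟨h, hx.2⟩

lemma integrable_circle_weight :
    Integrable (fun y : AddCircle (2 * Real.pi) =>
      ((1 - cosC y) ^ (1 / 2 : ℝ)) ^ (-(3 / 4) : ℝ)) volume := by
  have hm : Measurable (fun y : AddCircle (2 * Real.pi) =>
      ((1 - cosC y) ^ (1 / 2 : ℝ)) ^ (-(3 / 4) : ℝ)) :=
    ((measurable_const.sub continuous_cosC.measurable).pow_const _).pow_const _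
  rw [integrable_circle_iff hm.aestronglyMeasurable]
  have h := (integrableOn_abs_rpow (-(3 / 4)) (by norm_num) Real.pi).const_mul
    ((1 / Real.pi) ^ (-(3 / 4) : ℝ))
  have hs : Ioc (-Real.pi) (-Real.pi + 2 * Real.pi) ⊆ Icc (-Real.pi) Real.pi :=
    fun x hx => ⟨hx.1.le, by linarith [hx.2]⟩
  have h0 : ∀ᵐ y : ℝ ∂volume, y ≠ 0 := by simp [ae_iff]
  refine Integrable.mono' (IntegrableOn.mono_set h hs)
    (hm.comp (AddCircle.measurable_mk' (a := 2 * Real.pi))).aestronglyMeasurable ?_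
  filter_upwards [ae_restrict_mem measurableSet_Ioc, ae_restrict_of_ae h0] with y hy hy0
  have hya : |y| ≤ Real.pi := abs_le.2 (hs hy)
  have hpi := Real.pi_pos
  have hq := one_sub_cos_ge hya
  have hy0' : 0 < |y| := abs_pos.2 hy0
  have hs1 : 1 / Real.pi * |y| ≤ (1 - Real.cos y) ^ (1 / 2 : ℝ) := by
    rw [← Real.sqrt_eq_rpow]
    apply Real.le_sqrt_of_sq_le
    refine le_trans ?_ hq
    rw [mul_pow, sq_abs, div_pow]
    gcongr
    norm_num
  rw [cosC_coe, Real.norm_eq_abs, abs_of_nonneg (Real.rpow_nonneg (Real.rpow_nonneg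
    (by linarith [Real.cos_le_one y]) _) _), ← Real.mul_rpow (by positivity) (abs_nonneg _)]
  exact Real.rpow_le_rpow_of_nonpos (by positivity) hs1 (by norm_num)

lemma ae_snd_ne_zero : ∀ᵐ z : Cylinder, z.1 ≠ 0 ∧ z.2 ≠ 0 := by
  have h1 : ∀ᵐ x : ℝ ∂volume, x ≠ 0 := by simp [ae_iff]
  have h2 : ∀ᵐ y : AddCircle (2 * Real.pi) ∂volume, y ≠ 0 := by
    have h := AddCircle.volume_closedBall (2 * Real.pi) (x := 0) 0
    simp only [Metric.closedBall_zero] at h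
    rw [ae_iff]
    simpa using h
  rw [Measure.volume_eq_prod]
  exact (Measure.quasiMeasurePreserving_fst.ae h1).and (Measure.quasiMeasurePreserving_snd.ae h2)

lemma cosC_lt_one {y : AddCircle (2 * Real.pi)} (hy : y ≠ 0) : cosC y < 1 := by
  refine lt_of_le_of_ne (cosC_le_one y) fun h => hy ?_
  induction y using QuotientAddGroup.induction_on with
  | H y =>
    obtain ⟨n, hn⟩ := (Real.cos_eq_one_iff y).1 h
    rw [QuotientAddGroup.eq_zero_iff]
    exact ⟨n, by simpa using hn⟩

/-- The arithmetic-geometric inequality gives `den ≥ x²/2 + s² ≥ |x| s` with `s = (1 - cos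
y)^{1/2}`. So `den ^ (-3/4)` is dominated by a product of one-variable functions, each with a
singularity of order `3/4 < 1`. -/
lemma integrable_wtLoc : Integrable wtLoc volume := by
  have hx : Integrable ((Icc (-1 : ℝ) 1).indicator fun x : ℝ => |x| ^ (-(3 / 4) : ℝ)) volume :=
    (integrable_indicator_iff measurableSet_Icc).2 (integrableOn_abs_rpow _ (by norm_num) 1)
  have hxy := hx.mul_prod integrable_circle_weight
  rw [← Measure.volume_eq_prod] at hxy
  refine hxy.mono' (measurable_wt.indicator (measurableSet_strip 1)).aestronglyMeasurable ?_
  filter_upwards [ae_snd_ne_zero] with z hz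
  by_cases hzs : z ∈ strip 1
  · have hz1 : z.1 ∈ Icc (-1 : ℝ) 1 := abs_le.1 hzs
    have hc := cosC_lt_one hz.2
    have ha : 0 < |z.1| := abs_pos.2 hz.1
    have hsq := sq_add_le_den z
    set c := 1 - cosC z.2 with hcdef
    have hc0 : 0 < c := by linarith
    have hsc : (c ^ (1 / 2 : ℝ)) ^ 2 = c := by
      rw [← Real.sqrt_eq_rpow, Real.sq_sqrt hc0.le]
    have hs0 : 0 < c ^ (1 / 2 : ℝ) := Real.rpow_pos_of_pos hc0 _
    set s := c ^ (1 / 2 : ℝ)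
    have hle : |z.1| * s ≤ den z := by
      rw [← sq_abs] at hsq
      nlinarith [sq_nonneg (|z.1| - s)]
    rw [wtLoc, indicator_of_mem hzs, indicator_of_mem hz1, Real.norm_eq_abs,
      abs_of_nonneg (wt_nonneg z), wt, ← Real.mul_rpow ha.le hs0.le, ← Real.rpow_natCast,
      ← Real.rpow_mul (den_nonneg z)]
    norm_num
    exact Real.rpow_le_rpow_of_nonpos (by positivity) hle (by norm_num)
  · have hz1 : z.1 ∉ Icc (-1 : ℝ) 1 := fun h => hzs (abs_le.2 h)
    simp [wtLoc, hzs, hz1]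

/-- The singular part of the weight `1 / (cosh x - cos y + δ)`. -/
noncomputable def invLoc (δ : ℝ) : Cylinder → ℝ := (strip 1).indicator fun z => (den z + δ)⁻¹

lemma invLoc_nonneg {δ : ℝ} (hδ : 0 < δ) (z : Cylinder) : 0 ≤ invLoc δ z :=
  indicator_nonneg (fun z _ => by have := den_nonneg z; positivity) z

lemma inv_den_le {δ : ℝ} (hδ : 0 < δ) (z : Cylinder) : (den z + δ)⁻¹ ≤ 2 + invLoc δ z := by
  by_cases hz : z ∈ strip 1
  · simp [invLoc, hz]
  · have h := half_le_den hz
    simp only [invLoc, hz, not_false_eq_true, indicator_of_notMem, add_zero]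
    rw [inv_le_comm₀ (by linarith) two_pos]
    linarith

lemma integrable_invLoc {δ : ℝ} (hδ : 0 < δ) : Integrable (invLoc δ) volume := by
  have hc : Continuous fun z => (den z + δ)⁻¹ :=
    (continuous_den.add continuous_const).inv₀ fun z => by have := den_nonneg z; exact (by positivity : 0 < den z + δ).ne'
  refine (integrable_indicator_strip 1 δ⁻¹).mono'
    (hc.measurable.indicator (measurableSet_strip 1)).aestronglyMeasurable
    (Eventually.of_forall fun z => ?_)
  by_cases hz : z ∈ strip 1
  · have := den_nonneg z
    simp only [invLoc, hz, indicator_of_mem]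
    rw [Real.norm_eq_abs, abs_of_pos (by positivity)]
    gcongr
    linarith
  · simp [invLoc, hz]

lemma integral_inv_sq_add_sq {b : ℝ} (hb : 0 < b) :
    Integrable (fun x : ℝ => 2 * (x ^ 2 + b ^ 2)⁻¹) volume ∧
      ∫ x : ℝ, 2 * (x ^ 2 + b ^ 2)⁻¹ = 2 * Real.pi / b := by
  have heq : (fun x : ℝ => 2 * (x ^ 2 + b ^ 2)⁻¹) =
      fun x => 2 / b ^ 2 * (fun t : ℝ => (1 + t ^ 2)⁻¹) (x / b) := by
    funext x; field_simp; ring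
  rw [heq]
  refine ⟨(integrable_inv_one_add_sq.comp_div hb.ne').const_mul _, ?_⟩
  rw [integral_const_mul, Measure.integral_comp_div (fun t : ℝ => (1 + t ^ 2)⁻¹) b,
    integral_univ_inv_one_add_sq, abs_of_pos hb, smul_eq_mul]
  field_simp

lemma integral_inv_abs_add {τ : ℝ} (hτ : 0 < τ) :
    ∫ y in (-Real.pi)..Real.pi, (|y| / Real.pi + τ)⁻¹ =
      2 * Real.pi * Real.log ((1 + τ) / τ) := by
  have hpi := Real.pi_pos
  have hc : Continuous fun y : ℝ => (|y| / Real.pi + τ)⁻¹ :=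
    ((continuous_abs.div_const _).add continuous_const).inv₀ fun y => (by positivity : 0 < |y| / Real.pi + τ).ne'
  have h1 : ∫ y in (0:ℝ)..Real.pi, (|y| / Real.pi + τ)⁻¹ = Real.pi * Real.log ((1 + τ) / τ) := by
    have : ∫ y in (0:ℝ)..Real.pi, (|y| / Real.pi + τ)⁻¹ =
        ∫ y in (0:ℝ)..Real.pi, (fun t => t⁻¹) (y / Real.pi + τ) := by
      refine intervalIntegral.integral_congr fun y hy => ?_
      rw [uIcc_of_le hpi.le] at hy
      simp only [abs_of_nonneg hy.1]
    rw [this, intervalIntegral.integral_comp_div_add (fun t : ℝ => t⁻¹) hpi.ne', zero_div, zero_add,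
      div_self hpi.ne', integral_inv_of_pos hτ (by positivity), smul_eq_mul]
  have h2 : ∫ y in (-Real.pi)..0, (|y| / Real.pi + τ)⁻¹ = ∫ y in (0:ℝ)..Real.pi, (|y| / Real.pi + τ)⁻¹ := by
    have := intervalIntegral.integral_comp_neg (a := 0) (b := Real.pi)
      (fun y : ℝ => (|y| / Real.pi + τ)⁻¹)
    simpa using this.symm
  rw [← intervalIntegral.integral_add_adjacent_intervals (b := 0) (hc.intervalIntegrable _ _)
    (hc.intervalIntegrable _ _), h2, h1]
  ring

/-- The function is about `1/|z|²` cut off at `|z| ~ σ²`, whence the logarithm. Integrating an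
arctangent derivative in `x` leaves `2π / √(1 - cos y + σ⁴)`, and the root is at least `(|y|/π +
σ²)/2`. -/
lemma integral_invLoc_le {σ : ℝ} (hσ : 0 < σ) :
    ∫ z, invLoc (σ ^ 4) z ≤ 8 * Real.pi ^ 2 * Real.log ((1 + σ ^ 2) / σ ^ 2) := by
  have hδ : 0 < σ ^ 4 := by positivity
  have hpi := Real.pi_pos
  have hint := integrable_invLoc hδ
  rw [Measure.volume_eq_prod] at hint ⊢
  rw [integral_prod_symm _ hint]
  have hb : ∀ y : AddCircle (2 * Real.pi), 0 < 1 - cosC y + σ ^ 4 := fun y => by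
    have := cosC_le_one y; linarith
  have hcont : Continuous fun y : AddCircle (2 * Real.pi) =>
      2 * Real.pi / Real.sqrt (1 - cosC y + σ ^ 4) :=
    continuous_const.div (((continuous_const.sub continuous_cosC).add continuous_const).sqrt)
      fun y => (Real.sqrt_pos.2 (hb y)).ne'
  have hinner : ∀ y : AddCircle (2 * Real.pi),
      ∫ x : ℝ, invLoc (σ ^ 4) (x, y) ≤ 2 * Real.pi / Real.sqrt (1 - cosC y + σ ^ 4) := fun y => by
    obtain ⟨h1, h2⟩ := integral_inv_sq_add_sq (Real.sqrt_pos.2 (hb y))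
    rw [← h2]
    refine integral_mono_of_nonneg (Eventually.of_forall fun x => invLoc_nonneg hδ _) h1
      (Eventually.of_forall fun x => ?_)
    have hsq := sq_add_le_den (x, y)
    simp only at hsq
    have hby := hb y
    rw [Real.sq_sqrt hby.le]
    have hle : invLoc (σ ^ 4) (x, y) ≤ (den (x, y) + σ ^ 4)⁻¹ := by
      refine indicator_le_self' (fun z _ => ?_) _
      have := den_nonneg z
      positivity
    refine hle.trans ?_
    have h3 : (x ^ 2 + (1 - cosC y + σ ^ 4)) / 2 ≤ den (x, y) + σ ^ 4 := by
      nlinarith [sq_nonneg x]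
    calc (den (x, y) + σ ^ 4)⁻¹ ≤ ((x ^ 2 + (1 - cosC y + σ ^ 4)) / 2)⁻¹ := by gcongr
      _ = 2 * (x ^ 2 + (1 - cosC y + σ ^ 4))⁻¹ := by rw [inv_div, div_eq_mul_inv]
  have hσ2 : 0 < σ ^ 2 := by positivity
  calc ∫ y : AddCircle (2 * Real.pi), ∫ x : ℝ, invLoc (σ ^ 4) (x, y)
      ≤ ∫ y : AddCircle (2 * Real.pi), 2 * Real.pi / Real.sqrt (1 - cosC y + σ ^ 4) :=
        integral_mono_of_nonneg (Eventually.of_forall fun y =>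
          integral_nonneg fun x => invLoc_nonneg hδ _)
          (hcont.integrable_of_hasCompactSupport (HasCompactSupport.of_compactSpace _))
          (Eventually.of_forall hinner)
    _ = ∫ y in (-Real.pi)..Real.pi, 2 * Real.pi / Real.sqrt (1 - Real.cos y + σ ^ 4) := by
        have := AddCircle.intervalIntegral_preimage (2 * Real.pi) (-Real.pi)
          (fun y : AddCircle (2 * Real.pi) => 2 * Real.pi / Real.sqrt (1 - cosC y + σ ^ 4))
        rw [← this, show -Real.pi + 2 * Real.pi = Real.pi by ring]
        rfl
    _ ≤ ∫ y in (-Real.pi)..Real.pi, 4 * Real.pi * (|y| / Real.pi + σ ^ 2)⁻¹ := by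
        refine intervalIntegral.integral_mono_on (by linarith) ?_ ?_ fun y hy => ?_
        · exact (hcont.comp (AddCircle.continuous_mk' (2 * Real.pi))).intervalIntegrable _ _
        · refine Continuous.intervalIntegrable (continuous_const.mul
            (((continuous_abs.div_const _).add continuous_const).inv₀ fun y => ?_)) _ _
          exact (by positivity : 0 < |y| / Real.pi + σ ^ 2).ne'
        · have hq := one_sub_cos_ge (abs_le.2 hy)
          have h4 : (|y| / Real.pi + σ ^ 2) / 2 ≤ Real.sqrt (1 - Real.cos y + σ ^ 4) := by
            apply Real.le_sqrt_of_sq_le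
            have h5 : 2 / Real.pi ^ 2 * y ^ 2 = 2 * (|y| / Real.pi) ^ 2 := by
              rw [div_pow, sq_abs]; ring
            nlinarith [sq_nonneg (|y| / Real.pi - σ ^ 2), sq_nonneg (|y| / Real.pi)]
          calc 2 * Real.pi / Real.sqrt (1 - Real.cos y + σ ^ 4)
              ≤ 2 * Real.pi / ((|y| / Real.pi + σ ^ 2) / 2) := by gcongr
            _ = _ := by field_simp; ring
    _ = _ := by
        rw [intervalIntegral.integral_const_mul, integral_inv_abs_add hσ2]; ring

/-! ### The differential of the regularised kernel. -/

/-- The linear form with the given horizontal and vertical components. -/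
noncomputable def form (a b : ℝ) : ℝ × ℝ →L[ℝ] ℝ :=
  a • ContinuousLinearMap.fst ℝ ℝ ℝ + b • ContinuousLinearMap.snd ℝ ℝ ℝ

lemma form_apply (a b : ℝ) (v : ℝ × ℝ) : form a b v = a * v.1 + b * v.2 := by simp [form]

lemma form_sub (a b c d : ℝ) : form a b - form c d = form (a - c) (b - d) := by
  ext <;> simp [form_apply]

lemma norm_form_le (a b : ℝ) : ‖form a b‖ ≤ |a| + |b| := by
  refine ContinuousLinearMap.opNorm_le_bound _ (by positivity) fun v => ?_
  rw [form_apply, Real.norm_eq_abs, add_mul]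
  refine (abs_add_le _ _).trans ?_
  rw [abs_mul, abs_mul]
  gcongr
  · exact norm_fst_le v
  · exact norm_snd_le v

/-- The regularised denominator on the plane. -/
noncomputable def denP (δ : ℝ) (p : ℝ × ℝ) : ℝ := den (proj p) + δ

lemma denP_pos {δ : ℝ} (hδ : 0 < δ) (p : ℝ × ℝ) : 0 < denP δ p := by
  have := den_nonneg (proj p); unfold denP; positivity

lemma denP_eq (δ : ℝ) (p : ℝ × ℝ) : denP δ p = Real.cosh p.1 - Real.cos p.2 + δ := rfl

lemma le_denP {δ : ℝ} (p : ℝ × ℝ) : δ ≤ denP δ p := by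
  have := den_nonneg (proj p); unfold denP; linarith

lemma contDiff_denP (δ : ℝ) : ContDiff ℝ ∞ (denP δ) :=
  ((Real.contDiff_cosh.comp contDiff_fst).sub (Real.contDiff_cos.comp contDiff_snd)).add
    contDiff_const

lemma hasFDerivAt_comp_fst {f : ℝ → ℝ} {f' : ℝ} {p : ℝ × ℝ} (h : HasDerivAt f f' p.1) :
    HasFDerivAt (fun q : ℝ × ℝ => f q.1) (form f' 0) p := by
  have := h.comp_hasFDerivAt p (hasFDerivAt_fst (𝕜 := ℝ) (E := ℝ) (F := ℝ) (p := p))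
  simpa only [form, zero_smul, add_zero, zero_add] using! this

lemma hasFDerivAt_comp_snd {f : ℝ → ℝ} {f' : ℝ} {p : ℝ × ℝ} (h : HasDerivAt f f' p.2) :
    HasFDerivAt (fun q : ℝ × ℝ => f q.2) (form 0 f') p := by
  have := h.comp_hasFDerivAt p (hasFDerivAt_snd (𝕜 := ℝ) (E := ℝ) (F := ℝ) (p := p))
  simpa only [form, zero_smul, add_zero, zero_add] using! this

lemma hasFDerivAt_denP (δ : ℝ) (p : ℝ × ℝ) :
    HasFDerivAt (denP δ) (form (Real.sinh p.1) (Real.sin p.2)) p := by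
  have h := ((hasFDerivAt_comp_fst (Real.hasDerivAt_cosh p.1)).sub
    (hasFDerivAt_comp_snd (Real.hasDerivAt_cos p.2))).add_const δ
  rw [form_sub, sub_zero, zero_sub, neg_neg] at h
  exact h

/-- The quotient rule is written entirely in ratios over `denP δ`. The ratios of `sinh`, `cosh`,
`sin`, `cos` thus have derivatives that are polynomials in the same ratios, and boundedness of the
ratios alone makes them Lipschitz. -/
lemma hasFDerivAt_div_denP {δ : ℝ} (hδ : 0 < δ) {N : ℝ × ℝ → ℝ} {a b : ℝ} {p : ℝ × ℝ}
    (hN : HasFDerivAt N (form a b) p) :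
    HasFDerivAt (fun q => N q / denP δ q)
      (form (a / denP δ p - N p / denP δ p * (Real.sinh p.1 / denP δ p))
        (b / denP δ p - N p / denP δ p * (Real.sin p.2 / denP δ p))) p := by
  have hne := (denP_pos hδ p).ne'
  have h := hN.mul ((hasDerivAt_inv hne).comp_hasFDerivAt p (hasFDerivAt_denP δ p))
  refine h.congr_fderiv ?_
  ext <;> simp [form_apply] <;> field_simp <;> ring

/-- Bounded Lipschitz functions on the plane. -/
def BddLip (F : ℝ × ℝ → ℝ) : Prop :=
  ∃ C, 0 ≤ C ∧ (∀ p, |F p| ≤ C) ∧ ∀ p q, |F p - F q| ≤ C * ‖p - q‖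

namespace BddLip

variable {F G : ℝ × ℝ → ℝ}

lemma sub (hF : BddLip F) (hG : BddLip G) : BddLip (fun p => F p - G p) := by
  obtain ⟨C, hC, h1, h2⟩ := hF
  obtain ⟨C', hC', h1', h2'⟩ := hG
  refine ⟨C + C', by positivity, fun p => (abs_sub _ _).trans (add_le_add (h1 p) (h1' p)),
    fun p q => ?_⟩
  rw [show F p - G p - (F q - G q) = (F p - F q) - (G p - G q) by ring, add_mul]
  exact (abs_sub _ _).trans (add_le_add (h2 p q) (h2' p q))

lemma mul (hF : BddLip F) (hG : BddLip G) : BddLip (fun p => F p * G p) := by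
  obtain ⟨C, hC, h1, h2⟩ := hF
  obtain ⟨C', hC', h1', h2'⟩ := hG
  refine ⟨C * C' + C * C', by positivity, fun p => ?_, fun p q => ?_⟩
  · rw [abs_mul]
    have := mul_le_mul (h1 p) (h1' p) (abs_nonneg _) hC
    nlinarith [mul_nonneg hC hC']
  · rw [show F p * G p - F q * G q = F p * (G p - G q) + (F p - F q) * G q by ring]
    refine (abs_add_le _ _).trans ?_
    rw [abs_mul, abs_mul, add_mul]
    have h3 := mul_le_mul (h1 p) (h2' p q) (abs_nonneg _) hC
    have h4 := mul_le_mul (h2 p q) (h1' q) (abs_nonneg _) (by positivity)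
    linarith

lemma const (c : ℝ) : BddLip (fun _ => c) :=
  ⟨|c|, abs_nonneg c, fun _ => le_rfl, fun p q => by
    rw [sub_self, abs_zero]; positivity⟩

lemma of_hasFDerivAt {C : ℝ} (hF : ∀ p, |F p| ≤ C) {a b : ℝ × ℝ → ℝ} {A B : ℝ}
    (ha : ∀ p, |a p| ≤ A) (hb : ∀ p, |b p| ≤ B)
    (h : ∀ p, HasFDerivAt F (form (a p) (b p)) p) : BddLip F := by
  have hC := (abs_nonneg _).trans (hF 0)
  have hA := (abs_nonneg _).trans (ha 0)
  have hB := (abs_nonneg _).trans (hb 0)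
  refine ⟨C + (A + B), by positivity, fun p => (hF p).trans (by linarith), fun p q => ?_⟩
  have := Convex.norm_image_sub_le_of_norm_hasFDerivWithin_le (𝕜 := ℝ) (s := univ) (C := A + B)
    (fun x _ => (h x).hasFDerivWithinAt)
    (fun x _ => (norm_form_le _ _).trans (add_le_add (ha x) (hb x))) convex_univ (mem_univ q)
    (mem_univ p)
  rw [Real.norm_eq_abs] at this
  refine this.trans (mul_le_mul_of_nonneg_right (by linarith) (norm_nonneg _))

end BddLip

section Ratios

variable {δ : ℝ} (hδ : 0 < δ)
include hδ

lemma abs_div_denP_le {N : ℝ → ℝ} {x : ℝ} {p : ℝ × ℝ} (hN : |N x| ≤ 1) :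
    |N x / denP δ p| ≤ 1 + δ⁻¹ := by
  have h := denP_pos hδ p
  rw [abs_div, abs_of_pos h, div_eq_mul_inv]
  have h1 : (denP δ p)⁻¹ ≤ δ⁻¹ := by gcongr; exact le_denP p
  have h2 : |N x| * (denP δ p)⁻¹ ≤ 1 * δ⁻¹ := by gcongr
  linarith

lemma abs_div_denP_le_of_cosh {N : ℝ → ℝ} {p : ℝ × ℝ} (hN : |N p.1| ≤ Real.cosh p.1) :
    |N p.1 / denP δ p| ≤ 1 + δ⁻¹ := by
  have h := denP_pos hδ p
  rw [abs_div, abs_of_pos h, div_le_iff₀ h]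
  have h1 : Real.cosh p.1 ≤ denP δ p + 1 := by
    have := Real.cos_le_one p.2
    rw [denP_eq]; linarith
  have h2 : 1 ≤ δ⁻¹ * denP δ p := by
    rw [inv_mul_eq_div, one_le_div hδ]; exact le_denP p
  linarith

omit hδ in
lemma abs_sinh_le_cosh (x : ℝ) : |Real.sinh x| ≤ Real.cosh x :=
  abs_le_of_sq_le_sq (by rw [Real.cosh_sq]; linarith) (Real.cosh_pos x).le

lemma abs_ratio_sinh_le (p : ℝ × ℝ) : |Real.sinh p.1 / denP δ p| ≤ 1 + δ⁻¹ :=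
  abs_div_denP_le_of_cosh hδ (abs_sinh_le_cosh p.1)

lemma abs_ratio_cosh_le (p : ℝ × ℝ) : |Real.cosh p.1 / denP δ p| ≤ 1 + δ⁻¹ :=
  abs_div_denP_le_of_cosh hδ (abs_of_pos (Real.cosh_pos _)).le

lemma abs_ratio_sin_le (p : ℝ × ℝ) : |Real.sin p.2 / denP δ p| ≤ 1 + δ⁻¹ :=
  abs_div_denP_le hδ (Real.abs_sin_le_one _)

lemma abs_ratio_cos_le (p : ℝ × ℝ) : |Real.cos p.2 / denP δ p| ≤ 1 + δ⁻¹ :=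
  abs_div_denP_le hδ (Real.abs_cos_le_one _)

lemma bddLip_div_denP {N : ℝ × ℝ → ℝ} {a b : ℝ × ℝ → ℝ} {C : ℝ}
    (hN : ∀ p, HasFDerivAt N (form (a p) (b p)) p) (hNb : ∀ p, |N p / denP δ p| ≤ C)
    (ha : ∀ p, |a p / denP δ p| ≤ C) (hb : ∀ p, |b p / denP δ p| ≤ C) :
    BddLip (fun p => N p / denP δ p) := by
  have hC := (abs_nonneg _).trans (hNb 0)
  have hδ' : 0 ≤ 1 + δ⁻¹ := by positivity
  refine BddLip.of_hasFDerivAt hNb (A := C + C * (1 + δ⁻¹)) (B := C + C * (1 + δ⁻¹)) (fun p => ?_)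
    (fun p => ?_) fun p => hasFDerivAt_div_denP hδ (hN p)
  · refine (abs_sub _ _).trans (add_le_add (ha p) ?_)
    rw [abs_mul]
    exact mul_le_mul (hNb p) (abs_ratio_sinh_le hδ p) (abs_nonneg _) hC
  · refine (abs_sub _ _).trans (add_le_add (hb p) ?_)
    rw [abs_mul]
    exact mul_le_mul (hNb p) (abs_ratio_sin_le hδ p) (abs_nonneg _) hC

lemma bddLip_sinh : BddLip (fun p => Real.sinh p.1 / denP δ p) :=
  bddLip_div_denP hδ (fun p => hasFDerivAt_comp_fst (Real.hasDerivAt_sinh p.1))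
    (abs_ratio_sinh_le hδ) (abs_ratio_cosh_le hδ) fun p => by simp; positivity

lemma bddLip_cosh : BddLip (fun p => Real.cosh p.1 / denP δ p) :=
  bddLip_div_denP hδ (fun p => hasFDerivAt_comp_fst (Real.hasDerivAt_cosh p.1))
    (abs_ratio_cosh_le hδ) (abs_ratio_sinh_le hδ) fun p => by simp; positivity

lemma bddLip_sin : BddLip (fun p => Real.sin p.2 / denP δ p) :=
  bddLip_div_denP hδ (fun p => hasFDerivAt_comp_snd (Real.hasDerivAt_sin p.2))
    (abs_ratio_sin_le hδ) (fun p => by simp; positivity) (abs_ratio_cos_le hδ)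

lemma bddLip_cos : BddLip (fun p => Real.cos p.2 / denP δ p) :=
  bddLip_div_denP hδ (fun p => hasFDerivAt_comp_snd (Real.hasDerivAt_cos p.2))
    (abs_ratio_cos_le hδ) (fun p => by simp; positivity)
    (fun p => by rw [neg_div, abs_neg]; exact abs_ratio_sin_le hδ p)

lemma hasFDerivAt_lift_K₁ (p : ℝ × ℝ) :
    HasFDerivAt (lift (K₁ δ))
      (form (Real.sin p.2 / denP δ p * (Real.sinh p.1 / denP δ p) / 2)
        ((Real.sin p.2 / denP δ p * (Real.sin p.2 / denP δ p) - Real.cos p.2 / denP δ p) / 2)) p := by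
  have h := (hasFDerivAt_div_denP hδ (hasFDerivAt_comp_snd (Real.hasDerivAt_sin p.2))).const_mul
    (-(1 / 2))
  have heq : lift (K₁ δ) = fun q => -(1 / 2) * (Real.sin q.2 / denP δ q) := by
    funext q
    have := (denP_pos hδ q).ne'
    change -Real.sin q.2 / (2 * denP δ q) = _
    field_simp
  rw [heq]
  refine h.congr_fderiv ?_
  ext <;> simp [form_apply] <;> ring

lemma hasFDerivAt_lift_K₂ (p : ℝ × ℝ) :
    HasFDerivAt (lift (K₂ δ))
      (form ((Real.cosh p.1 / denP δ p - Real.sinh p.1 / denP δ p * (Real.sinh p.1 / denP δ p)) / 2)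
        (-(Real.sin p.2 / denP δ p * (Real.sinh p.1 / denP δ p)) / 2)) p := by
  have h := (hasFDerivAt_div_denP hδ (hasFDerivAt_comp_fst (Real.hasDerivAt_sinh p.1))).const_mul
    (1 / 2)
  have heq : lift (K₂ δ) = fun q => (1 / 2) * (Real.sinh q.1 / denP δ q) := by
    funext q
    have := (denP_pos hδ q).ne'
    change Real.sinh q.1 / (2 * denP δ q) = _
    field_simp
  rw [heq]
  refine h.congr_fderiv ?_
  ext <;> simp [form_apply] <;> ring

lemma hasFDerivAt_lift_green (p : ℝ × ℝ) :
    HasFDerivAt (lift (green δ)) (form (K₂ δ (proj p)) (-K₁ δ (proj p))) p := by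
  have hne := (denP_pos hδ p).ne'
  have h := ((hasFDerivAt_denP δ p).log hne).mul_const (1 / 2)
  have heq : lift (green δ) = fun q => Real.log (denP δ q) * (1 / 2) := by
    funext q; simp only [lift, green, denP]; ring
  rw [heq]
  refine h.congr_fderiv ?_
  have h1 : K₂ δ (proj p) = Real.sinh p.1 / (2 * denP δ p) := rfl
  have h2 : K₁ δ (proj p) = -Real.sin p.2 / (2 * denP δ p) := rfl
  rw [h1, h2]
  ext <;> simp [form_apply] <;> field_simp

lemma smooth_K₁ : Smooth (K₁ δ) :=
  ContDiff.div (Real.contDiff_sin.comp contDiff_snd).neg (contDiff_const.mul (contDiff_denP δ))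
    fun p => by have := denP_pos hδ p; positivity

lemma smooth_K₂ : Smooth (K₂ δ) :=
  ContDiff.div (Real.contDiff_sinh.comp contDiff_fst) (contDiff_const.mul (contDiff_denP δ))
    fun p => by have := denP_pos hδ p; positivity

lemma smooth_green : Smooth (green δ) :=
  ((contDiff_denP δ).log fun p => (denP_pos hδ p).ne').div_const 2

/-- The dependence of `C` on `δ` is left unspecified: it enters only second-order errors of time
steps, which vanish while `δ` is fixed. -/
lemma grad_K₁_lipschitz : ∃ C, 0 ≤ C ∧ (∀ z, ‖grad (K₁ δ) z‖ ≤ C) ∧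
    ∀ p q, ‖lift (grad (K₁ δ)) p - lift (grad (K₁ δ)) q‖ ≤ C * ‖p - q‖ := by
  obtain ⟨C, hC, h1, h2⟩ := ((bddLip_sin hδ).mul (bddLip_sinh hδ)).mul (BddLip.const (1 / 2))
  obtain ⟨C', hC', h1', h2'⟩ := (((bddLip_sin hδ).mul (bddLip_sin hδ)).sub
    (bddLip_cos hδ)).mul (BddLip.const (1 / 2))
  have hg := fun p => grad_eq_of_hasFDerivAt (hasFDerivAt_lift_K₁ hδ p)
  simp only [mul_one_div] at h1 h2 h1' h2'
  refine ⟨C + C', by positivity, fun z => ?_, fun p q => ?_⟩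
  · obtain ⟨p, rfl⟩ := proj_surjective z
    rw [hg]
    exact (norm_form_le _ _).trans (add_le_add (h1 p) (h1' p))
  · simp only [lift, hg, form_sub, add_mul]
    exact (norm_form_le _ _).trans (add_le_add (h2 p q) (h2' p q))

lemma grad_K₂_lipschitz : ∃ C, 0 ≤ C ∧ (∀ z, ‖grad (K₂ δ) z‖ ≤ C) ∧
    ∀ p q, ‖lift (grad (K₂ δ)) p - lift (grad (K₂ δ)) q‖ ≤ C * ‖p - q‖ := by
  obtain ⟨C, hC, h1, h2⟩ := ((bddLip_cosh hδ).sub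
    ((bddLip_sinh hδ).mul (bddLip_sinh hδ))).mul (BddLip.const (1 / 2))
  obtain ⟨C', hC', h1', h2'⟩ := ((bddLip_sin hδ).mul (bddLip_sinh hδ)).mul (BddLip.const (-1 / 2))
  have hg := fun p => grad_eq_of_hasFDerivAt (hasFDerivAt_lift_K₂ hδ p)
  simp only [mul_one_div] at h1 h2
  have h3 : ∀ t : ℝ, t * (-1 / 2) = -t / 2 := fun t => by ring
  simp only [h3] at h1' h2'
  refine ⟨C + C', by positivity, fun z => ?_, fun p q => ?_⟩
  · obtain ⟨p, rfl⟩ := proj_surjective z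
    rw [hg]
    exact (norm_form_le _ _).trans (add_le_add (h1 p) (h1' p))
  · simp only [lift, hg, form_sub, add_mul]
    exact (norm_form_le _ _).trans (add_le_add (h2 p q) (h2' p q))

/-- Unlike the bounds by `1 + δ⁻¹`, these keep the dependence on the point. They yield the bound `8
+ 3 * invLoc δ` for the differential, whose integral is only logarithmic. -/
lemma ratio_bounds (p : ℝ × ℝ) :
    (Real.sinh p.1 / denP δ p) ^ 2 ≤ 1 + 2 * (denP δ p)⁻¹ ∧
    (Real.sin p.2 / denP δ p) ^ 2 ≤ 2 * (denP δ p)⁻¹ ∧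
    |Real.cosh p.1 / denP δ p| ≤ 1 + (denP δ p)⁻¹ ∧
    |Real.cos p.2 / denP δ p| ≤ (denP δ p)⁻¹ := by
  have h := denP_pos hδ p
  have hd := den_nonneg (proj p)
  have h1 := sinh_sq_le (proj p)
  have h2 := sinC_sq_le (proj p)
  have h3 : den (proj p) = denP δ p - δ := by unfold denP; ring
  have h4 := le_denP (δ := δ) p
  rw [h3] at h1 h2
  refine ⟨?_, ?_, ?_, ?_⟩
  · rw [div_pow, div_le_iff₀ (by positivity)]
    refine h1.trans ?_
    have : (1 + 2 * (denP δ p)⁻¹) * denP δ p ^ 2 = denP δ p * (denP δ p + 2) := by field_simp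
    rw [this]
    nlinarith
  · rw [div_pow, div_le_iff₀ (by positivity)]
    refine h2.trans ?_
    have : (2 * (denP δ p)⁻¹) * denP δ p ^ 2 = 2 * denP δ p := by field_simp
    rw [this]
    linarith
  · rw [abs_div, abs_of_pos h, abs_of_pos (Real.cosh_pos _), div_le_iff₀ h]
    have : (1 + (denP δ p)⁻¹) * denP δ p = denP δ p + 1 := by field_simp
    rw [this, denP_eq]
    linarith [Real.cos_le_one p.2]
  · rw [abs_div, abs_of_pos h, div_eq_mul_inv]
    have := Real.abs_cos_le_one p.2
    exact mul_le_of_le_one_left (by positivity) this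

lemma norm_grad_K₁_le (z : Cylinder) : ‖grad (K₁ δ) z‖ ≤ 8 + 3 * invLoc δ z := by
  have hinv := inv_den_le hδ z
  have hloc := invLoc_nonneg hδ z
  obtain ⟨p, rfl⟩ := proj_surjective z
  rw [grad_eq_of_hasFDerivAt (hasFDerivAt_lift_K₁ hδ p)]
  obtain ⟨h1, h2, h3, h4⟩ := ratio_bounds hδ p
  change (denP δ p)⁻¹ ≤ _ at hinv
  refine (norm_form_le _ _).trans ?_
  set P := Real.sinh p.1 / denP δ p
  set Q := Real.sin p.2 / denP δ p
  have hPQ : |Q * P / 2| ≤ (1 + 4 * (denP δ p)⁻¹) / 4 := by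
    rw [abs_le]; constructor <;> nlinarith [sq_nonneg (P - Q), sq_nonneg (P + Q)]
  have hQ : |(Q * Q - Real.cos p.2 / denP δ p) / 2| ≤ 3 / 2 * (denP δ p)⁻¹ := by
    rw [abs_le] at h4 ⊢; constructor <;> nlinarith [sq_nonneg Q]
  linarith

lemma norm_grad_K₂_le (z : Cylinder) : ‖grad (K₂ δ) z‖ ≤ 8 + 3 * invLoc δ z := by
  have hinv := inv_den_le hδ z
  have hloc := invLoc_nonneg hδ z
  obtain ⟨p, rfl⟩ := proj_surjective z
  rw [grad_eq_of_hasFDerivAt (hasFDerivAt_lift_K₂ hδ p)]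
  obtain ⟨h1, h2, h3, h4⟩ := ratio_bounds hδ p
  change (denP δ p)⁻¹ ≤ _ at hinv
  refine (norm_form_le _ _).trans ?_
  set P := Real.sinh p.1 / denP δ p
  set Q := Real.sin p.2 / denP δ p
  have hPQ : |-(Q * P) / 2| ≤ (1 + 4 * (denP δ p)⁻¹) / 4 := by
    rw [abs_le]; constructor <;> nlinarith [sq_nonneg (P - Q), sq_nonneg (P + Q)]
  have hQ : |(Real.cosh p.1 / denP δ p - P * P) / 2| ≤ (2 + 3 * (denP δ p)⁻¹) / 2 := by
    rw [abs_le] at h3 ⊢; constructor <;> nlinarith [sq_nonneg P]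
  linarith

end Ratios

/-! ### Velocity generated by a bounded density. -/

lemma measurable_K₁ (δ : ℝ) : Measurable (K₁ δ) :=
  (continuous_sinC.measurable.comp measurable_snd).neg.div
    (measurable_const.mul (continuous_den.measurable.add_const δ))

lemma measurable_K₂ (δ : ℝ) : Measurable (K₂ δ) :=
  (Real.continuous_sinh.measurable.comp measurable_fst).div
    (measurable_const.mul (continuous_den.measurable.add_const δ))

lemma u₁_eq_conv (f : Cylinder → ℝ) : u₁ f = conv (K₁ 0) f := by
  funext z; simp only [u₁, conv, K₁_zero, smul_eq_mul, mul_comm]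

lemma u₂_eq_conv (f : Cylinder → ℝ) : u₂ f = conv (K₂ 0) f := by
  funext z; simp only [u₂, conv, K₂_zero, smul_eq_mul, mul_comm]

namespace Dens

variable {M R : ℝ} {f : Cylinder → ℝ}

lemma integrable_conv_of_le (h : Dens M R f) {E : Type} [NormedAddCommGroup E] [NormedSpace ℝ E]
    {K : Cylinder → E} (hK : StronglyMeasurable K)
    {H : Cylinder → ℝ} (hH : Integrable H volume) {a b : ℝ} (hKH : ∀ z, ‖K z‖ ≤ a + b * H z)
    (z : Cylinder) : Integrable (fun ξ => f ξ • K (z - ξ)) volume := by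
  have hm : Measurable fun ξ : Cylinder => z - ξ := measurable_const.sub measurable_id
  have h1 := h.integrable_mul_weight (hH.comp_sub_left z)
  refine ((h.integrable.abs.const_mul a).add (h1.const_mul b)).mono'
    (h.meas.smul (hK.comp_measurable hm).aestronglyMeasurable)
    (Eventually.of_forall fun ξ => ?_)
  rw [norm_smul, Real.norm_eq_abs, Pi.add_apply]
  nlinarith [mul_le_mul_of_nonneg_left (hKH (z - ξ)) (abs_nonneg (f ξ))]

/-- The constant part of the kernel bound is paired with the `L¹` norm of `f` and the singular part
with its sup bound. In the gradient estimate the logarithm is therefore multiplied by `M` alone,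
independently of `R`. -/
lemma norm_conv_le (h : Dens M R f) {E : Type} [NormedAddCommGroup E] [NormedSpace ℝ E]
    {K : Cylinder → E} {H : Cylinder → ℝ} (hH : Integrable H volume) (hH0 : ∀ z, 0 ≤ H z)
    {a b : ℝ} (hb : 0 ≤ b) (hKH : ∀ z, ‖K z‖ ≤ a + b * H z) (z : Cylinder) :
    ‖conv K f z‖ ≤ a * (∫ ξ, |f ξ|) + b * (M * ∫ ξ, H ξ) := by
  have h1 := h.integrable_mul_weight (hH.comp_sub_left z)
  calc ‖conv K f z‖ ≤ ∫ ξ, (a * |f ξ| + b * (|f ξ| * H (z - ξ))) := by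
        refine norm_integral_le_of_norm_le
          ((h.integrable.abs.const_mul a).add (h1.const_mul b))
          (Eventually.of_forall fun ξ => ?_)
        rw [norm_smul, Real.norm_eq_abs]
        nlinarith [mul_le_mul_of_nonneg_left (hKH (z - ξ)) (abs_nonneg (f ξ))]
    _ = a * (∫ ξ, |f ξ|) + b * ∫ ξ, |f ξ| * H (z - ξ) := by
        rw [integral_add (h.integrable.abs.const_mul a) (h1.const_mul b), integral_const_mul,
          integral_const_mul]
    _ ≤ _ := by gcongr; exact h.integral_weight_le hH hH0 z

lemma stronglyMeasurable_conv (h : Dens M R f) {K : Cylinder → ℝ} (hK : Measurable K) :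
    AEStronglyMeasurable (conv K f) volume := by
  have h1 : AEStronglyMeasurable (fun p : Cylinder × Cylinder => f p.2 • K (p.1 - p.2))
      ((volume : Measure Cylinder).prod volume) :=
    h.meas.comp_snd.smul
      (hK.comp (measurable_fst.sub measurable_snd)).aestronglyMeasurable
  exact h1.integral_prod_right'

end Dens

lemma norm_K₁_le {δ : ℝ} (hδ : 0 ≤ δ) (z : Cylinder) : ‖K₁ δ z‖ ≤ 4 + 1 * wtLoc z := by
  have := abs_K₁_le hδ z; have := wt_le z; rw [Real.norm_eq_abs]; linarith

lemma norm_K₂_le {δ : ℝ} (hδ : 0 ≤ δ) (z : Cylinder) : ‖K₂ δ z‖ ≤ 4 + 1 * wtLoc z := by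
  have := abs_K₂_le hδ z; have := wt_le z; rw [Real.norm_eq_abs]; linarith

/-- The velocity generated by a density through the kernel with regularisation `δ`. -/
noncomputable def vel (δ : ℝ) (f : Cylinder → ℝ) (z : Cylinder) : ℝ × ℝ :=
  (conv (K₁ δ) f z, conv (K₂ δ) f z)

/-- Bound of the velocity generated by a density bounded by `M` and supported in `|x| ≤ R`. -/
noncomputable def velBound (M R : ℝ) : ℝ := 4 * (4 * Real.pi * R * M) + M * ∫ z, wtLoc z

lemma Dens.norm_vel_le {M R δ : ℝ} {f : Cylinder → ℝ} (h : Dens M R f) (hR : 0 ≤ R) (hδ : 0 ≤ δ)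
    (z : Cylinder) : ‖vel δ f z‖ ≤ velBound M R := by
  have h1 := h.norm_conv_le integrable_wtLoc wtLoc_nonneg zero_le_one (norm_K₁_le hδ) z
  have h2 := h.norm_conv_le integrable_wtLoc wtLoc_nonneg zero_le_one (norm_K₂_le hδ) z
  have h3 := h.integral_abs_le hR
  rw [vel, Prod.norm_def, velBound]
  exact max_le (by linarith) (by linarith)

lemma Dens.velBound_nonneg {M R : ℝ} {f : Cylinder → ℝ} (h : Dens M R f) (hR : 0 ≤ R) :
    0 ≤ velBound M R :=
  (norm_nonneg _).trans (h.norm_vel_le hR le_rfl 0)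

/-- Bound of the error of the regularised velocity, relative to `σ = δ ^ (1 / 4)`. -/
noncomputable def velErr (M R : ℝ) : ℝ := 6 * (4 * Real.pi * R * M) + 2 * (M * ∫ z, wtLoc z)

lemma conv_sub {f : Cylinder → ℝ} {E : Type}
    [NormedAddCommGroup E] [NormedSpace ℝ E] {K L : Cylinder → E} {z : Cylinder}
    (hK : Integrable (fun ξ => f ξ • K (z - ξ)) volume)
    (hL : Integrable (fun ξ => f ξ • L (z - ξ)) volume) :
    conv K f z - conv L f z = conv (fun z => K z - L z) f z := by
  rw [conv, conv, conv, ← integral_sub hK hL]; simp only [smul_sub]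

lemma Dens.integrable_K₁ {M R δ : ℝ} {f : Cylinder → ℝ} (h : Dens M R f) (hδ : 0 ≤ δ)
    (z : Cylinder) : Integrable (fun ξ => f ξ • K₁ δ (z - ξ)) volume :=
  h.integrable_conv_of_le (measurable_K₁ δ).stronglyMeasurable integrable_wtLoc (norm_K₁_le hδ) z

lemma Dens.integrable_K₂ {M R δ : ℝ} {f : Cylinder → ℝ} (h : Dens M R f) (hδ : 0 ≤ δ)
    (z : Cylinder) : Integrable (fun ξ => f ξ • K₂ δ (z - ξ)) volume :=
  h.integrable_conv_of_le (measurable_K₂ δ).stronglyMeasurable integrable_wtLoc (norm_K₂_le hδ) z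

lemma Dens.norm_vel_sub_le {M R σ : ℝ} {f : Cylinder → ℝ} (h : Dens M R f) (hR : 0 ≤ R)
    (hσ : 0 < σ) (z : Cylinder) : ‖vel 0 f z - vel (σ ^ 4) f z‖ ≤ σ * velErr M R := by
  have hδ : (0:ℝ) ≤ σ ^ 4 := by positivity
  have h3 := h.integral_abs_le hR
  have key : ∀ K : Cylinder → ℝ, (∀ z, |K z| ≤ σ * (2 + 2 * wt z)) →
      ‖conv K f z‖ ≤ σ * velErr M R := fun K hK => by
    have h1 := h.norm_conv_le (K := K) integrable_wtLoc wtLoc_nonneg (a := σ * 6) (b := σ * 2)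
      (by positivity) (fun z => by
        rw [Real.norm_eq_abs]
        refine (hK z).trans ?_
        rw [mul_assoc, ← mul_add]
        have := wt_le z
        exact mul_le_mul_of_nonneg_left (by linarith) hσ.le) z
    rw [velErr]
    nlinarith
  rw [vel, vel, Prod.mk_sub_mk, Prod.norm_def]
  refine max_le ?_ ?_
  · simp only
    rw [conv_sub (h.integrable_K₁ le_rfl z) (h.integrable_K₁ hδ z)]
    exact key _ fun z => abs_K₁_sub_le hσ z
  · simp only
    rw [conv_sub (h.integrable_K₂ le_rfl z) (h.integrable_K₂ hδ z)]
    exact key _ fun z => abs_K₂_sub_le hσ z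

lemma Dens.aestronglyMeasurable_vel {M R : ℝ} {f : Cylinder → ℝ} (h : Dens M R f) (δ : ℝ) :
    AEStronglyMeasurable (vel δ f) volume :=
  (h.stronglyMeasurable_conv (measurable_K₁ δ)).prodMk (h.stronglyMeasurable_conv (measurable_K₂ δ))

lemma aestronglyMeasurable_grad_apply {g : Cylinder → ℝ} (hg : Smooth g) {v : Cylinder → ℝ × ℝ}
    (hv : AEStronglyMeasurable v volume) :
    AEStronglyMeasurable (fun z => grad g z (v z)) volume :=
  (isBoundedBilinearMap_apply (𝕜 := ℝ) (E := ℝ × ℝ) (F := ℝ)).continuous.comp_aestronglyMeasurable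
    (hg.grad.continuous.aestronglyMeasurable.prodMk hv)

/-! ### Essential support -/

/-- Each point off the essential support has a neighbourhood where `f` vanishes almost everywhere;
countably many of these suffice in a second countable space. -/
lemma ae_eq_zero_of_notMem_essSupport (f : Cylinder → ℝ) :
    ∀ᵐ z, z ∉ essSupport f → f z = 0 := by
  have h : volume {z | z ∉ essSupport f ∧ f z ≠ 0} = 0 := by
    refine measure_null_of_locally_null _ fun z hz => ?_
    have hz1 := hz.1
    simp only [essSupport, mem_ofPred_eq, not_forall, not_not] at hz1
    obtain ⟨U, hU, hU0⟩ := hz1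
    obtain ⟨V, hVU, hVo, hzV⟩ := mem_nhds_iff.1 hU
    refine ⟨{z | z ∉ essSupport f ∧ f z ≠ 0} ∩ V,
      inter_mem self_mem_nhdsWithin (mem_nhdsWithin_of_mem_nhds (hVo.mem_nhds hzV)), ?_⟩
    have h1 := (ae_restrict_iff' hVo.measurableSet).1 (ae_restrict_of_ae_restrict_of_subset hVU hU0)
    refine measure_mono_null (fun ξ hξ => ?_) (ae_iff.1 h1)
    simp only [mem_ofPred_eq, Classical.not_imp]
    exact ⟨hξ.2, hξ.1.2⟩
  filter_upwards [(ae_iff.2 (by simpa using h) : ∀ᵐ z, ¬ (z ∉ essSupport f ∧ f z ≠ 0))] with z hz h1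
  by_contra h2
  exact hz ⟨h1, h2⟩

lemma exists_bound_fst {K : Set Cylinder} (hK : IsCompact K) : ∃ R, 0 ≤ R ∧ ∀ z ∈ K, |z.1| ≤ R := by
  obtain ⟨C, hC⟩ := hK.exists_bound_of_continuousOn (f := fun z : Cylinder => z.1)
    continuous_fst.continuousOn
  exact ⟨max C 0, le_max_right _ _, fun z hz => (hC z hz).trans (le_max_left _ _)⟩

lemma IsSolution.exists_dens {θ₀ : Cylinder → ℝ} {θ : ℝ → Cylinder → ℝ} (h : IsSolution θ₀ θ)
    (T : ℝ) : ∃ M R, 0 ≤ R ∧ ∀ t ∈ Icc 0 T, Dens M R (θ t) := by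
  obtain ⟨M, hM⟩ := h.locallyBounded T
  obtain ⟨K, hK, hKs⟩ := h.locallyCompactSupport T
  obtain ⟨R, hR, hKR⟩ := exists_bound_fst hK
  refine ⟨M, R, hR, fun t ht => ⟨h.measurable_slice t ht.1, hM t ht, ?_⟩⟩
  filter_upwards [ae_eq_zero_of_notMem_essSupport (θ t)] with z hz hzR
  exact hz fun hzs => absurd (hKR z (hKs t ht hzs)) (not_le.2 hzR)

lemma exists_dens_of_memLp {f : Cylinder → ℝ} (hf : MemLp f ∞ volume)
    (hs : IsCompact (essSupport f)) : ∃ R, 0 ≤ R ∧ Dens (supNorm f) R f := by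
  obtain ⟨R, hR, hKR⟩ := exists_bound_fst hs
  refine ⟨R, hR, hf.1, ?_, ?_⟩
  · filter_upwards [ae_le_eLpNormEssSup (f := f) (μ := volume)] with z hz
    have hfin : eLpNormEssSup f volume ≠ ⊤ := by
      rw [← eLpNorm_exponent_top]; exact hf.2.ne
    rw [supNorm, eLpNorm_exponent_top, ← Real.norm_eq_abs, ← toReal_enorm]
    exact ENNReal.toReal_mono hfin hz
  · filter_upwards [ae_eq_zero_of_notMem_essSupport f] with z hz hzR
    exact hz fun hzs => absurd (hKR z hzs) (not_le.2 hzR)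

lemma Dens.mono {M M' R R' : ℝ} {f : Cylinder → ℝ} (h : Dens M R f) (hM : M ≤ M') (hR : R ≤ R') :
    Dens M' R' f :=
  ⟨h.meas, h.bound.mono fun _ hz => hz.trans hM, h.supp.mono fun _ hz hz' => hz (hR.trans_lt hz')⟩

lemma dens_indicator_strip (R : ℝ) : Dens 1 R ((strip R).indicator fun _ => 1) := by
  refine ⟨(measurable_const.indicator (measurableSet_strip R)).aestronglyMeasurable,
    Eventually.of_forall fun z => ?_, Eventually.of_forall fun z hz => ?_⟩
  · by_cases hz : z ∈ strip R <;> simp [hz]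
  · have : z ∉ strip R := not_le.2 hz
    simp [this]

/-! ### A one-dimensional weak equation -/

/-- Given `ψ` supported in `(0, ∞)`, the admissible `χ` with `χ' = ψ` is the primitive vanishing at
late times. Integrating by parts turns the hypothesis into `∫ ψ (a - B) = 0` for the candidate `B`.
Hence `a = B` almost everywhere on `(0, ∞)`, and by continuity up to `0`. -/
lemma eq_add_integral_of_weak {a b : ℝ → ℝ} {a₀ : ℝ} (ha : Continuous a) (hb : Continuous b)
    (h : ∀ χ : ℝ → ℝ, ContDiff ℝ ∞ χ → HasCompactSupport χ →
      (∫ t in Ioi (0 : ℝ), (deriv χ t * a t + χ t * b t)) + χ 0 * a₀ = 0) {t : ℝ} (ht : 0 ≤ t) :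
    a t = a₀ + ∫ s in (0:ℝ)..t, b s := by
  set B : ℝ → ℝ := fun t => a₀ + ∫ s in (0:ℝ)..t, b s with hB
  have hBd : ∀ t, HasDerivAt B (b t) t := fun t =>
    (intervalIntegral.integral_hasDerivAt_right (hb.intervalIntegrable _ _)
      hb.aestronglyMeasurable.stronglyMeasurableAtFilter hb.continuousAt).const_add a₀
  have hBc : Continuous B := continuous_iff_continuousAt.2 fun t => (hBd t).continuousAt
  have hab : Continuous fun t => a t - B t := ha.sub hBc
  have key : ∀ ψ : ℝ → ℝ, ContDiff ℝ ∞ ψ → HasCompactSupport ψ → tsupport ψ ⊆ Ioi 0 →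
      ∫ t, ψ t • (a t - B t) = 0 := by
    intro ψ hψ hψc hψs
    obtain ⟨N, hN⟩ := hψc.isBounded.subset_closedBall 0
    have hψN : ∀ t, N < t → ψ t = 0 := fun t htN => by
      by_contra hne
      have := hN (subset_tsupport _ hne)
      rw [mem_closedBall_zero_iff, Real.norm_eq_abs] at this
      linarith [le_abs_self t]
    have hψ0 : ∀ t, t ≤ 0 → ψ t = 0 := fun t ht0 => by
      by_contra hne
      exact absurd (hψs (subset_tsupport _ hne)) (not_lt.2 ht0)
    set N' := max N 1 with hN'
    have hN'0 : 0 < N' := lt_max_of_lt_right one_pos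
    set Ψ : ℝ → ℝ := fun t => ∫ s in N'..t, ψ s with hΨ
    have hΨd : ∀ t, HasDerivAt Ψ (ψ t) t := fun t =>
      intervalIntegral.integral_hasDerivAt_right (hψ.continuous.intervalIntegrable _ _)
        hψ.continuous.aestronglyMeasurable.stronglyMeasurableAtFilter hψ.continuous.continuousAt
    have hΨs : ContDiff ℝ ∞ Ψ := by
      rw [contDiff_infty_iff_deriv]
      refine ⟨fun t => (hΨd t).differentiableAt, ?_⟩
      rw [show deriv Ψ = ψ from funext fun t => (hΨd t).deriv]
      exact hψ
    have hΨN : ∀ t, N' ≤ t → Ψ t = 0 := fun t htN => by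
      rw [hΨ]
      refine (intervalIntegral.integral_congr_ae (g := fun _ => 0)
        (Eventually.of_forall fun s hs => ?_)).trans (by simp)
      rw [uIoc_of_le htN] at hs
      exact hψN s ((le_max_left _ _).trans_lt hs.1)
    -- For negative times `Ψ` is a constant, in general non-zero, so a cutoff is needed there. For
    -- `t ≥ 0` it changes nothing: it equals `1` up to `N' + 1`, and `Ψ` vanishes beyond `N'`.
    let η : ContDiffBump (0 : ℝ) := ⟨N' + 1, N' + 2, by linarith, by linarith⟩
    have hη : ∀ t, |t| < N' + 1 → η =ᶠ[𝓝 t] fun _ => 1 := fun t ht' => by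
      filter_upwards [Metric.isOpen_ball.mem_nhds (x := t)
        (by rw [mem_ball_zero_iff]; exact ht' : t ∈ Metric.ball (0:ℝ) (N' + 1))] with s hs
      exact η.one_of_mem_closedBall (Metric.ball_subset_closedBall hs)
    have hχs : ContDiff ℝ ∞ (fun t => η t * Ψ t) := η.contDiff.mul hΨs
    have hχc : HasCompactSupport (fun t => η t * Ψ t) := η.hasCompactSupport.mul_right
    have hχe : ∀ t, |t| < N' + 1 → (fun t => η t * Ψ t) =ᶠ[𝓝 t] Ψ := fun t ht' => by
      filter_upwards [hη t ht'] with s hs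
      rw [hs, one_mul]
    have hχΨ : ∀ t, 0 ≤ t → η t * Ψ t = Ψ t ∧ deriv (fun t => η t * Ψ t) t = ψ t := fun t ht0 => by
      rcases lt_or_ge t (N' + 1) with h1 | h1
      · have h2 := hχe t (by rwa [abs_of_nonneg ht0])
        exact ⟨h2.eq_of_nhds, by rw [h2.deriv_eq]; exact (hΨd t).deriv⟩
      · have h3 : (fun t => η t * Ψ t) =ᶠ[𝓝 t] fun _ => 0 := by
          filter_upwards [lt_mem_nhds (show N' < t by linarith)] with s hs
          rw [hΨN s hs.le, mul_zero]
        refine ⟨by rw [hΨN t (by linarith), mul_zero], ?_⟩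
        rw [h3.deriv_eq, deriv_const, hψN t]
        linarith [le_max_left N 1]
    have hw := h _ hχs hχc
    rw [(hχΨ 0 le_rfl).1, setIntegral_congr_fun (g := fun t => ψ t * a t + Ψ t * b t)
      measurableSet_Ioi (fun t ht0 => by
        simp only [(hχΨ t (le_of_lt ht0)).1, (hχΨ t (le_of_lt ht0)).2])] at hw
    have hcut : ∀ F : ℝ → ℝ, (∀ t, N' < t → F t = 0) →
        ∫ t in Ioi (0 : ℝ), F t = ∫ t in (0:ℝ)..N', F t := fun F hF => by
      rw [intervalIntegral.integral_of_le hN'0.le]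
      refine setIntegral_eq_of_subset_of_forall_sdiff_eq_zero measurableSet_Ioi Ioc_subset_Ioi_self
        fun t ht' => hF t ?_
      by_contra! hle
      exact ht'.2 ⟨ht'.1, hle⟩
    rw [hcut _ fun t htN => by
      rw [hψN t ((le_max_left _ _).trans_lt htN), hΨN t htN.le]; ring] at hw
    have hparts := intervalIntegral.integral_deriv_mul_eq_sub (a := 0) (b := N')
      (fun t _ => hΨd t) (fun t _ => hBd t) (hψ.continuous.intervalIntegrable _ _)
      (hb.intervalIntegrable _ _)
    have hB0 : B 0 = a₀ := by simp [hB]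
    rw [hΨN N' le_rfl, hB0] at hparts
    have hfin : ∫ t, ψ t • (a t - B t) = ∫ t in (0:ℝ)..N', ψ t * (a t - B t) := by
      rw [← hcut _ fun t htN => by rw [hψN t ((le_max_left _ _).trans_lt htN), zero_mul]]
      refine (setIntegral_eq_integral_of_forall_compl_eq_zero fun t ht' => ?_).symm
      simp only [hψ0 t (not_lt.1 ht'), zero_smul]
    rw [hfin]
    have hc1 : Continuous fun t => ψ t * a t + Ψ t * b t :=
      (hψ.continuous.mul ha).add (hΨs.continuous.mul hb)
    have hc2 : Continuous fun t => ψ t * B t + Ψ t * b t :=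
      (hψ.continuous.mul hBc).add (hΨs.continuous.mul hb)
    have : ∫ t in (0:ℝ)..N', ψ t * (a t - B t) =
        (∫ t in (0:ℝ)..N', (ψ t * a t + Ψ t * b t)) - ∫ t in (0:ℝ)..N', (ψ t * B t + Ψ t * b t) := by
      rw [← intervalIntegral.integral_sub (hc1.intervalIntegrable _ _)
        (hc2.intervalIntegrable _ _)]
      exact intervalIntegral.integral_congr fun t _ => by ring
    rw [this, hparts]
    linarith
  have hae := isOpen_Ioi.ae_eq_zero_of_integral_contDiff_smul_eq_zero (μ := volume) (U := Ioi (0:ℝ))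
    (hab.locallyIntegrable.locallyIntegrableOn _) key
  have heq : EqOn (fun t => a t - B t) (fun _ => 0) (Ioi 0) :=
    Measure.eqOn_open_of_ae_eq (μ := volume) ((ae_restrict_iff' measurableSet_Ioi).2 hae) isOpen_Ioi
      hab.continuousOn continuousOn_const
  have := heq.closure hab continuous_const (by rw [closure_Ioi]; exact ht : t ∈ closure (Ioi (0:ℝ)))
  exact sub_eq_zero.1 this

/-! ### Test functions of product form -/

section Product

variable {χ : ℝ → ℝ} {g : Cylinder → ℝ}

lemma isTestFunction_mul (hχ : ContDiff ℝ ∞ χ) (hχc : HasCompactSupport χ) (hg : Smooth g)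
    (hgc : HasCompactSupport g) : IsTestFunction (fun p => χ p.1 * g p.2) := by
  refine ⟨(hχ.comp contDiff_fst).mul (ContDiff.comp (g := lift g) hg contDiff_snd), ?_⟩
  refine HasCompactSupport.intro (hχc.isCompact.prod hgc.isCompact) fun p hp => ?_
  rw [mem_prod, not_and_or] at hp
  rcases hp with hp | hp
  · rw [image_eq_zero_of_notMem_tsupport hp, zero_mul]
  · rw [image_eq_zero_of_notMem_tsupport hp, mul_zero]

lemma dt_mul (hχ : ContDiff ℝ ∞ χ) (t : ℝ) (z : Cylinder) :
    dt (fun p => χ p.1 * g p.2) t z = deriv χ t * g z := by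
  have h := (hχ.differentiable (by simp) t).hasDerivAt
  exact (h.mul_const (g z)).deriv

lemma dx_mul (hg : Smooth g) (t : ℝ) (z : Cylinder) :
    dx (fun p => χ p.1 * g p.2) t z = χ t * grad g z (1, 0) := by
  obtain ⟨p, rfl⟩ := proj_surjective z
  have h1 : HasDerivAt (fun s : ℝ => (s, p.2)) ((1 : ℝ), (0 : ℝ)) p.1 :=
    (hasDerivAt_id p.1).prodMk (hasDerivAt_const _ _)
  exact (((hg.hasFDerivAt p).comp_hasDerivAt p.1 h1).const_mul (χ t)).deriv

lemma dy_mul (hg : Smooth g) (t : ℝ) (z : Cylinder) :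
    dy (fun p => χ p.1 * g p.2) t z = χ t * grad g z (0, 1) := by
  obtain ⟨p, rfl⟩ := proj_surjective z
  have h1 : HasDerivAt (fun s : ℝ => (p.1, p.2 + s)) ((0 : ℝ), (1 : ℝ)) 0 :=
    (hasDerivAt_const _ _).prodMk ((hasDerivAt_id (0:ℝ)).const_add p.2)
  have h2 := hg.hasFDerivAt p
  rw [show p = (p.1, p.2 + 0) by simp] at h2
  have h3 := ((h2.comp_hasDerivAt (0:ℝ) h1).const_mul (χ t)).deriv
  rw [add_zero] at h3
  exact h3

lemma grad_apply_eq (z : Cylinder) (v : ℝ × ℝ) :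
    grad g z v = v.1 * grad g z (1, 0) + v.2 * grad g z (0, 1) := by
  conv_lhs => rw [show v = v.1 • ((1:ℝ), (0:ℝ)) + v.2 • ((0:ℝ), (1:ℝ)) by ext <;> simp]
  rw [map_add, map_smul, map_smul, smul_eq_mul, smul_eq_mul]

end Product

/-! ### The weak equation tested with functions independent of time. -/

/-- The rate of change of `∫ θ g` for a density `f` with its own velocity. -/
noncomputable def rate (f : Cylinder → ℝ) (g : Cylinder → ℝ) : ℝ :=
  ∫ z, f z • grad g z (vel 0 f z)

lemma norm_grad_apply_le {g : Cylinder → ℝ} {z : Cylinder} {v : ℝ × ℝ} {A V : ℝ} (hA0 : 0 ≤ A)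
    (hA : ‖grad g z‖ ≤ A) (hV : ‖v‖ ≤ V) : ‖grad g z v‖ ≤ A * V :=
  ((grad g z).le_opNorm v).trans (mul_le_mul hA hV (norm_nonneg _) hA0)

lemma Dens.integrable_rate {M R δ : ℝ} {f f' : Cylinder → ℝ} (h : Dens M R f) (h' : Dens M R f')
    (hR : 0 ≤ R) (hδ : 0 ≤ δ) {g : Cylinder → ℝ} (hg : Smooth g) :
    Integrable (fun z => f z • grad g z (vel δ f' z)) volume := by
  obtain ⟨A, hA0, hA⟩ := hg.grad.exists_bound R
  exact h.integrable_smul (aestronglyMeasurable_grad_apply hg (h'.aestronglyMeasurable_vel δ))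
    fun z hz => norm_grad_apply_le hA0 (hA z hz) (h'.norm_vel_le hR hδ z)

lemma Dens.abs_rate_le {M R A : ℝ} {f : Cylinder → ℝ} (h : Dens M R f) (hR : 0 ≤ R)
    {g : Cylinder → ℝ} (hA0 : 0 ≤ A) (hA : ∀ z : Cylinder, |z.1| ≤ R → ‖grad g z‖ ≤ A) :
    |rate f g| ≤ 4 * Real.pi * R * M * (A * velBound M R) :=
  h.norm_integral_smul_le hR (mul_nonneg hA0 (h.velBound_nonneg hR)) fun z hz =>
    norm_grad_apply_le hA0 (hA z hz) (h.norm_vel_le hR le_rfl z)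

section Solution

variable {θ₀ : Cylinder → ℝ} {θ : ℝ → Cylinder → ℝ} {M R T : ℝ}

/-- Weak-* continuity tests only against `L¹`; the common support of the `θ t` allows functions
integrable merely on the strip, such as kernels and smooth functions without decay. -/
lemma IsSolution.continuousOn_pairing (h : IsSolution θ₀ θ)
    (hd : ∀ t ∈ Icc 0 T, Dens M R (θ t)) {g : Cylinder → ℝ}
    (hg : Integrable ((strip R).indicator g) volume) :
    ContinuousOn (fun t => ∫ z, θ t z * g z) (Icc 0 T) := by
  refine ((h.weakStarContinuous _ hg).mono Icc_subset_Ici_self).congr fun t ht => ?_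
  refine integral_congr_ae ?_
  filter_upwards [(hd t ht).supp] with z hz
  by_cases hzR : z ∈ strip R
  · simp [hzR]
  · rw [hz (not_le.1 hzR), zero_mul, zero_mul]

lemma integrable_indicator_of_bound {g : Cylinder → ℝ} (hg : AEStronglyMeasurable g volume) {C : ℝ}
    (hC : ∀ z : Cylinder, |z.1| ≤ R → ‖g z‖ ≤ C) :
    Integrable ((strip R).indicator g) volume := by
  refine (integrable_indicator_strip R C).mono' (hg.indicator (measurableSet_strip R))
    (Eventually.of_forall fun z => ?_)
  by_cases hz : z ∈ strip R
  · simpa [hz] using hC z hz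
  · simp [hz]

lemma IsSolution.continuousOn_vel (h : IsSolution θ₀ θ)
    (hd : ∀ t ∈ Icc 0 T, Dens M R (θ t)) (z : Cylinder) :
    ContinuousOn (fun t => vel 0 (θ t) z) (Icc 0 T) := by
  have h1 : ∀ K : Cylinder → ℝ, Measurable K → (∀ z, ‖K z‖ ≤ 4 + 1 * wtLoc z) →
      ContinuousOn (fun t => conv K (θ t) z) (Icc 0 T) := fun K hK hKb => by
    refine h.continuousOn_pairing hd (g := fun ξ => K (z - ξ)) ?_
    -- The indicator of the strip is itself a density, so local integrability of the reflected
    -- kernel is a case of the convolution estimate.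
    refine ((dens_indicator_strip R).integrable_conv_of_le hK.stronglyMeasurable integrable_wtLoc
      hKb z).congr (Eventually.of_forall fun ξ => ?_)
    by_cases hξ : ξ ∈ strip R <;> simp [hξ]
  exact (h1 _ (measurable_K₁ 0) (norm_K₁_le le_rfl)).prodMk
    (h1 _ (measurable_K₂ 0) (norm_K₂_le le_rfl))

/-- The rate is quadratic in `θ`, so weak continuity is not enough by itself. The velocity is frozen
at time `s`: the frozen pairing converges weakly, and the rest tends to `0` by dominated
convergence, as the velocity is continuous in time at each point and uniformly bounded. -/
lemma IsSolution.continuousOn_rate_Icc (h : IsSolution θ₀ θ) (hR : 0 ≤ R)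
    (hd : ∀ t ∈ Icc 0 T, Dens M R (θ t)) {g : Cylinder → ℝ} (hg : Smooth g) :
    ContinuousOn (fun t => rate (θ t) g) (Icc 0 T) := by
  intro s hs
  obtain ⟨A, hA0, hA⟩ := hg.grad.exists_bound R
  set V := velBound M R
  have hV : ∀ t ∈ Icc 0 T, ∀ z, ‖vel 0 (θ t) z‖ ≤ V := fun t ht z =>
    (hd t ht).norm_vel_le hR le_rfl z
  have hM := (hd s hs).M_nonneg
  have hV0 : 0 ≤ V := (norm_nonneg _).trans (hV s hs 0)
  have hsplit : ∀ t ∈ Icc 0 T, rate (θ t) g = (∫ z, θ t z • grad g z (vel 0 (θ t) z - vel 0 (θ s) z))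
      + ∫ z, θ t z * grad g z (vel 0 (θ s) z) := fun t ht => by
    have h1 := (hd t ht).integrable_rate (hd t ht) hR le_rfl hg
    have h2 := (hd t ht).integrable_rate (hd s hs) hR le_rfl hg
    simp only [map_sub, smul_sub]
    rw [integral_sub h1 h2]
    simp [rate]
  have hc2 : Tendsto (fun t => ∫ z, θ t z * grad g z (vel 0 (θ s) z)) (𝓝[Icc 0 T] s)
      (𝓝 (∫ z, θ s z * grad g z (vel 0 (θ s) z))) := by
    refine h.continuousOn_pairing hd (g := fun z => grad g z (vel 0 (θ s) z)) ?_ s hs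
    exact integrable_indicator_of_bound
      (aestronglyMeasurable_grad_apply hg ((hd s hs).aestronglyMeasurable_vel 0)) fun z hz =>
        norm_grad_apply_le hA0 (hA z hz) (hV s hs z)
  have hc1 : Tendsto (fun t => ∫ z, θ t z • grad g z (vel 0 (θ t) z - vel 0 (θ s) z))
      (𝓝[Icc 0 T] s) (𝓝 0) := by
    have hdct : Tendsto (fun t => ∫ z, (strip R).indicator
        (fun z => M * (A * ‖vel 0 (θ t) z - vel 0 (θ s) z‖)) z) (𝓝[Icc 0 T] s)
        (𝓝 (∫ _z : Cylinder, (0:ℝ))) := by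
      refine tendsto_integral_filter_of_dominated_convergence
        ((strip R).indicator fun _ => M * (A * (V + V))) ?_ ?_
        (integrable_indicator_strip R _) ?_
      · filter_upwards [self_mem_nhdsWithin] with t ht
        exact (((((hd t ht).aestronglyMeasurable_vel 0).sub
          ((hd s hs).aestronglyMeasurable_vel 0)).norm.const_mul A).const_mul M).indicator
            (measurableSet_strip R)
      · filter_upwards [self_mem_nhdsWithin] with t ht
        refine Eventually.of_forall fun z => ?_
        by_cases hz : z ∈ strip R
        · simp only [hz, indicator_of_mem]
          rw [Real.norm_eq_abs, abs_of_nonneg (by positivity)]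
          gcongr
          exact (norm_sub_le _ _).trans (add_le_add (hV t ht z) (hV s hs z))
        · simp [hz]
      · refine Eventually.of_forall fun z => ?_
        by_cases hz : z ∈ strip R
        · simp only [hz, indicator_of_mem]
          have h3 := (((h.continuousOn_vel hd z s hs).sub_const (vel 0 (θ s) z)).norm.const_mul
            A).const_mul M
          simpa using h3
        · simpa [hz] using tendsto_const_nhds
    rw [integral_zero] at hdct
    refine squeeze_zero_norm' ?_ hdct
    filter_upwards [self_mem_nhdsWithin] with t ht
    refine norm_integral_le_of_norm_le ?_ ?_
    · refine integrable_indicator_of_bound (C := M * (A * (V + V)))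
        ((((hd t ht).aestronglyMeasurable_vel 0).sub
          ((hd s hs).aestronglyMeasurable_vel 0)).norm.const_mul A |>.const_mul M) fun z hz => ?_
      rw [Real.norm_eq_abs, abs_of_nonneg (by positivity)]
      gcongr
      exact (norm_sub_le _ _).trans (add_le_add (hV t ht z) (hV s hs z))
    · filter_upwards [(hd t ht).bound, (hd t ht).supp] with z hz1 hz2
      by_cases hz : z ∈ strip R
      · simp only [hz, indicator_of_mem]
        rw [norm_smul]
        exact mul_le_mul hz1 (norm_grad_apply_le hA0 (hA z hz) le_rfl) (norm_nonneg _) hM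
      · rw [hz2 (not_le.1 hz)]; simp [hz]
  have hfin := hc1.add hc2
  rw [zero_add] at hfin
  have : rate (θ s) g = ∫ z, θ s z * grad g z (vel 0 (θ s) z) := rfl
  rw [← this] at hfin
  refine hfin.congr' ?_
  filter_upwards [self_mem_nhdsWithin] with t ht
  exact (hsplit t ht).symm

lemma continuousOn_Ici_of_Icc {F : ℝ → ℝ} (h : ∀ T, ContinuousOn F (Icc 0 T)) :
    ContinuousOn F (Ici 0) := fun s hs =>
  (h (s + 1) s ⟨hs, by linarith⟩).mono_of_mem_nhdsWithin <| by
    filter_upwards [self_mem_nhdsWithin, mem_nhdsWithin_of_mem_nhds (gt_mem_nhds (lt_add_one s))]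
      with t h1 h2 using ⟨h1, le_of_lt h2⟩

lemma IsSolution.continuousOn_rate (h : IsSolution θ₀ θ) {g : Cylinder → ℝ} (hg : Smooth g) :
    ContinuousOn (fun t => rate (θ t) g) (Ici 0) :=
  continuousOn_Ici_of_Icc fun T => by
    obtain ⟨M, R, hR, hd⟩ := h.exists_dens T
    exact h.continuousOn_rate_Icc hR hd hg

lemma IsSolution.pairing_eq_of_hasCompactSupport (h : IsSolution θ₀ θ) {g : Cylinder → ℝ}
    (hg : Smooth g) (hgc : HasCompactSupport g) {t : ℝ} (ht : 0 ≤ t) :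
    ∫ z, θ t z * g z = (∫ z, θ₀ z * g z) + ∫ s in (0:ℝ)..t, rate (θ s) g := by
  -- `θ t` carries no information for `t < 0`; both functions of time are extended by their value at
  -- `0`.
  have hext : ∀ F : ℝ → ℝ, ContinuousOn F (Ici 0) → Continuous fun t => F (max t 0) := fun F hF =>
    hF.comp_continuous (continuous_id.max continuous_const) fun t => le_max_right t (0:ℝ)
  have ha := hext _ (h.weakStarContinuous g (hg.continuous.integrable_of_hasCompactSupport hgc))
  have hb := hext _ (h.continuousOn_rate hg)
  have hw := eq_add_integral_of_weak (a₀ := ∫ z, θ₀ z * g z) ha hb (fun χ hχ hχc => ?_) ht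
  · rw [max_eq_left ht] at hw
    rw [hw]
    congr 1
    refine intervalIntegral.integral_congr fun s hs => ?_
    rw [uIcc_of_le ht] at hs
    simp only [max_eq_left hs.1]
  · have hd := h.distributional _ (isTestFunction_mul hχ hχc hg hgc)
    simp only [dt_mul hχ, dx_mul hg, dy_mul hg] at hd
    refine Eq.trans ?_ hd
    congr 1
    · refine setIntegral_congr_fun measurableSet_Ioi fun t ht0 => ?_
      have ht0' : (0:ℝ) < t := ht0
      simp only [max_eq_left ht0'.le]
      obtain ⟨M, R, hR, hdens⟩ := h.exists_dens t
      have hdt := hdens t ⟨ht0'.le, le_rfl⟩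
      have h1 : Integrable (fun z => θ t z • g z) volume := by
        obtain ⟨C, _, hC⟩ := hg.exists_bound R
        exact hdt.integrable_smul hg.continuous.aestronglyMeasurable hC
      have h2 := hdt.integrable_rate hdt hR le_rfl hg
      simp only [smul_eq_mul] at h1 h2
      rw [rate, ← integral_const_mul, ← integral_const_mul, ← integral_add]
      · refine integral_congr_ae (Eventually.of_forall fun z => ?_)
        simp only
        rw [grad_apply_eq z (vel 0 (θ t) z), u₁_eq_conv, u₂_eq_conv]
        simp only [vel, smul_eq_mul]
        ring
      · exact h1.const_mul _
      · exact h2.const_mul _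
    · rw [← integral_const_mul]
      refine integral_congr_ae (Eventually.of_forall fun z => ?_)
      simp only; ring

lemma exists_cutoff (R : ℝ) (hR : 0 ≤ R) {g : Cylinder → ℝ} (hg : Smooth g) :
    ∃ g' : Cylinder → ℝ, Smooth g' ∧ HasCompactSupport g' ∧
      ∀ z : Cylinder, |z.1| ≤ R → g' z = g z ∧ grad g' z = grad g z := by
  let η : ContDiffBump (0 : ℝ) := ⟨R + 1, R + 2, by linarith, by linarith⟩
  refine ⟨fun z => η z.1 * g z, ?_, ?_, fun z hz => ?_⟩
  · exact (η.contDiff.comp contDiff_fst).mul hg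
  · refine HasCompactSupport.intro (K := Metric.closedBall (0:ℝ) (R + 2) ×ˢ univ)
      ((isCompact_closedBall _ _).prod isCompact_univ) fun z hz => ?_
    have hz1 : z.1 ∉ Metric.closedBall (0:ℝ) (R + 2) := fun h1 => hz ⟨h1, mem_univ _⟩
    rw [η.zero_of_le_dist (le_of_lt (not_le.1 hz1)), zero_mul]
  · have hone : ∀ x : ℝ, |x| ≤ R + 1 → η x = 1 := fun x hx =>
      η.one_of_mem_closedBall (by rw [mem_closedBall_zero_iff]; exact hx)
    refine ⟨by simp only [hone _ (show |z.1| ≤ R + 1 by linarith), one_mul], ?_⟩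
    obtain ⟨p, rfl⟩ := proj_surjective z
    rw [grad_proj, grad_proj]
    refine Filter.EventuallyEq.fderiv_eq ?_
    have hp : |p.1| < R + 1 := by have := hz; rw [proj_fst] at this; linarith
    filter_upwards [(isOpen_lt (continuous_fst.abs) continuous_const).mem_nhds hp] with q hq
    have hq' : |q.1| < R + 1 := hq
    simp only [lift]
    rw [proj_fst, hone _ hq'.le, one_mul]

lemma Dens.pairing_congr {f : Cylinder → ℝ} (hf : Dens M R f) {g g' : Cylinder → ℝ}
    (h : ∀ z : Cylinder, |z.1| ≤ R → g' z = g z) : ∫ z, f z * g' z = ∫ z, f z * g z := by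
  refine integral_congr_ae ?_
  filter_upwards [hf.supp] with z hz
  by_cases hzR : |z.1| ≤ R
  · rw [h z hzR]
  · rw [hz (not_le.1 hzR), zero_mul, zero_mul]

/-- The equation tested with a smooth function of arbitrary support. -/
lemma IsSolution.pairing_eq (h : IsSolution θ₀ θ) {M₀ R₀ : ℝ} (h₀ : Dens M₀ R₀ θ₀)
    {g : Cylinder → ℝ} (hg : Smooth g) {t : ℝ} (ht : 0 ≤ t) :
    ∫ z, θ t z * g z = (∫ z, θ₀ z * g z) + ∫ s in (0:ℝ)..t, rate (θ s) g := by
  obtain ⟨M, R, hR, hd⟩ := h.exists_dens t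
  obtain ⟨g', hg', hgc, hgg⟩ := exists_cutoff (max R R₀) (le_max_of_le_left hR) hg
  have h1 := h.pairing_eq_of_hasCompactSupport hg' hgc ht
  have hRm : ∀ s ∈ Icc 0 t, Dens M (max R R₀) (θ s) := fun s hs =>
    (hd s hs).mono le_rfl (le_max_left _ _)
  rw [(hRm t ⟨ht, le_rfl⟩).pairing_congr fun z hz => (hgg z hz).1,
    (h₀.mono le_rfl (le_max_right R R₀)).pairing_congr fun z hz => (hgg z hz).1] at h1
  rw [h1]
  congr 1
  refine intervalIntegral.integral_congr fun s hs => ?_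
  rw [uIcc_of_le ht] at hs
  exact (hRm s hs).pairing_congr fun z hz => by rw [(hgg z hz).2]

lemma IsSolution.pairing_sub_eq (h : IsSolution θ₀ θ) {M₀ R₀ : ℝ} (h₀ : Dens M₀ R₀ θ₀)
    {g : Cylinder → ℝ} (hg : Smooth g) {s t : ℝ} (hs : 0 ≤ s) (hst : s ≤ t) :
    (∫ z, θ t z * g z) - ∫ z, θ s z * g z = ∫ τ in s..t, rate (θ τ) g := by
  have hi : ∀ r, 0 ≤ r → IntervalIntegrable (fun τ => rate (θ τ) g) volume 0 r := fun r hr =>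
    ((h.continuousOn_rate hg).mono (by rw [uIcc_of_le hr]; exact Icc_subset_Ici_self)).intervalIntegrable
  rw [h.pairing_eq h₀ hg hs, h.pairing_eq h₀ hg (hs.trans hst),
    ← intervalIntegral.integral_add_adjacent_intervals (hi s hs)
      ((hi s hs).symm.trans (hi t (hs.trans hst)))]
  ring

end Solution

/-! ### Divergence-free fields and Euler steps. -/

/-- Divergence-free fields on the cylinder, with bounds for the field and its differential and a
Lipschitz bound for the differential. -/
structure Field (V L N : ℝ) (v : Cylinder → ℝ × ℝ) : Prop where
  smooth : Smooth v
  norm_le : ∀ z, ‖v z‖ ≤ V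
  grad_le : ∀ z, ‖grad v z‖ ≤ L
  grad_lip : ∀ p q, ‖lift (grad v) p - lift (grad v) q‖ ≤ N * ‖p - q‖
  div_eq_zero : ∀ z, (grad v z (1, 0)).1 + (grad v z (0, 1)).2 = 0

/-- Smooth functions with a bound and a Lipschitz bound for the differential. -/
structure Ctrl (A B : ℝ) (φ : Cylinder → ℝ) : Prop where
  smooth : Smooth φ
  grad_le : ∀ z, ‖grad φ z‖ ≤ A
  grad_lip : ∀ p q, ‖lift (grad φ) p - lift (grad φ) q‖ ≤ B * ‖p - q‖

/-- Functions vanishing for `|x| > R`. -/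
def SuppIn (R : ℝ) (φ : Cylinder → ℝ) : Prop := ∀ z : Cylinder, R < |z.1| → φ z = 0

/-- Composition with an Euler step of length `h` along `v`. -/
noncomputable def step (h : ℝ) (v : Cylinder → ℝ × ℝ) (φ : Cylinder → ℝ) (z : Cylinder) : ℝ :=
  φ (z + proj (h • v z))

lemma lift_step (h : ℝ) (v : Cylinder → ℝ × ℝ) (φ : Cylinder → ℝ) :
    lift (step h v φ) = fun p => lift φ (p + h • lift v p) := by
  funext p; simp only [lift, step, proj_add]

section Step

variable {V L N A B h : ℝ} {v : Cylinder → ℝ × ℝ} {φ : Cylinder → ℝ}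

lemma Field.V_nonneg (hv : Field V L N v) : 0 ≤ V := (norm_nonneg _).trans (hv.norm_le 0)

lemma Field.L_nonneg (hv : Field V L N v) : 0 ≤ L := (norm_nonneg _).trans (hv.grad_le 0)

lemma nonneg_of_lip {E : Type} [NormedAddCommGroup E] {F : ℝ × ℝ → E} {N : ℝ}
    (h : ∀ p q, ‖F p - F q‖ ≤ N * ‖p - q‖) : 0 ≤ N := by
  have := (norm_nonneg _).trans (h (1, 0) 0)
  rw [sub_zero] at this
  have h1 : ‖((1:ℝ), (0:ℝ))‖ = 1 := by simp [Prod.norm_def]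
  rwa [h1, mul_one] at this

lemma Ctrl.A_nonneg (hφ : Ctrl A B φ) : 0 ≤ A := (norm_nonneg _).trans (hφ.grad_le 0)

lemma Ctrl.B_nonneg (hφ : Ctrl A B φ) : 0 ≤ B := nonneg_of_lip hφ.grad_lip

lemma Field.N_nonneg (hv : Field V L N v) : 0 ≤ N := nonneg_of_lip hv.grad_lip

lemma Field.lip (hv : Field V L N v) (p q : ℝ × ℝ) : ‖lift v p - lift v q‖ ≤ L * ‖p - q‖ :=
  norm_sub_le_of_grad hv.smooth.differentiable hv.grad_le p q

lemma Ctrl.lip (hφ : Ctrl A B φ) (p q : ℝ × ℝ) : ‖lift φ p - lift φ q‖ ≤ A * ‖p - q‖ :=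
  norm_sub_le_of_grad hφ.smooth.differentiable hφ.grad_le p q

lemma Field.lip_step (hv : Field V L N v) (hh : 0 ≤ h) (p q : ℝ × ℝ) :
    ‖(p + h • lift v p) - (q + h • lift v q)‖ ≤ (1 + h * L) * ‖p - q‖ := by
  rw [show (p + h • lift v p) - (q + h • lift v q) = (p - q) + h • (lift v p - lift v q) by
    rw [smul_sub]; abel]
  refine (norm_add_le _ _).trans ?_
  rw [norm_smul, Real.norm_eq_abs, abs_of_nonneg hh]
  nlinarith [mul_le_mul_of_nonneg_left (hv.lip p q) hh]

/-- The new gradient bound involves only `A` and `L`, not `B` or `N`. Its growth under iteration is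
therefore `exp (time * L)`, the one growth rate that must stay logarithmic in `σ`. -/
lemma Ctrl.step (hφ : Ctrl A B φ) (hv : Field V L N v) (hh : 0 ≤ h) :
    Ctrl (A * (1 + h * L)) (B * (1 + h * L) ^ 2 + A * (h * N)) (step h v φ) := by
  have hL := hv.L_nonneg
  have hA := hφ.A_nonneg
  have hB := hφ.B_nonneg
  have hN := hv.N_nonneg
  have hsm : Smooth (CylEuler.step h v φ) := by
    rw [Smooth, lift_step]
    exact ContDiff.comp (g := lift φ) hφ.smooth 
      (contDiff_id.add (ContDiff.const_smul (f := lift v) h hv.smooth))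
  refine ⟨hsm, ?_, fun p q => ?_⟩
  · refine norm_grad_le_of_lipschitz (by positivity) fun p q => ?_
    rw [lift_step]
    refine (hφ.lip _ _).trans ?_
    rw [mul_assoc]
    exact mul_le_mul_of_nonneg_left (hv.lip_step hh p q) hA
  · have hd : ∀ p, lift (grad (CylEuler.step h v φ)) p = (lift (grad φ) (p + h • lift v p)).comp
        (ContinuousLinearMap.id ℝ (ℝ × ℝ) + h • lift (grad v) p) := fun p => by
      rw [lift, grad_proj, lift_step]
      have h1 := (hφ.smooth.hasFDerivAt (p + h • lift v p)).comp p
        ((hasFDerivAt_id p).add ((hv.smooth.hasFDerivAt p).const_smul h))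
      exact h1.fderiv
    have hn : ∀ p, ‖ContinuousLinearMap.id ℝ (ℝ × ℝ) + h • lift (grad v) p‖ ≤ 1 + h * L :=
      fun p => by
        refine (norm_add_le _ _).trans (add_le_add ContinuousLinearMap.norm_id_le ?_)
        rw [norm_smul, Real.norm_eq_abs, abs_of_nonneg hh]
        exact mul_le_mul_of_nonneg_left (hv.grad_le _) hh
    rw [hd, hd]
    set P := lift (grad φ) (p + h • lift v p)
    set Q := lift (grad φ) (q + h • lift v q) with hQ
    have hPQ : ‖P - Q‖ ≤ B * ((1 + h * L) * ‖p - q‖) :=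
      (hφ.grad_lip _ _).trans (mul_le_mul_of_nonneg_left (hv.lip_step hh p q) hB)
    have hQA : ‖Q‖ ≤ A := hφ.grad_le _
    have hsplit : P.comp (ContinuousLinearMap.id ℝ (ℝ × ℝ) + h • lift (grad v) p) -
        Q.comp (ContinuousLinearMap.id ℝ (ℝ × ℝ) + h • lift (grad v) q) =
        (P - Q).comp (ContinuousLinearMap.id ℝ (ℝ × ℝ) + h • lift (grad v) p) +
        Q.comp (h • (lift (grad v) p - lift (grad v) q)) := by
      ext <;> simp <;> ring
    rw [hsplit]
    refine (norm_add_le _ _).trans ?_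
    have h1 : ‖(P - Q).comp (ContinuousLinearMap.id ℝ (ℝ × ℝ) + h • lift (grad v) p)‖ ≤
        B * ((1 + h * L) * ‖p - q‖) * (1 + h * L) :=
      (ContinuousLinearMap.opNorm_comp_le _ _).trans
        (mul_le_mul hPQ (hn p) (norm_nonneg _) (by positivity))
    have h2 : ‖Q.comp (h • (lift (grad v) p - lift (grad v) q))‖ ≤ A * (h * (N * ‖p - q‖)) := by
      refine (ContinuousLinearMap.opNorm_comp_le _ _).trans (mul_le_mul hQA ?_ (norm_nonneg _) hA)
      rw [norm_smul, Real.norm_eq_abs, abs_of_nonneg hh]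
      exact mul_le_mul_of_nonneg_left (hv.grad_lip p q) hh
    calc _ ≤ _ := add_le_add h1 h2
      _ = _ := by ring

/-- First-order Taylor estimate on the ball of radius `h V`, where the differential of `φ` varies by
at most `B h V`. -/
lemma Ctrl.abs_step_sub_le (hφ : Ctrl A B φ) (hv : Field V L N v) (hh : 0 ≤ h) (z : Cylinder) :
    |CylEuler.step h v φ z - φ z - h * grad φ z (v z)| ≤ B * (h * V) ^ 2 := by
  have hV := hv.V_nonneg
  have hB := hφ.B_nonneg
  obtain ⟨p, rfl⟩ := proj_surjective z
  set w := h • v (proj p) with hw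
  have hwn : ‖w‖ ≤ h * V := by
    rw [hw, norm_smul, Real.norm_eq_abs, abs_of_nonneg hh]
    exact mul_le_mul_of_nonneg_left (hv.norm_le _) hh
  have key := Convex.norm_image_sub_le_of_norm_fderiv_le' (𝕜 := ℝ) (f := lift φ)
    (φ := grad φ (proj p)) (C := B * (h * V)) (s := Metric.closedBall p (h * V)) (x := p) (y := p + w)
    (fun x _ => hφ.smooth.differentiable x) (fun x hx => by
      rw [← grad_proj]
      refine (hφ.grad_lip x p).trans (mul_le_mul_of_nonneg_left ?_ hB)
      rw [← dist_eq_norm]; exact hx)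
    (convex_closedBall _ _) (Metric.mem_closedBall_self (by positivity))
    (by rw [Metric.mem_closedBall, dist_eq_norm, add_sub_cancel_left]; exact hwn)
  rw [add_sub_cancel_left, Real.norm_eq_abs] at key
  have h1 : lift φ (p + w) = CylEuler.step h v φ (proj p) := by
    simp only [lift, CylEuler.step, proj_add, hw]
  have h2 : grad φ (proj p) w = h * grad φ (proj p) (v (proj p)) := by
    rw [hw, map_smul, smul_eq_mul]
  rw [h1, h2] at key
  refine key.trans ?_
  rw [show B * (h * V) ^ 2 = B * (h * V) * (h * V) by ring]
  exact mul_le_mul_of_nonneg_left hwn (by positivity)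

lemma SuppIn.step {R : ℝ} (hφ : SuppIn R φ) (hv : Field V L N v) (hh : 0 ≤ h) :
    SuppIn (R + h * V) (CylEuler.step h v φ) := fun z hz => by
  refine hφ _ ?_
  have h1 : |(h • v z).1| ≤ h * V := by
    rw [Prod.smul_fst, smul_eq_mul, abs_mul, abs_of_nonneg hh]
    exact mul_le_mul_of_nonneg_left ((norm_fst_le (v z)).trans (hv.norm_le z)) hh
  rw [Prod.fst_add, proj_fst]
  have := abs_sub_abs_le_abs_add z.1 (h • v z).1
  linarith

lemma SuppIn.mono {R R' : ℝ} (hφ : SuppIn R φ) (h : R ≤ R') : SuppIn R' φ :=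
  fun z hz => hφ z (h.trans_lt hz)

lemma SuppIn.grad {R : ℝ} {E : Type} [NormedAddCommGroup E] [NormedSpace ℝ E] {F : Cylinder → E}
    (hF : ∀ z : Cylinder, R < |z.1| → F z = 0) (z : Cylinder) (hz : R < |z.1|) :
    CylEuler.grad F z = 0 := by
  obtain ⟨p, rfl⟩ := proj_surjective z
  rw [grad_proj]
  have : lift F =ᶠ[𝓝 p] fun _ => 0 := by
    filter_upwards [(isOpen_lt continuous_const (continuous_fst.abs)).mem_nhds hz] with q hq
    exact hF (proj q) hq
  rw [this.fderiv_eq]; simp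

lemma integrable_of_suppIn {R : ℝ} {E : Type} [NormedAddCommGroup E] {F : Cylinder → E}
    (hc : Continuous F) (hF : ∀ z : Cylinder, R < |z.1| → F z = 0) : Integrable F volume := by
  refine hc.integrable_of_hasCompactSupport (HasCompactSupport.intro (K := Icc (-R) R ×ˢ univ)
    (isCompact_Icc.prod isCompact_univ) fun z hz => hF z ?_)
  by_contra! h
  exact hz ⟨abs_le.1 h, mem_univ _⟩

/-- The convolution of `F` with the indicator of the larger strip is, near the origin, the constant
`∫ F`. Its differential there is `∫ grad F`, which must vanish; no boundary terms are needed. -/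
lemma integral_grad_eq_zero {R : ℝ} {E : Type} [NormedAddCommGroup E] [NormedSpace ℝ E]
    [CompleteSpace E] {F : Cylinder → E}
    (hs : Smooth F) (hF : ∀ z : Cylinder, R < |z.1| → F z = 0) : ∫ z, grad F z = 0 := by
  have hd := dens_indicator_strip (R + 1)
  have hcut : ∀ G : Cylinder → E, (∀ z : Cylinder, R < |z.1| → G z = 0) → ∀ q : ℝ × ℝ, |q.1| < 1 →
      conv G ((strip (R + 1)).indicator fun _ => 1) (proj q) = ∫ z, G z := fun G hG q hq => by
    rw [conv, ← integral_sub_left_eq_self G volume (proj q)]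
    refine integral_congr_ae (Eventually.of_forall fun ξ => ?_)
    by_cases hξ : ξ ∈ strip (R + 1)
    · simp [hξ]
    · have h1 : R + 1 < |ξ.1| := not_le.1 hξ
      have h2 : R < |(proj q - ξ).1| := by
        have := abs_sub_abs_le_abs_sub ξ.1 q.1
        rw [Prod.fst_sub, proj_fst, abs_sub_comm]
        linarith
      simp [hG _ h2]
  have h1 := hd.hasFDerivAt_conv hs 0
  have h2 : lift (conv F ((strip (R + 1)).indicator fun _ => 1)) =ᶠ[𝓝 0] fun _ => ∫ z, F z := by
    filter_upwards [(isOpen_lt (continuous_fst.abs) continuous_const).mem_nhds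
      (show |(0 : ℝ × ℝ).1| < 1 by simp)] with q hq
    exact hcut F hF q hq
  have h3 := (h1.congr_of_eventuallyEq h2.symm).unique (hasFDerivAt_const _ _)
  have h4 : conv (grad F) ((strip (R + 1)).indicator fun _ => 1) (proj 0) = ∫ z, grad F z := by
    rw [conv, ← integral_sub_left_eq_self (grad F) volume (proj 0)]
    refine integral_congr_ae (Eventually.of_forall fun ξ => ?_)
    by_cases hξ : ξ ∈ strip (R + 1)
    · simp [hξ]
    · have h1 : R + 1 < |ξ.1| := not_le.1 hξ
      have h2 : R < |(proj 0 - ξ).1| := by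
        rw [Prod.fst_sub, proj_fst, abs_sub_comm]
        simp; linarith
      simp only [hξ, not_false_eq_true, indicator_of_notMem, zero_smul]
      exact (SuppIn.grad hF _ h2).symm
  rw [← h4, h3]

/-- Divergence theorem for `φ v`, whose divergence is `grad φ · v` because `v` is divergence-free.
-/
lemma Field.integral_grad_apply (hv : Field V L N v) {R : ℝ} (hφ : Smooth φ) (hs : SuppIn R φ) :
    ∫ z, grad φ z (v z) = 0 := by
  set F : Cylinder → ℝ × ℝ := fun z => φ z • v z with hFdef
  have hF : Smooth F := ContDiff.smul (f := lift φ) (g := lift v) hφ hv.smooth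
  have hFs : ∀ z : Cylinder, R < |z.1| → F z = 0 := fun z hz => by
    rw [hFdef]; simp only [hs z hz, zero_smul]
  have hgrad : ∀ z w, grad F z w = φ z • grad v z w + grad φ z w • v z := fun z w => by
    obtain ⟨p, rfl⟩ := proj_surjective z
    rw [grad_eq_of_hasFDerivAt (F := F) ((hφ.hasFDerivAt p).smul (hv.smooth.hasFDerivAt p))]
    simp [lift]
  have hi := integrable_of_suppIn hF.grad.continuous (SuppIn.grad hFs)
  have h0 := integral_grad_eq_zero hF hFs
  have h1 : ∫ z, (grad F z (1, 0)).1 = 0 := by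
    have := ((ContinuousLinearMap.fst ℝ ℝ ℝ).comp
      (ContinuousLinearMap.apply ℝ (ℝ × ℝ) ((1:ℝ), (0:ℝ)))).integral_comp_comm hi
    rw [h0, map_zero] at this
    exact this
  have h2 : ∫ z, (grad F z (0, 1)).2 = 0 := by
    have := ((ContinuousLinearMap.snd ℝ ℝ ℝ).comp
      (ContinuousLinearMap.apply ℝ (ℝ × ℝ) ((0:ℝ), (1:ℝ)))).integral_comp_comm hi
    rw [h0, map_zero] at this
    exact this
  have i1 := ((ContinuousLinearMap.fst ℝ ℝ ℝ).comp
      (ContinuousLinearMap.apply ℝ (ℝ × ℝ) ((1:ℝ), (0:ℝ)))).integrable_comp hi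
  have i2 := ((ContinuousLinearMap.snd ℝ ℝ ℝ).comp
      (ContinuousLinearMap.apply ℝ (ℝ × ℝ) ((0:ℝ), (1:ℝ)))).integrable_comp hi
  have h3 : ∫ z, ((grad F z (1, 0)).1 + (grad F z (0, 1)).2) = 0 := by
    have := integral_add i1 i2
    simp only [ContinuousLinearMap.comp_apply, ContinuousLinearMap.apply_apply,
      ContinuousLinearMap.coe_fst', ContinuousLinearMap.coe_snd'] at this
    rw [this, h1, h2, add_zero]
  rw [← h3]
  refine integral_congr_ae (Eventually.of_forall fun z => ?_)
  have hdiv := hv.div_eq_zero z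
  simp only [hgrad, Prod.fst_add, Prod.snd_add, Prod.smul_fst, Prod.smul_snd, smul_eq_mul]
  rw [grad_apply_eq z (v z)]
  linear_combination -φ z * hdiv

/-- An Euler step need not preserve area, but the first-order term integrates to zero. The error is
quadratic in `h`, so it disappears when steps are refined. -/
lemma Ctrl.abs_integral_step_sub_le (hφ : Ctrl A B φ) (hv : Field V L N v) (hh : 0 ≤ h) {R : ℝ}
    (hs : SuppIn R φ) (hR : 0 ≤ R + h * V) :
    |(∫ z, CylEuler.step h v φ z) - ∫ z, φ z| ≤
      4 * Real.pi * (R + h * V) * (B * (h * V) ^ 2) := by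
  have hV := hv.V_nonneg
  have hsm := (hφ.step hv hh).smooth
  have hs' := hs.step hv hh
  have hle : R ≤ R + h * V := by nlinarith [mul_nonneg hh hV]
  have i1 := integrable_of_suppIn hsm.continuous hs'
  have i2 := integrable_of_suppIn hφ.smooth.continuous hs
  have hgs : ∀ z : Cylinder, R < |z.1| → grad φ z (v z) = 0 := fun z hz => by
    rw [SuppIn.grad hs z hz]; simp
  have i3 : Integrable (fun z => h * grad φ z (v z)) volume :=
    (integrable_of_suppIn (hφ.smooth.grad.continuous.clm_apply hv.smooth.continuous) hgs).const_mul h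
  have heq : (∫ z, CylEuler.step h v φ z) - ∫ z, φ z =
      ∫ z, (CylEuler.step h v φ z - φ z - h * grad φ z (v z)) := by
    have i12 : Integrable (fun z => CylEuler.step h v φ z - φ z) volume := i1.sub i2
    rw [integral_sub i12 i3, integral_sub i1 i2, integral_const_mul,
      hv.integral_grad_apply hφ.smooth hs, mul_zero, sub_zero]
  rw [heq, ← Real.norm_eq_abs]
  calc ‖∫ z, (CylEuler.step h v φ z - φ z - h * grad φ z (v z))‖
      ≤ ∫ z, (strip (R + h * V)).indicator (fun _ => B * (h * V) ^ 2) z := by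
        refine norm_integral_le_of_norm_le (integrable_indicator_strip _ _)
          (Eventually.of_forall fun z => ?_)
        by_cases hz : z ∈ strip (R + h * V)
        · simp only [hz, indicator_of_mem]
          exact hφ.abs_step_sub_le hv hh z
        · have h1 : R + h * V < |z.1| := not_le.1 hz
          rw [hs' z h1, hs z (hle.trans_lt h1), hgs z (hle.trans_lt h1)]
          simp [hz]
    _ = _ := by
        rw [integral_indicator (measurableSet_strip _), setIntegral_const,
          volume_real_strip hR, smul_eq_mul]

/-- It makes `grad φ · v` an admissible test function, so its pairing with `θ` is Lipschitz in time.
-/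
lemma Ctrl.apply_lip (hφ : Ctrl A B φ) (hv : Field V L N v) :
    Smooth (fun z => grad φ z (v z)) ∧ ∀ z, ‖grad (fun z => grad φ z (v z)) z‖ ≤ B * V + A * L := by
  have hA := hφ.A_nonneg
  have hB := hφ.B_nonneg
  have hL := hv.L_nonneg
  have hV := hv.V_nonneg
  refine ⟨ContDiff.clm_apply (f := lift (grad φ)) (g := lift v) hφ.smooth.grad hv.smooth,
    norm_grad_le_of_lipschitz (by positivity) fun p q => ?_⟩
  have : lift (fun z => grad φ z (v z)) p - lift (fun z => grad φ z (v z)) q =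
      (lift (grad φ) p - lift (grad φ) q) (lift v p) +
      lift (grad φ) q (lift v p - lift v q) := by
    simp [lift]
  rw [this]
  refine (norm_add_le _ _).trans ?_
  rw [add_mul]
  refine add_le_add ?_ ?_
  · refine (ContinuousLinearMap.le_opNorm _ _).trans ?_
    calc _ ≤ B * ‖p - q‖ * V :=
          mul_le_mul (hφ.grad_lip p q) (hv.norm_le _) (norm_nonneg _) (by positivity)
      _ = _ := by ring
  · refine (ContinuousLinearMap.le_opNorm _ _).trans ?_
    calc _ ≤ A * (L * ‖p - q‖) := mul_le_mul (hφ.grad_le _) (hv.lip p q) (norm_nonneg _) hA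
      _ = _ := by ring

end Step

/-! ### The regularised velocity as a field -/

/-- The regularised Biot-Savart kernel. -/
noncomputable def kernel (δ : ℝ) (z : Cylinder) : ℝ × ℝ := (K₁ δ z, K₂ δ z)

section Kernel

variable {δ : ℝ} (hδ : 0 < δ)
include hδ

lemma smooth_kernel : Smooth (kernel δ) :=
  ContDiff.prodMk (f := lift (K₁ δ)) (g := lift (K₂ δ)) (smooth_K₁ hδ) (smooth_K₂ hδ)

lemma grad_kernel (z : Cylinder) :
    grad (kernel δ) z = (grad (K₁ δ) z).prod (grad (K₂ δ) z) := by
  obtain ⟨p, rfl⟩ := proj_surjective z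
  exact grad_eq_of_hasFDerivAt
    (((smooth_K₁ hδ).hasFDerivAt p).prodMk ((smooth_K₂ hδ).hasFDerivAt p))

lemma norm_grad_kernel_le (z : Cylinder) : ‖grad (kernel δ) z‖ ≤ 8 + 3 * invLoc δ z := by
  rw [grad_kernel hδ, ContinuousLinearMap.opNorm_prod, Prod.norm_def]
  exact max_le (norm_grad_K₁_le hδ z) (norm_grad_K₂_le hδ z)

lemma grad_kernel_lipschitz : ∃ C, 0 ≤ C ∧ (∀ z, ‖grad (kernel δ) z‖ ≤ C) ∧
    ∀ p q, ‖lift (grad (kernel δ)) p - lift (grad (kernel δ)) q‖ ≤ C * ‖p - q‖ := by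
  obtain ⟨C, hC, h1, h2⟩ := grad_K₁_lipschitz hδ
  obtain ⟨C', hC', h1', h2'⟩ := grad_K₂_lipschitz hδ
  refine ⟨max C C', le_max_of_le_left hC, fun z => ?_, fun p q => ?_⟩
  · rw [grad_kernel hδ, ContinuousLinearMap.opNorm_prod, Prod.norm_def]
    exact max_le_max (h1 z) (h1' z)
  · have : lift (grad (kernel δ)) p - lift (grad (kernel δ)) q =
        (lift (grad (K₁ δ)) p - lift (grad (K₁ δ)) q).prod
          (lift (grad (K₂ δ)) p - lift (grad (K₂ δ)) q) := by
      simp only [lift, grad_kernel hδ]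
      ext <;> simp
    rw [this, ContinuousLinearMap.opNorm_prod, Prod.norm_def]
    refine max_le ((h2 p q).trans ?_) ((h2' p q).trans ?_)
    · gcongr; exact le_max_left _ _
    · gcongr; exact le_max_right _ _

lemma div_kernel (z : Cylinder) :
    (grad (kernel δ) z (1, 0)).1 + (grad (kernel δ) z (0, 1)).2 = 0 := by
  rw [grad_kernel hδ]
  obtain ⟨p, rfl⟩ := proj_surjective z
  rw [grad_eq_of_hasFDerivAt (hasFDerivAt_lift_K₁ hδ p),
    grad_eq_of_hasFDerivAt (hasFDerivAt_lift_K₂ hδ p)]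
  simp [form_apply]
  ring

lemma Dens.vel_eq_conv {M R : ℝ} {f : Cylinder → ℝ} (h : Dens M R f) :
    vel δ f = conv (kernel δ) f := by
  funext z
  rw [vel, conv, conv, conv, ← integral_pair (h.integrable_K₁ hδ.le z) (h.integrable_K₂ hδ.le z)]
  rfl

end Kernel

/-- Bound of the differential of the regularised velocity; logarithmic in `σ = δ ^ (1 / 4)`. -/
noncomputable def gradBound (M R σ : ℝ) : ℝ :=
  8 * (4 * Real.pi * R * M) +
    3 * (M * (8 * Real.pi ^ 2 * Real.log ((1 + σ ^ 2) / σ ^ 2)))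

/-- Smoothness, gradient bound and zero divergence pass from the kernel to the velocity through the
convolution. Only the gradient bound is explicit in `σ`; `C` depends on `σ` in an unspecified way
but is common to all densities. -/
lemma exists_field {σ : ℝ} (hσ : 0 < σ) : ∃ C, 0 ≤ C ∧ (∀ z, ‖grad (kernel (σ ^ 4)) z‖ ≤ C) ∧
    ∀ (M R : ℝ) (f : Cylinder → ℝ), 0 ≤ R → Dens M R f →
      Field (velBound M R) (gradBound M R σ) (4 * Real.pi * R * M * C) (vel (σ ^ 4) f) := by
  have hδ : 0 < σ ^ 4 := by positivity
  obtain ⟨C, hC, h1, h2⟩ := grad_kernel_lipschitz hδ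
  refine ⟨C, hC, h1, fun M R f hR hf => ?_⟩
  have hM := hf.M_nonneg
  have hk := smooth_kernel hδ
  have hv := hf.vel_eq_conv hδ
  have hg : grad (vel (σ ^ 4) f) = conv (grad (kernel (σ ^ 4))) f := by rw [hv, hf.grad_conv hk]
  refine ⟨?_, fun z => hf.norm_vel_le hR hδ.le z, fun z => ?_, fun p q => ?_, fun z => ?_⟩
  · rw [hv]; exact hf.smooth_conv hk
  · rw [hg]
    refine (hf.norm_conv_le (integrable_invLoc hδ) (invLoc_nonneg hδ) (by norm_num)
      (norm_grad_kernel_le hδ) z).trans ?_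
    rw [gradBound]
    have := hf.integral_abs_le hR
    have := integral_invLoc_le hσ
    gcongr
  · rw [hg]
    have i := fun z => hf.integrable_conv hk.grad z
    have : lift (conv (grad (kernel (σ ^ 4))) f) p - lift (conv (grad (kernel (σ ^ 4))) f) q =
        ∫ ξ, f ξ • (grad (kernel (σ ^ 4)) (proj p - ξ) - grad (kernel (σ ^ 4)) (proj q - ξ)) := by
      rw [lift, lift, conv, conv, ← integral_sub (i _) (i _)]
      simp only [smul_sub]
    rw [this, mul_assoc]
    refine hf.norm_integral_smul_le hR (by positivity) fun ξ _ => ?_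
    obtain ⟨r, rfl⟩ := proj_surjective ξ
    have := h2 (p - r) (q - r)
    simpa [lift, proj_sub] using this
  · rw [hg]
    have i := hf.integrable_conv hk.grad z
    have e1 := ((ContinuousLinearMap.fst ℝ ℝ ℝ).comp
      (ContinuousLinearMap.apply ℝ (ℝ × ℝ) ((1:ℝ), (0:ℝ))) +
      (ContinuousLinearMap.snd ℝ ℝ ℝ).comp
      (ContinuousLinearMap.apply ℝ (ℝ × ℝ) ((0:ℝ), (1:ℝ)))).integral_comp_comm i
    refine Eq.trans e1.symm ?_
    refine integral_eq_zero_of_ae (Eventually.of_forall fun ξ => ?_)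
    have := div_kernel hδ (z - ξ)
    simp only [add_apply, ContinuousLinearMap.comp_apply,
      ContinuousLinearMap.apply_apply, smul_apply, Pi.zero_apply,
      ContinuousLinearMap.coe_fst', ContinuousLinearMap.coe_snd', Prod.smul_fst, Prod.smul_snd,
      ← smul_add]
    rw [this, smul_zero]

lemma norm_grad_reflect_le {F : Cylinder → ℝ} (hF : Smooth F) {C : ℝ} (hC0 : 0 ≤ C)
    (hC : ∀ z, ‖grad F z‖ ≤ C) (z ξ : Cylinder) : ‖grad (fun ξ => F (z - ξ)) ξ‖ ≤ C := by
  refine norm_grad_le_of_lipschitz hC0 (fun p q => ?_) ξ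
  obtain ⟨r, rfl⟩ := proj_surjective z
  have := norm_sub_le_of_grad hF.differentiable hC (r - p) (r - q)
  rw [show r - p - (r - q) = -(p - q) by abel, norm_neg] at this
  simpa [lift, proj_sub] using this

lemma norm_grad_K₁_le_kernel {δ : ℝ} (hδ : 0 < δ) (z : Cylinder) :
    ‖grad (K₁ δ) z‖ ≤ ‖grad (kernel δ) z‖ := by
  rw [grad_kernel hδ, ContinuousLinearMap.opNorm_prod]; exact norm_fst_le (_, _)

lemma norm_grad_K₂_le_kernel {δ : ℝ} (hδ : 0 < δ) (z : Cylinder) :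
    ‖grad (K₂ δ) z‖ ≤ ‖grad (kernel δ) z‖ := by
  rw [grad_kernel hδ, ContinuousLinearMap.opNorm_prod]; exact norm_snd_le (_, _)

/-! ### Consistency of one Euler step with the equation. -/

section Solution

variable {θ₀ : Cylinder → ℝ} {θ : ℝ → Cylinder → ℝ} {M R T M₀ R₀ : ℝ}

lemma IsSolution.abs_pairing_sub_le (h : IsSolution θ₀ θ) (h₀ : Dens M₀ R₀ θ₀) (hR : 0 ≤ R)
    (hd : ∀ t ∈ Icc 0 T, Dens M R (θ t)) {s t : ℝ} (hs : 0 ≤ s) (hst : s ≤ t) (htT : t ≤ T)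
    {g : Cylinder → ℝ} (hg : Smooth g) {A : ℝ} (hA : ∀ z, ‖grad g z‖ ≤ A) :
    |(∫ z, θ t z * g z) - ∫ z, θ s z * g z| ≤
      (t - s) * (4 * Real.pi * R * M * (A * velBound M R)) := by
  rw [h.pairing_sub_eq h₀ hg hs hst, ← Real.norm_eq_abs]
  have := intervalIntegral.norm_integral_le_of_norm_le_const (a := s) (b := t)
    (f := fun τ => rate (θ τ) g) (C := 4 * Real.pi * R * M * (A * velBound M R)) fun τ hτ => by
      rw [uIoc_of_le hst] at hτ
      exact (hd τ ⟨hs.trans hτ.1.le, hτ.2.trans htT⟩).abs_rate_le hR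
        ((norm_nonneg _).trans (hA 0)) fun z _ => hA z
  rwa [abs_of_nonneg (sub_nonneg.2 hst), mul_comm] at this

/-- At a fixed point the regularised velocity is the pairing of `θ` with a smooth reflected kernel,
so the weak equation makes it Lipschitz in time. -/
lemma IsSolution.norm_vel_sub_le (h : IsSolution θ₀ θ) (h₀ : Dens M₀ R₀ θ₀) (hR : 0 ≤ R)
    (hd : ∀ t ∈ Icc 0 T, Dens M R (θ t)) {s t : ℝ} (hs : 0 ≤ s) (hst : s ≤ t) (htT : t ≤ T)
    {δ C : ℝ} (hδ : 0 < δ) (hC : ∀ z, ‖grad (kernel δ) z‖ ≤ C) (z : Cylinder) :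
    ‖vel δ (θ t) z - vel δ (θ s) z‖ ≤
      (t - s) * (4 * Real.pi * R * M * (C * velBound M R)) := by
  have hC0 := (norm_nonneg _).trans (hC 0)
  rw [vel, vel, Prod.mk_sub_mk, Prod.norm_def]
  exact max_le
    (h.abs_pairing_sub_le h₀ hR hd hs hst htT ((smooth_K₁ hδ).reflect z)
      (norm_grad_reflect_le (smooth_K₁ hδ) hC0
        (fun z => (norm_grad_K₁_le_kernel hδ z).trans (hC z)) z))
    (h.abs_pairing_sub_le h₀ hR hd hs hst htT ((smooth_K₂ hδ).reflect z)
      (norm_grad_reflect_le (smooth_K₂ hδ) hC0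
        (fun z => (norm_grad_K₂_le_kernel hδ z).trans (hC z)) z))

/-- The difference between the rate of change at a later time and the rate computed with the
regularised velocity and the density at the initial time. -/
lemma IsSolution.abs_rate_sub_le (h : IsSolution θ₀ θ) (h₀ : Dens M₀ R₀ θ₀) (hR : 0 ≤ R)
    (hd : ∀ t ∈ Icc 0 T, Dens M R (θ t)) {s t : ℝ} (hs : 0 ≤ s) (hst : s ≤ t) (htT : t ≤ T)
    {σ C L N : ℝ} (hσ : 0 < σ) (hC : ∀ z, ‖grad (kernel (σ ^ 4)) z‖ ≤ C)
    (hv : Field (velBound M R) L N (vel (σ ^ 4) (θ s))) {A B : ℝ} {φ : Cylinder → ℝ}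
    (hφ : Ctrl A B φ) :
    |rate (θ t) φ - ∫ z, θ s z * grad φ z (vel (σ ^ 4) (θ s) z)| ≤
      4 * Real.pi * R * M *
        (A * (σ * velErr M R + (t - s) * (4 * Real.pi * R * M * (C * velBound M R)))) +
      (t - s) * (4 * Real.pi * R * M * ((B * velBound M R + A * L) * velBound M R)) := by
  have hδ : 0 < σ ^ 4 := by positivity
  have hdt := hd t ⟨hs.trans hst, htT⟩
  have hds := hd s ⟨hs, hst.trans htT⟩
  have h1 := hdt.integrable_rate hdt hR le_rfl hφ.smooth
  have h2 := hdt.integrable_rate hds hR hδ.le hφ.smooth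
  obtain ⟨hgs, hgb⟩ := hφ.apply_lip hv
  have h3 := h.abs_pairing_sub_le h₀ hR hd hs hst htT hgs hgb
  have hX : ∀ z, ‖vel 0 (θ t) z - vel (σ ^ 4) (θ s) z‖ ≤
      σ * velErr M R + (t - s) * (4 * Real.pi * R * M * (C * velBound M R)) := fun z => by
    -- First removing the singularity at time `t` costs `O(σ)`, then moving from `t` to `s` costs
    -- `O(t - s)`.
    rw [← sub_add_sub_cancel _ (vel (σ ^ 4) (θ t) z)]
    exact (norm_add_le _ _).trans (add_le_add (hdt.norm_vel_sub_le hR hσ z)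
      (h.norm_vel_sub_le h₀ hR hd hs hst htT hδ hC z))
  have h4 : ‖∫ z, θ t z • grad φ z (vel 0 (θ t) z - vel (σ ^ 4) (θ s) z)‖ ≤ 4 * Real.pi * R * M *
        (A * (σ * velErr M R + (t - s) * (4 * Real.pi * R * M * (C * velBound M R)))) :=
    hdt.norm_integral_smul_le hR (mul_nonneg hφ.A_nonneg ((norm_nonneg _).trans (hX 0)))
      fun z _ => norm_grad_apply_le hφ.A_nonneg (hφ.grad_le z) (hX z)
  have h5 : rate (θ t) φ - ∫ z, θ s z * grad φ z (vel (σ ^ 4) (θ s) z) =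
      (∫ z, θ t z • grad φ z (vel 0 (θ t) z - vel (σ ^ 4) (θ s) z)) +
      ((∫ z, θ t z * grad φ z (vel (σ ^ 4) (θ s) z)) -
        ∫ z, θ s z * grad φ z (vel (σ ^ 4) (θ s) z)) := by
    simp only [map_sub, smul_sub]
    rw [integral_sub h1 h2]
    simp [rate]
  rw [h5]
  exact (abs_add_le _ _).trans (add_le_add h4 h3)

/-- Coefficient of the second order error of an Euler step. -/
noncomputable def stepErr (m V L C : ℝ) : ℝ := m * (m * (C * V)) + m * (V * (V + L)) + m * V ^ 2

/-- Moving `θ` forward and pulling `φ` back along the frozen regularised velocity have the same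
first-order term `τ c`. What remains is the regularisation error `τ σ A`, with the gradient bound
only, and terms of order `τ²`. -/
lemma IsSolution.abs_step_le (h : IsSolution θ₀ θ) (h₀ : Dens M₀ R₀ θ₀) (hR : 0 ≤ R)
    (hd : ∀ t ∈ Icc 0 T, Dens M R (θ t)) {s τ : ℝ} (hs : 0 ≤ s) (hτ : 0 ≤ τ) (hT : s + τ ≤ T)
    {σ C L N : ℝ} (hσ : 0 < σ) (hC : ∀ z, ‖grad (kernel (σ ^ 4)) z‖ ≤ C)
    (hv : Field (velBound M R) L N (vel (σ ^ 4) (θ s))) {A B : ℝ} {φ : Cylinder → ℝ}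
    (hφ : Ctrl A B φ) :
    |(∫ z, θ (s + τ) z * φ z) - ∫ z, θ s z * step τ (vel (σ ^ 4) (θ s)) φ z| ≤
      τ * (σ * (4 * Real.pi * R * M * velErr M R * A)) +
        τ ^ 2 * (stepErr (4 * Real.pi * R * M) (velBound M R) L C * (A + B)) := by
  set V := velBound M R
  set m := 4 * Real.pi * R * M
  set E := velErr M R
  set v := vel (σ ^ 4) (θ s)
  have hst : s ≤ s + τ := by linarith
  have hds := hd s ⟨hs, hst.trans hT⟩
  have hA := hφ.A_nonneg
  have hB := hφ.B_nonneg
  have hV := hv.V_nonneg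
  have hL := hv.L_nonneg
  have hM := hds.M_nonneg
  have hm : 0 ≤ m := by positivity
  have hC0 := (norm_nonneg _).trans (hC 0)
  set c := ∫ z, θ s z * grad φ z (v z) with hc
  have hci : IntervalIntegrable (fun r => rate (θ r) φ) volume s (s + τ) :=
    ((h.continuousOn_rate hφ.smooth).mono (by
      rw [uIcc_of_le hst]; exact fun r hr => hs.trans hr.1)).intervalIntegrable
  have h1 : |(∫ z, θ (s + τ) z * φ z) - (∫ z, θ s z * φ z) - τ * c| ≤
      (m * (A * (σ * E + τ * (m * (C * V)))) + τ * (m * ((B * V + A * L) * V))) * τ := by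
    have e1 : (∫ z, θ (s + τ) z * φ z) - (∫ z, θ s z * φ z) - τ * c =
        ∫ r in s..(s + τ), (rate (θ r) φ - c) := by
      rw [intervalIntegral.integral_sub hci (by simp), h.pairing_sub_eq h₀ hφ.smooth hs hst,
        intervalIntegral.integral_const, smul_eq_mul, add_sub_cancel_left]
    rw [e1, ← Real.norm_eq_abs]
    have := intervalIntegral.norm_integral_le_of_norm_le_const (a := s) (b := s + τ)
      (f := fun r => rate (θ r) φ - c)
      (C := m * (A * (σ * E + τ * (m * (C * V)))) + τ * (m * ((B * V + A * L) * V))) fun r hr => by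
        rw [uIoc_of_le hst] at hr
        have hrs : r - s ≤ τ := by linarith [hr.2]
        refine (h.abs_rate_sub_le h₀ hR hd hs hr.1.le (hr.2.trans hT) hσ hC hv hφ).trans ?_
        gcongr
    rwa [add_sub_cancel_left, abs_of_nonneg hτ] at this
  have hsm := (hφ.step hv hτ).smooth
  have i1 : Integrable (fun z => θ s z • step τ v φ z) volume := by
    obtain ⟨D, _, hD⟩ := hsm.exists_bound R
    exact hds.integrable_smul hsm.continuous.aestronglyMeasurable hD
  have i2 : Integrable (fun z => θ s z • φ z) volume := by
    obtain ⟨D, _, hD⟩ := hφ.smooth.exists_bound R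
    exact hds.integrable_smul hφ.smooth.continuous.aestronglyMeasurable hD
  have i3 : Integrable (fun z => θ s z • grad φ z (v z)) volume :=
    hds.integrable_rate hds hR (by positivity) hφ.smooth
  have h2 : |(∫ z, θ s z * step τ v φ z) - (∫ z, θ s z * φ z) - τ * c| ≤
      m * (B * (τ * V) ^ 2) := by
    have e2 : (∫ z, θ s z * step τ v φ z) - (∫ z, θ s z * φ z) - τ * c =
        ∫ z, θ s z • (step τ v φ z - φ z - τ * grad φ z (v z)) := by
      simp only [smul_eq_mul] at i1 i2 i3
      have i12 : Integrable (fun z => θ s z * step τ v φ z - θ s z * φ z) volume := i1.sub i2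
      rw [hc, ← integral_const_mul, ← integral_sub i1 i2, ← integral_sub i12 (i3.const_mul τ)]
      refine integral_congr_ae (Eventually.of_forall fun z => ?_)
      simp only [smul_eq_mul]; ring
    rw [e2, ← Real.norm_eq_abs]
    exact hds.norm_integral_smul_le hR (by positivity) fun z _ => hφ.abs_step_sub_le hv hτ z
  have h3 : (∫ z, θ (s + τ) z * φ z) - ∫ z, θ s z * step τ v φ z =
      ((∫ z, θ (s + τ) z * φ z) - (∫ z, θ s z * φ z) - τ * c) -
      ((∫ z, θ s z * step τ v φ z) - (∫ z, θ s z * φ z) - τ * c) := by ring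
  rw [h3]
  refine (abs_sub _ _).trans ((add_le_add h1 h2).trans ?_)
  rw [stepErr]
  have p1 : 0 ≤ τ ^ 2 * (m * (m * (C * V))) * B := by positivity
  have p2 : 0 ≤ τ ^ 2 * m * V ^ 2 * A := by positivity
  have p3 : 0 ≤ τ ^ 2 * m * V * L * B := by positivity
  nlinarith [p1, p2, p3]

/-! ### Preservation of pointwise bounds by duality with Euler polygons. -/

/-- `c + a f ≥ 0`, tested with smooth non-negative functions. -/
def PosTest (c a : ℝ) (f : Cylinder → ℝ) : Prop :=
  ∀ (φ : Cylinder → ℝ) (r : ℝ), Smooth φ → (∀ z, 0 ≤ φ z) → SuppIn r φ →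
    0 ≤ c * (∫ z, φ z) + a * ∫ z, f z * φ z

lemma euler_growth_le {A B L N τ : ℝ} (hA : 0 ≤ A) (hB : 0 ≤ B) (hL : 0 ≤ L) (hN : 0 ≤ N)
    (hτ : 0 ≤ τ) (hτ1 : τ ≤ 1) :
    A * (1 + τ * L) + (B * (1 + τ * L) ^ 2 + A * (τ * N)) ≤
      (A + B) * (1 + τ * (3 * L + L ^ 2 + N)) := by
  have q1 : 0 ≤ τ * (1 - τ) * L ^ 2 * B := by
    have := sub_nonneg.2 hτ1; positivity
  have q2 : 0 ≤ τ * L * A := by positivity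
  have q3 : 0 ≤ τ * L ^ 2 * A := by positivity
  have q4 : 0 ≤ τ * N * B := by positivity
  have q5 : 0 ≤ τ * L * B := by positivity
  nlinarith

lemma euler_sum_le {k τ σ p q X Y Z F : ℝ} (hk : 0 ≤ k) (hτ : 0 ≤ τ) (hσ : 0 ≤ σ)
    (hX : p ≤ X) (hY : q ≤ Y) (hZ : Z ≤ Y) (h : -(k * (τ * (σ * X) + τ ^ 2 * Z)) ≤ F) :
    -((k + 1) * (τ * (σ * X) + τ ^ 2 * Y)) ≤ F - (τ * (σ * p) + τ ^ 2 * q) := by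
  have h1 : τ * (σ * p) ≤ τ * (σ * X) := by gcongr
  have h2 : τ ^ 2 * q ≤ τ ^ 2 * Y := by gcongr
  have h3 : k * (τ ^ 2 * Z) ≤ k * (τ ^ 2 * Y) := by gcongr
  linarith

-- Induction over the steps, with the test function left general. `R₁` bounds the supports of all
-- pulled-back functions, hence the areas in the incompressibility errors. The two error families
-- are kept apart: `τ σ` with growth rate `L`, and `τ²` with growth rate `κ`.
set_option maxHeartbeats 400000 in
lemma IsSolution.polygon (h : IsSolution θ₀ θ) (h₀ : Dens M₀ R₀ θ₀) (hR : 0 ≤ R)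
    (hd : ∀ t ∈ Icc 0 T, Dens M R (θ t)) {s τ : ℝ} (hs : 0 ≤ s) (hτ : 0 ≤ τ) (hτ1 : τ ≤ 1)
    {σ C L N : ℝ} (hσ : 0 < σ) (hC : ∀ z, ‖grad (kernel (σ ^ 4)) z‖ ≤ C)
    (hv : ∀ t ∈ Icc 0 T, Field (velBound M R) L N (vel (σ ^ 4) (θ t))) {c a : ℝ}
    (hpos : PosTest c a (θ s)) {R₁ P Q κ : ℝ}
    (hP : P = |a| * (4 * Real.pi * R * M * velErr M R)) (hP0 : 0 ≤ P)
    (hQ : Q = |a| * stepErr (4 * Real.pi * R * M) (velBound M R) L C +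
      |c| * (4 * Real.pi * R₁ * velBound M R ^ 2)) (hQ0 : 0 ≤ Q)
    (hκ : κ = 3 * L + L ^ 2 + N) (k : ℕ) :
    ∀ (A B r : ℝ) (φ : Cylinder → ℝ), Ctrl A B φ → (∀ z, 0 ≤ φ z) → SuppIn r φ → 0 ≤ r →
      r + k * τ * velBound M R ≤ R₁ → s + k * τ ≤ T →
      -(k * (τ * (σ * (P * A * (1 + τ * L) ^ k)) + τ ^ 2 * (Q * (A + B) * (1 + τ * κ) ^ k))) ≤
        c * (∫ z, φ z) + a * ∫ z, θ (s + k * τ) z * φ z := by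
  induction k with
  | zero =>
    intro A B r φ hφ hφ0 hφr _ _ _
    have := hpos φ r hφ.smooth hφ0 hφr
    simpa using this
  | succ k ih =>
    intro A B r φ hφ hφ0 hφr hr hrR hT
    set V := velBound M R
    push_cast at hrR hT ⊢
    have hkτ : 0 ≤ k * τ := by positivity
    have ht : s + k * τ ∈ Icc 0 T := ⟨by positivity, by linarith⟩
    have hvk := hv _ ht
    have hA := hφ.A_nonneg
    have hB := hφ.B_nonneg
    have hV := hvk.V_nonneg
    have hL := hvk.L_nonneg
    have hN := hvk.N_nonneg
    have hκ0 : 0 ≤ κ := by rw [hκ]; positivity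
    have hφ' := hφ.step hvk hτ
    have hs' := hφr.step hvk hτ
    have hrV : 0 ≤ r + τ * V := by positivity
    -- The last time step is removed by pulling `φ` back with the velocity at `s + k τ`; the
    -- remaining `k` steps act on the pulled-back function, still non-negative as a composition.
    have h1 := ih _ _ _ _ hφ' (fun z => hφ0 _) hs' hrV (by linarith) (by linarith)
    have h2 := h.abs_step_le h₀ hR hd ht.1 hτ (by linarith) hσ hC hvk hφ
    have h3 := hφ.abs_integral_step_sub_le hvk hτ hφr hrV
    set I := ∫ z, φ z
    set I' := ∫ z, step τ (vel (σ ^ 4) (θ (s + k * τ))) φ z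
    set J := ∫ z, θ (s + k * τ + τ) z * φ z with hJ
    set J' := ∫ z, θ (s + k * τ) z * step τ (vel (σ ^ 4) (θ (s + k * τ))) φ z
    have hJ2 : ∫ z, θ (s + (k + 1) * τ) z * φ z = J := by
      rw [hJ, show s + (k + 1) * τ = s + k * τ + τ by ring]
    rw [hJ2]
    have hdiff : |c * (I' - I) - a * (J - J')| ≤ τ * (σ * (P * A)) + τ ^ 2 * (Q * (A + B)) := by
      refine (abs_sub _ _).trans ?_
      rw [abs_mul, abs_mul]
      have e1 := mul_le_mul_of_nonneg_left h2 (abs_nonneg a)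
      have hr1 : r + τ * V ≤ R₁ := by
        nlinarith [mul_nonneg hkτ hV]
      have e2 : |c| * |I' - I| ≤ |c| * (4 * Real.pi * R₁ * ((A + B) * (τ * V) ^ 2)) := by
        refine mul_le_mul_of_nonneg_left (h3.trans ?_) (abs_nonneg c)
        have hp := Real.pi_pos
        have hR₁ : 0 ≤ R₁ := hrV.trans hr1
        gcongr
        linarith
      refine (add_le_add e2 e1).trans (le_of_eq ?_)
      rw [hP, hQ]
      ring
    have h4 : c * I' + a * J' - (τ * (σ * (P * A)) + τ ^ 2 * (Q * (A + B))) ≤ c * I + a * J := by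
      have := (abs_le.1 hdiff).2
      linarith
    refine le_trans ?_ h4
    have hAB := euler_growth_le hA hB hL hN hτ hτ1
    rw [← hκ] at hAB
    have hl : 1 ≤ 1 + τ * L := by nlinarith [mul_nonneg hτ hL]
    have hk1 : 1 ≤ 1 + τ * κ := by nlinarith [mul_nonneg hτ hκ0]
    have hX : P * A ≤ P * A * (1 + τ * L) ^ (k + 1) :=
      le_mul_of_one_le_right (mul_nonneg hP0 hA) (one_le_pow₀ hl)
    have hY : Q * (A + B) ≤ Q * (A + B) * (1 + τ * κ) ^ (k + 1) :=
      le_mul_of_one_le_right (mul_nonneg hQ0 (add_nonneg hA hB)) (one_le_pow₀ hk1)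
    have hZ : Q * (A * (1 + τ * L) + (B * (1 + τ * L) ^ 2 + A * (τ * N))) * (1 + τ * κ) ^ k ≤
        Q * (A + B) * (1 + τ * κ) ^ (k + 1) := by
      refine (mul_le_mul_of_nonneg_right (mul_le_mul_of_nonneg_left hAB hQ0)
        (pow_nonneg (zero_le_one.trans hk1) k)).trans (le_of_eq ?_)
      ring
    have hW : P * (A * (1 + τ * L)) * (1 + τ * L) ^ k = P * A * (1 + τ * L) ^ (k + 1) := by ring
    rw [hW] at h1
    exact euler_sum_le (Nat.cast_nonneg k) hτ hσ.le hX hY hZ h1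

end Solution

lemma exists_ctrl {φ : Cylinder → ℝ} {r : ℝ} (hφ : Smooth φ) (hr : SuppIn r φ) :
    ∃ A B, Ctrl A B φ := by
  have key : ∀ {E : Type} [NormedAddCommGroup E] [NormedSpace ℝ E] (F : Cylinder → E), Smooth F →
      (∀ z : Cylinder, r < |z.1| → F z = 0) → ∃ C, ∀ z, ‖grad F z‖ ≤ C := by
    intro E _ _ F hF hFr
    obtain ⟨C, hC0, hC⟩ := hF.grad.exists_bound r
    refine ⟨C, fun z => ?_⟩
    by_cases hz : |z.1| ≤ r
    · exact hC z hz
    · rw [SuppIn.grad hFr z (not_le.1 hz), norm_zero]; exact hC0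
  obtain ⟨A, hA⟩ := key φ hφ hr
  obtain ⟨B, hB⟩ := key (grad φ) hφ.grad (SuppIn.grad hr)
  exact ⟨A, B, hφ, hA, norm_sub_le_of_grad hφ.grad.differentiable hB⟩

lemma one_add_div_pow_le_exp {x : ℝ} (hx : 0 ≤ x) {n : ℕ} (hn : n ≠ 0) :
    (1 + x / n) ^ n ≤ Real.exp x := by
  have h1 : 1 + x / n ≤ Real.exp (x / n) := by rw [add_comm]; exact Real.add_one_le_exp _
  calc (1 + x / n) ^ n ≤ Real.exp (x / n) ^ n := pow_le_pow_left₀ (by positivity) h1 n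
    _ = Real.exp x := by
        rw [← Real.exp_nat_mul]; congr 1; field_simp

/-- With `σ = τ²` the exponential is about `σ ^ (-1/2) = τ⁻¹`: the regularisation error beats the
growth of the gradient. -/
lemma mul_exp_log_le {τ : ℝ} (hτ : 0 < τ) (hτ1 : τ ≤ 1) :
    τ ^ 2 * Real.exp (Real.log ((1 + (τ ^ 2) ^ 2) / (τ ^ 2) ^ 2) / 4) ≤ 2 * τ := by
  rw [← pow_le_pow_iff_left₀ (by positivity) (by positivity) (four_ne_zero)]
  rw [mul_pow, ← Real.exp_nat_mul]
  push_cast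
  rw [mul_div_cancel₀ _ (four_ne_zero), Real.exp_log (by positivity)]
  have h1 : τ ^ 4 ≤ 1 := pow_le_one₀ hτ.le hτ1
  have h2 : 0 < τ ^ 4 := by positivity
  have h3 : (τ ^ 2) ^ 4 * ((1 + (τ ^ 2) ^ 2) / (τ ^ 2) ^ 2) = τ ^ 4 * (1 + τ ^ 4) := by
    field_simp
  rw [h3]
  nlinarith

lemma integral_wtLoc_nonneg : 0 ≤ ∫ z, wtLoc z := integral_nonneg wtLoc_nonneg

section Solution

variable {θ₀ : Cylinder → ℝ} {θ : ℝ → Cylinder → ℝ} {M R T M₀ R₀ : ℝ}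

/-- Limit of `n` Euler steps of length `H / n` at fixed `σ`. The quadratic errors are `O(1/n)`,
whatever their dependence on `σ`; the regularisation error survives. -/
lemma IsSolution.flow_lower_bound (h : IsSolution θ₀ θ) (h₀ : Dens M₀ R₀ θ₀) (hR : 0 ≤ R)
    (hd : ∀ t ∈ Icc 0 T, Dens M R (θ t)) {s H : ℝ} (hs : 0 ≤ s) (hH : 0 ≤ H) (hT : s + H ≤ T)
    {c a : ℝ} (hpos : PosTest c a (θ s)) {σ : ℝ} (hσ : 0 < σ) {A B r : ℝ} {φ : Cylinder → ℝ}
    (hφ : Ctrl A B φ) (hφ0 : ∀ z, 0 ≤ φ z) (hr : SuppIn r φ) :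
    -(H * (σ * (|a| * (4 * Real.pi * R * M * velErr M R) * A * Real.exp (H * gradBound M R σ)))) ≤
      c * (∫ z, φ z) + a * ∫ z, θ (s + H) z * φ z := by
  obtain ⟨C, hC0, hC, hfield⟩ := exists_field hσ
  have hv : ∀ t ∈ Icc 0 T, Field (velBound M R) (gradBound M R σ) (4 * Real.pi * R * M * C)
      (vel (σ ^ 4) (θ t)) := fun t ht => hfield M R (θ t) hR (hd t ht)
  have hs' : s ∈ Icc 0 T := ⟨hs, by linarith⟩
  have hM := (hd s hs').M_nonneg
  have hL := (hv s hs').L_nonneg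
  have hV := (hv s hs').V_nonneg
  have hA := hφ.A_nonneg
  have hB := hφ.B_nonneg
  have hw := integral_wtLoc_nonneg
  have hE : 0 ≤ velErr M R := by unfold velErr; positivity
  set L := gradBound M R σ
  set V := velBound M R
  set N := 4 * Real.pi * R * M * C with hN
  have hN0 : 0 ≤ N := by positivity
  set r' := max r 0
  have hr' : 0 ≤ r' := le_max_right _ _
  set P := |a| * (4 * Real.pi * R * M * velErr M R) with hP
  have hP0 : 0 ≤ P := by positivity
  obtain ⟨Q, hQ⟩ : ∃ Q, Q = |a| * stepErr (4 * Real.pi * R * M) V L C +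
    |c| * (4 * Real.pi * (r' + H * V) * V ^ 2) := ⟨_, rfl⟩
  have hQ0 : 0 ≤ Q := by rw [hQ]; unfold stepErr; positivity
  obtain ⟨κ, hκ⟩ : ∃ κ, κ = 3 * L + L ^ 2 + N := ⟨_, rfl⟩
  have hκ0 : 0 ≤ κ := by rw [hκ]; positivity
  have key : ∀ n : ℕ, 1 ≤ n → H ≤ n →
      -(H * (σ * (P * A * Real.exp (H * L))) + H ^ 2 * (Q * (A + B) * Real.exp (H * κ)) / n) ≤
        c * (∫ z, φ z) + a * ∫ z, θ (s + H) z * φ z := fun n hn hHn => by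
    have hn0 : (0:ℝ) < n := by exact_mod_cast hn
    have hn1 : n ≠ 0 := by omega
    have hnτ : (n:ℝ) * (H / n) = H := by field_simp
    have h1 := h.polygon h₀ hR hd hs (τ := H / n) (by positivity) ((div_le_one hn0).2 hHn) hσ hC hv
      hpos (R₁ := r' + H * V) hP hP0 hQ hQ0 hκ n A B r' φ hφ hφ0 (hr.mono (le_max_left _ _)) hr'
      (by rw [hnτ]) (by rw [hnτ]; exact hT)
    rw [hnτ] at h1
    refine le_trans (neg_le_neg ?_) h1
    have e1 : (1 + H / n * L) ^ n ≤ Real.exp (H * L) := by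
      rw [div_mul_eq_mul_div]; exact one_add_div_pow_le_exp (by positivity) hn1
    have e2 : (1 + H / n * κ) ^ n ≤ Real.exp (H * κ) := by
      rw [div_mul_eq_mul_div]; exact one_add_div_pow_le_exp (by positivity) hn1
    calc (n:ℝ) * (H / n * (σ * (P * A * (1 + H / n * L) ^ n)) +
          (H / n) ^ 2 * (Q * (A + B) * (1 + H / n * κ) ^ n))
        = H * (σ * (P * A * (1 + H / n * L) ^ n)) +
          H ^ 2 * (Q * (A + B) * (1 + H / n * κ) ^ n) / n := by
          generalize (1 + H / n * L) ^ n = X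
          generalize (1 + H / n * κ) ^ n = Y
          field_simp
      _ ≤ _ := by gcongr
  have hlim : Tendsto (fun n : ℕ => -(H * (σ * (P * A * Real.exp (H * L))) +
      H ^ 2 * (Q * (A + B) * Real.exp (H * κ)) / n)) atTop
      (𝓝 (-(H * (σ * (P * A * Real.exp (H * L))) + 0))) :=
    ((tendsto_const_div_atTop_nhds_zero_nat _).const_add _).neg
  rw [add_zero] at hlim
  refine le_of_tendsto hlim ?_
  filter_upwards [eventually_ge_atTop 1, eventually_ge_atTop ⌈H⌉₊] with n hn1 hn2
  exact key n hn1 ((Nat.le_ceil H).trans (by exact_mod_cast hn2))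

/-- The factor `24 π² M` is the coefficient of the logarithm in `gradBound`. The smallness of `H`
caps the exponent at a quarter of that logarithm plus a constant, so the error is `O(τ)` with `σ =
τ²`. -/
lemma IsSolution.posTest_add (h : IsSolution θ₀ θ) (h₀ : Dens M₀ R₀ θ₀) (hR : 0 ≤ R)
    (hd : ∀ t ∈ Icc 0 T, Dens M R (θ t)) {s H : ℝ} (hs : 0 ≤ s) (hH : 0 ≤ H) (hT : s + H ≤ T)
    (hHM : H * (24 * Real.pi ^ 2 * M) ≤ 1 / 4)
    {c a : ℝ} (hpos : PosTest c a (θ s)) : PosTest c a (θ (s + H)) := by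
  intro φ r hφ hφ0 hr
  obtain ⟨A, B, hc⟩ := exists_ctrl hφ hr
  have hM := (hd s ⟨hs, by linarith⟩).M_nonneg
  have hA := hc.A_nonneg
  have hw := integral_wtLoc_nonneg
  have hE : 0 ≤ velErr M R := by unfold velErr; positivity
  set P := |a| * (4 * Real.pi * R * M * velErr M R) with hP
  have hP0 : 0 ≤ P := by positivity
  set D := H * (P * A * Real.exp (H * (8 * (4 * Real.pi * R * M)))) * 2 with hD
  have key : ∀ τ : ℝ, 0 < τ → τ ≤ 1 →
      -(D * τ) ≤ c * (∫ z, φ z) + a * ∫ z, θ (s + H) z * φ z := fun τ hτ hτ1 => by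
    refine le_trans (neg_le_neg ?_)
      (h.flow_lower_bound h₀ hR hd hs hH hT hpos (σ := τ ^ 2) (by positivity) hc hφ0 hr)
    set x := Real.log ((1 + (τ ^ 2) ^ 2) / (τ ^ 2) ^ 2) with hx
    have hx0 : 0 ≤ x := by
      refine Real.log_nonneg ?_
      rw [one_le_div (by positivity)]
      linarith
    have hexp : Real.exp (H * gradBound M R (τ ^ 2)) ≤
        Real.exp (H * (8 * (4 * Real.pi * R * M))) * Real.exp (x / 4) := by
      rw [← Real.exp_add]
      refine Real.exp_le_exp.2 ?_
      rw [gradBound, ← hx]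
      nlinarith [mul_le_mul_of_nonneg_right hHM hx0]
    have hτx := mul_exp_log_le hτ hτ1
    rw [← hx] at hτx
    calc H * (τ ^ 2 * (P * A * Real.exp (H * gradBound M R (τ ^ 2))))
        ≤ H * (τ ^ 2 * (P * A * (Real.exp (H * (8 * (4 * Real.pi * R * M))) *
            Real.exp (x / 4)))) := by gcongr
      _ = H * (P * A * Real.exp (H * (8 * (4 * Real.pi * R * M)))) *
            (τ ^ 2 * Real.exp (x / 4)) := by ring
      _ ≤ H * (P * A * Real.exp (H * (8 * (4 * Real.pi * R * M)))) * (2 * τ) := by gcongr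
      _ = D * τ := by rw [hD]; ring
  have hlim : Tendsto (fun n : ℕ => -(D * (1 / ((n : ℝ) + 1)))) atTop (𝓝 (-(D * 0))) :=
    (tendsto_one_div_add_atTop_nhds_zero_nat.const_mul D).neg
  rw [mul_zero, neg_zero] at hlim
  refine le_of_tendsto' hlim fun n => key _ Nat.one_div_pos_of_nat ?_
  rw [div_le_one (by positivity)]
  linarith [Nat.cast_nonneg (α := ℝ) n]

/-- The admissible step depends only on the bound `M` valid up to time `t`, so finitely many equal
steps and a shorter one reach `t`. -/
lemma IsSolution.posTest (h : IsSolution θ₀ θ) (h₀ : Dens M₀ R₀ θ₀) {c a : ℝ}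
    (hpos : PosTest c a θ₀) {t : ℝ} (ht : 0 ≤ t) : PosTest c a (θ t) := by
  obtain ⟨M, R, hR, hd⟩ := h.exists_dens t
  have hM := (hd t ⟨ht, le_rfl⟩).M_nonneg
  set b := 24 * Real.pi ^ 2 * M with hb
  have hb0 : 0 ≤ b := by positivity
  set H := 1 / (4 * (b + 1)) with hH
  have hH0 : 0 < H := by positivity
  have hHb : H * b ≤ 1 / 4 := by
    rw [hH, div_mul_eq_mul_div, one_mul, div_le_div_iff₀ (by positivity) (by norm_num)]
    linarith
  have key : ∀ n : ℕ, ∀ r, 0 ≤ r → r ≤ t → r ≤ n * H → PosTest c a (θ r) := by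
    intro n
    induction n with
    | zero =>
      intro r hr _ hrn
      have hr0 : r = 0 := le_antisymm (by simpa using hrn) hr
      subst hr0
      intro φ r hφ hφ0 hφr
      have := h.pairing_eq h₀ hφ le_rfl
      rw [intervalIntegral.integral_same, add_zero] at this
      rw [this]
      exact hpos φ r hφ hφ0 hφr
    | succ n ih =>
      intro r hr hrt hrn
      push_cast at hrn
      have hnH : 0 ≤ n * H := by positivity
      by_cases hle : r ≤ n * H
      · exact ih r hr hrt hle
      · have hlt := not_le.1 hle
        have h1 := ih (n * H) hnH (hlt.le.trans hrt) le_rfl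
        have h2 := h.posTest_add h₀ hR hd hnH (H := r - n * H) (by linarith) (by linarith) (by
          refine le_trans (mul_le_mul_of_nonneg_right ?_ hb0) hHb
          linarith) h1
        rwa [add_sub_cancel] at h2
  refine key ⌈t / H⌉₊ t ht le_rfl ?_
  rw [← div_le_iff₀ hH0]
  exact Nat.le_ceil _

end Solution

/-! ### From smooth test functions to inequalities almost everywhere. -/

lemma isCompact_strip (R : ℝ) : IsCompact (strip R) := by
  rw [strip_eq]; exact isCompact_Icc.prod isCompact_univ

/-- Restrictions to a strip of the smooth functions. -/
noncomputable def smoothAlgebra (R : ℝ) : Subalgebra ℝ C(strip R, ℝ) where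
  carrier := {q | ∃ F : Cylinder → ℝ, Smooth F ∧ ∀ x : strip R, q x = F x}
  mul_mem' := by
    rintro p q ⟨F, hF, hp⟩ ⟨G, hG, hq⟩
    exact ⟨fun z => F z * G z, ContDiff.mul (f := lift F) (g := lift G) hF hG,
      fun x => by simp [hp, hq]⟩
  add_mem' := by
    rintro p q ⟨F, hF, hp⟩ ⟨G, hG, hq⟩
    exact ⟨fun z => F z + G z, ContDiff.add (f := lift F) (g := lift G) hF hG,
      fun x => by simp [hp, hq]⟩
  algebraMap_mem' := fun c => ⟨fun _ => c, contDiff_const, fun x => rfl⟩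

lemma eq_of_sinC_cosC {y w : AddCircle (2 * Real.pi)} (hs : sinC y = sinC w)
    (hc : cosC y = cosC w) : y = w := by
  induction y using QuotientAddGroup.induction_on with
  | H y =>
    induction w using QuotientAddGroup.induction_on with
    | H w => exact Real.Angle.cos_sin_inj hc hs

lemma smoothAlgebra_separatesPoints (R : ℝ) : (smoothAlgebra R).SeparatesPoints := by
  intro x y hxy
  have hmem : ∀ F : Cylinder → ℝ, (hF : Smooth F) →
      (⟨fun x : strip R => F x, hF.continuous.comp continuous_subtype_val⟩ : C(strip R, ℝ)) ∈
        smoothAlgebra R := fun F hF => ⟨F, hF, fun _ => rfl⟩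
  have h1 : Smooth (fun z : Cylinder => z.1) := contDiff_fst
  have h2 : Smooth (fun z : Cylinder => sinC z.2) := Real.contDiff_sin.comp contDiff_snd
  have h3 : Smooth (fun z : Cylinder => cosC z.2) := Real.contDiff_cos.comp contDiff_snd
  by_contra! hcon
  refine hxy (Subtype.ext (Prod.ext ?_ (eq_of_sinC_cosC ?_ ?_)))
  · exact hcon _ ⟨_, hmem _ h1, rfl⟩
  · exact hcon _ ⟨_, hmem _ h2, rfl⟩
  · exact hcon _ ⟨_, hmem _ h3, rfl⟩

/-- Stone-Weierstrass on the compact strip: `x`, `sin y` and `cos y` separate points. -/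
lemma exists_smooth_near {ψ : Cylinder → ℝ} (hψ : Continuous ψ) (R : ℝ) {ε : ℝ} (hε : 0 < ε) :
    ∃ F : Cylinder → ℝ, Smooth F ∧ ∀ z : Cylinder, |z.1| ≤ R → |F z - ψ z| < ε := by
  have : CompactSpace (strip R) := isCompact_iff_compactSpace.1 (isCompact_strip R)
  obtain ⟨⟨q, F, hF, hq⟩, hn⟩ :=
    ContinuousMap.exists_mem_subalgebra_near_continuous_of_separatesPoints (smoothAlgebra R)
      (smoothAlgebra_separatesPoints R) (fun x => ψ x) (hψ.comp continuous_subtype_val) ε hε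
  refine ⟨F, hF, fun z hz => ?_⟩
  have := hn ⟨z, hz⟩
  rwa [hq, Real.norm_eq_abs] at this

lemma exists_smooth_nonneg_near {ψ : Cylinder → ℝ} (hψ : Continuous ψ) (hψ0 : ∀ z, 0 ≤ ψ z)
    {R : ℝ} (hR : 0 ≤ R) (hs : SuppIn R ψ) {ε : ℝ} (hε : 0 < ε) :
    ∃ φ : Cylinder → ℝ, Smooth φ ∧ (∀ z, 0 ≤ φ z) ∧ SuppIn (R + 2) φ ∧ ∀ z, |φ z - ψ z| ≤ ε := by
  let η : ContDiffBump (0 : ℝ) := ⟨R + 1, R + 2, by linarith, by linarith⟩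
  -- Approximating `ψ + ε / 2` to within `ε / 2` puts `F` between `ψ` and `ψ + ε`, so `F` is
  -- non-negative on the strip.
  obtain ⟨F, hF, hn⟩ := exists_smooth_near (ψ := fun z => ψ z + ε / 2)
    (hψ.add continuous_const) (R + 2) (half_pos hε)
  have hF' : ∀ z : Cylinder, |z.1| ≤ R + 2 → ψ z ≤ F z ∧ F z ≤ ψ z + ε := fun z hz => by
    have := abs_lt.1 (hn z hz)
    constructor <;> linarith [this.1, this.2]
  have hη0 : ∀ z : Cylinder, R + 2 < |z.1| → η z.1 = 0 := fun z hz =>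
    η.zero_of_le_dist (by rw [dist_zero_right]; exact hz.le)
  refine ⟨fun z => η z.1 * F z, (η.contDiff.comp contDiff_fst).mul hF, fun z => ?_, fun z hz => ?_,
    fun z => ?_⟩
  · by_cases hz : |z.1| ≤ R + 2
    · exact mul_nonneg η.nonneg ((hψ0 z).trans (hF' z hz).1)
    · simp [hη0 z (not_le.1 hz)]
  · simp [hη0 z hz]
  · change |η z.1 * F z - ψ z| ≤ ε
    by_cases hz : |z.1| ≤ R + 2
    · obtain ⟨h1, h2⟩ := hF' z hz
      by_cases hz1 : |z.1| ≤ R + 1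
      · have : η z.1 = 1 := η.one_of_mem_closedBall (by rw [mem_closedBall_zero_iff]; exact hz1)
        rw [this, one_mul, abs_of_nonneg (by linarith)]
        linarith
      · have h3 : ψ z = 0 := hs z (by linarith [not_le.1 hz1])
        rw [h3, zero_add] at h2
        rw [h3] at h1 ⊢
        rw [sub_zero, abs_of_nonneg (mul_nonneg η.nonneg h1)]
        exact (mul_le_of_le_one_left h1 η.le_one).trans h2
    · rw [hη0 z (not_le.1 hz), hs z (by linarith [not_le.1 hz])]
      simpa using hε.le

lemma integral_nonneg_of_smooth_test {g : Cylinder → ℝ} (hg : AEStronglyMeasurable g volume) {G : ℝ}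
    (hG : ∀ᵐ z, |g z| ≤ G)
    (h : ∀ (φ : Cylinder → ℝ) (r : ℝ), Smooth φ → (∀ z, 0 ≤ φ z) → SuppIn r φ → 0 ≤ ∫ z, g z * φ z)
    {ψ : Cylinder → ℝ} (hψ : Continuous ψ) (hψ0 : ∀ z, 0 ≤ ψ z) {R : ℝ} (hR : 0 ≤ R)
    (hs : SuppIn R ψ) : 0 ≤ ∫ z, g z * ψ z := by
  have hG0 : 0 ≤ G := by
    obtain ⟨z, hz⟩ := hG.exists
    exact (abs_nonneg _).trans hz
  set W := 4 * Real.pi * (R + 2) * G with hW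
  have hi : ∀ χ : Cylinder → ℝ, Continuous χ → SuppIn (R + 2) χ →
      Integrable (fun z => g z * χ z) volume := fun χ hχ hχs =>
    (integrable_of_suppIn hχ hχs).bdd_mul (c := G) hg hG
  have key : ∀ ε : ℝ, 0 < ε → -(W * ε) ≤ ∫ z, g z * ψ z := fun ε hε => by
    obtain ⟨φ, hφ, hφ0, hφs, hn⟩ := exists_smooth_nonneg_near hψ hψ0 hR hs hε
    have h1 := h φ _ hφ hφ0 hφs
    have hs2 : SuppIn (R + 2) ψ := hs.mono (by linarith)
    have h2 : |(∫ z, g z * φ z) - ∫ z, g z * ψ z| ≤ W * ε := by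
      rw [← integral_sub (hi φ hφ.continuous hφs) (hi ψ hψ hs2), ← Real.norm_eq_abs]
      calc _ ≤ ∫ z, (strip (R + 2)).indicator (fun _ => G * ε) z := by
            refine norm_integral_le_of_norm_le (integrable_indicator_strip _ _) ?_
            filter_upwards [hG] with z hz
            by_cases hzR : z ∈ strip (R + 2)
            · rw [← mul_sub, norm_mul]
              simp only [hzR, indicator_of_mem]
              exact mul_le_mul hz (hn z) (norm_nonneg _) hG0
            · have hz' : R + 2 < |z.1| := not_le.1 hzR
              rw [hφs z hz', hs2 z hz']
              simp [hzR]
        _ = W * ε := by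
            rw [integral_indicator (measurableSet_strip _), setIntegral_const,
              volume_real_strip (by linarith), smul_eq_mul, hW]
            ring
    linarith [(abs_le.1 h2).2]
  have hlim : Tendsto (fun n : ℕ => -(W * (1 / ((n : ℝ) + 1)))) atTop (𝓝 (-(W * 0))) :=
    (tendsto_one_div_add_atTop_nhds_zero_nat.const_mul W).neg
  rw [mul_zero, neg_zero] at hlim
  exact le_of_tendsto' hlim fun n => key _ Nat.one_div_pos_of_nat

/-- Thickened indicators are continuous and decrease to the indicator of `K`; dominated convergence
passes to the limit. -/
lemma setIntegral_nonneg_of_smooth_test {g : Cylinder → ℝ} (hg : AEStronglyMeasurable g volume)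
    {G : ℝ} (hG : ∀ᵐ z, |g z| ≤ G)
    (h : ∀ (φ : Cylinder → ℝ) (r : ℝ), Smooth φ → (∀ z, 0 ≤ φ z) → SuppIn r φ → 0 ≤ ∫ z, g z * φ z)
    {K : Set Cylinder} (hK : IsCompact K) : 0 ≤ ∫ z in K, g z := by
  obtain ⟨R, hR, hKR⟩ := exists_bound_fst hK
  have hG0 : 0 ≤ G := by
    obtain ⟨z, hz⟩ := hG.exists
    exact (abs_nonneg _).trans hz
  have hpos : ∀ n : ℕ, (0:ℝ) < 1 / ((n : ℝ) + 1) := fun n => Nat.one_div_pos_of_nat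
  set ψ : ℕ → Cylinder → ℝ := fun n z => (thickenedIndicator (hpos n) K z : ℝ) with hψ
  have hψc : ∀ n, Continuous (ψ n) := fun n =>
    NNReal.continuous_coe.comp (thickenedIndicator (hpos n) K).continuous
  have hψ0 : ∀ n z, 0 ≤ ψ n z := fun n z => NNReal.coe_nonneg _
  have hψ1 : ∀ n z, ψ n z ≤ 1 := fun n z => by
    exact NNReal.coe_le_one.2 (thickenedIndicator_le_one (hpos n) K z)
  have hψs : ∀ n, SuppIn (R + 1) (ψ n) := fun n z hz => by
    have : z ∉ Metric.thickening (1 / ((n : ℝ) + 1)) K := fun hzK => by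
      obtain ⟨w, hw, hd⟩ := Metric.mem_thickening_iff.1 hzK
      have h1 : dist z.1 w.1 < 1 := by
        refine ((le_max_left _ _).trans_lt (Prod.dist_eq (x := z) (y := w) ▸ hd)).trans_le ?_
        rw [div_le_one (by positivity)]
        linarith [Nat.cast_nonneg (α := ℝ) n]
      rw [Real.dist_eq] at h1
      have := abs_sub_abs_le_abs_sub z.1 w.1
      linarith [hKR w hw]
    simp only [hψ]
    rw [thickenedIndicator_zero (hpos n) K this, NNReal.coe_zero]
  have hlim : Tendsto (fun n => ∫ z, g z * ψ n z) atTop (𝓝 (∫ z, g z * K.indicator 1 z)) := by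
    refine tendsto_integral_of_dominated_convergence ((strip (R + 1)).indicator fun _ => G)
      (fun n => hg.mul (hψc n).aestronglyMeasurable) (integrable_indicator_strip _ _)
      (fun n => ?_) (Eventually.of_forall fun z => ?_)
    · filter_upwards [hG] with z hz
      by_cases hzR : z ∈ strip (R + 1)
      · simp only [hzR, indicator_of_mem]
        rw [norm_mul, Real.norm_eq_abs, Real.norm_eq_abs, abs_of_nonneg (hψ0 n z)]
        exact (mul_le_of_le_one_right (abs_nonneg _) (hψ1 n z)).trans hz
      · rw [hψs n z (not_le.1 hzR)]
        simp [hzR]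
    · refine Tendsto.const_mul (g z) ?_
      have h1 := thickenedIndicator_tendsto_indicator_closure hpos
        tendsto_one_div_add_atTop_nhds_zero_nat K
      rw [hK.isClosed.closure_eq] at h1
      have h2 := (NNReal.continuous_coe.tendsto _).comp (tendsto_pi_nhds.1 h1 z)
      have h3 : ((K.indicator (fun _ => (1 : NNReal)) z : NNReal) : ℝ) = K.indicator 1 z := by
        by_cases hz : z ∈ K <;> simp [hz]
      rw [h3] at h2
      exact h2
  have h0 : 0 ≤ ∫ z, g z * K.indicator 1 z :=
    ge_of_tendsto' hlim fun n =>
      integral_nonneg_of_smooth_test hg hG h (hψc n) (hψ0 n) (by linarith) (hψs n)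
  rw [← integral_indicator hK.measurableSet]
  refine h0.trans_eq (integral_congr_ae (Eventually.of_forall fun z => ?_))
  by_cases hz : z ∈ K <;> simp [hz]

/-- If `g` were negative on a set of positive measure, inner regularity would give a compact subset
of positive measure with negative integral. -/
lemma ae_nonneg_of_smooth_test {g : Cylinder → ℝ} (hg : AEStronglyMeasurable g volume) {G : ℝ}
    (hG : ∀ᵐ z, |g z| ≤ G)
    (h : ∀ (φ : Cylinder → ℝ) (r : ℝ), Smooth φ → (∀ z, 0 ≤ φ z) → SuppIn r φ → 0 ≤ ∫ z, g z * φ z) :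
    ∀ᵐ z, 0 ≤ g z := by
  set g' := hg.mk g with hg'
  have hm : MeasurableSet {z | g' z < 0} :=
    measurableSet_lt hg.stronglyMeasurable_mk.measurable measurable_const
  have h0 : volume {z | g' z < 0} = 0 := by
    by_contra hne
    obtain ⟨K, hKs, hK, hK0⟩ := hm.exists_lt_isCompact (pos_iff_ne_zero.2 hne)
    have h1 := setIntegral_nonneg_of_smooth_test hg hG h hK
    rw [integral_congr_ae (ae_restrict_of_ae hg.ae_eq_mk)] at h1
    have hi : IntegrableOn g' K volume := by
      refine Measure.integrableOn_of_bounded (M := G) hK.measure_lt_top.ne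
        hg.stronglyMeasurable_mk.aestronglyMeasurable (ae_restrict_of_ae ?_)
      filter_upwards [hG, hg.ae_eq_mk] with z hz hz'
      rw [hg', ← hz']; exact hz
    have h2 : 0 < ∫ z in K, -g' z := by
      rw [setIntegral_pos_iff_support_of_nonneg_ae]
      · have : Function.support (fun z => -g' z) ∩ K = K := by
          refine inter_eq_right.2 fun z hz => ?_
          have : g' z < 0 := hKs hz
          simp [this.ne]
        rwa [this]
      · filter_upwards [ae_restrict_mem hK.measurableSet] with z hz
        have : g' z < 0 := hKs hz
        simpa using this.le
      · exact hi.neg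
    rw [integral_neg] at h2
    linarith
  filter_upwards [hg.ae_eq_mk, (ae_iff.2 (by simpa using h0) : ∀ᵐ z, 0 ≤ g' z)] with z h1 h2
  rw [h1]; exact h2

lemma posTest_of_ae {M R c a : ℝ} {f : Cylinder → ℝ} (hf : Dens M R f)
    (h : ∀ᵐ z, 0 ≤ c + a * f z) : PosTest c a f := by
  intro φ r hφ hφ0 hr
  have i1 := (integrable_of_suppIn hφ.continuous hr).const_mul c
  have i2 : Integrable (fun z => f z * φ z) volume :=
    (integrable_of_suppIn hφ.continuous hr).bdd_mul (c := M) hf.meas hf.bound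
  rw [← integral_const_mul, ← integral_const_mul, ← integral_add i1 (i2.const_mul a)]
  refine integral_nonneg_of_ae ?_
  filter_upwards [h] with z hz
  have := mul_nonneg hz (hφ0 z)
  simp only [Pi.zero_apply]
  linarith

lemma PosTest.ae_nonneg {M R c a : ℝ} {f : Cylinder → ℝ} (hf : Dens M R f) (h : PosTest c a f) :
    ∀ᵐ z, 0 ≤ c + a * f z := by
  refine ae_nonneg_of_smooth_test (G := |c| + |a| * M)
    ((hf.meas.const_mul a).const_add c) ?_ fun φ r hφ hφ0 hr => ?_
  · filter_upwards [hf.bound] with z hz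
    refine (abs_add_le _ _).trans ?_
    rw [abs_mul]
    gcongr
  · have i1 := (integrable_of_suppIn hφ.continuous hr).const_mul c
    have i2 : Integrable (fun z => f z * φ z) volume :=
      (integrable_of_suppIn hφ.continuous hr).bdd_mul (c := M) hf.meas hf.bound
    have := h φ r hφ hφ0 hr
    rw [← integral_const_mul, ← integral_const_mul, ← integral_add i1 (i2.const_mul a)] at this
    refine this.trans_eq (integral_congr_ae (Eventually.of_forall fun z => ?_))
    simp only; ring

/-- Non-negative densities stay non-negative and keep their upper bound. -/
lemma IsSolution.ae_bounds {θ₀ : Cylinder → ℝ} {θ : ℝ → Cylinder → ℝ} {M₀ R₀ : ℝ}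
    (h : IsSolution θ₀ θ) (h₀ : Dens M₀ R₀ θ₀) (hpos : ∀ᵐ z, 0 ≤ θ₀ z) {t : ℝ} (ht : 0 ≤ t) :
    (∀ᵐ z, 0 ≤ θ t z) ∧ ∀ᵐ z, θ t z ≤ M₀ := by
  obtain ⟨M, R, hR, hd⟩ := h.exists_dens t
  have hdt := hd t ⟨ht, le_rfl⟩
  -- The pairs `(0, 1)` and `(M₀, -1)` encode `θ ≥ 0` and `M₀ - θ ≥ 0`.
  have h1 := (h.posTest h₀ (posTest_of_ae (c := 0) (a := 1) h₀ (by simpa using hpos)) ht).ae_nonneg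
    hdt
  have h2 := (h.posTest h₀ (posTest_of_ae (c := M₀) (a := -1) h₀ (by
    filter_upwards [h₀.bound] with z hz
    linarith [(abs_le.1 hz).2])) ht).ae_nonneg hdt
  constructor
  · simpa using h1
  · filter_upwards [h2] with z hz
    linarith

/-! ### Symmetry of double integrals -/

lemma integrable_pair {M M' R C : ℝ} {f f' K : Cylinder → ℝ} (hf : Dens M R f) (hf' : Dens M' R f')
    (hK : Measurable K)
    (hi : ∀ z : Cylinder, |z.1| ≤ R → Integrable (fun ξ => f' ξ • K (z - ξ)) volume)
    (hC : ∀ z : Cylinder, |z.1| ≤ R → ∫ ξ, |f' ξ • K (z - ξ)| ≤ C) :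
    Integrable (fun p : Cylinder × Cylinder => f p.1 * (f' p.2 • K (p.1 - p.2)))
      ((volume : Measure Cylinder).prod volume) := by
  have hm : AEStronglyMeasurable (fun p : Cylinder × Cylinder => f p.1 * (f' p.2 • K (p.1 - p.2)))
      ((volume : Measure Cylinder).prod volume) :=
    hf.meas.comp_fst.mul (hf'.meas.comp_snd.smul
      (hK.comp (measurable_fst.sub measurable_snd)).aestronglyMeasurable)
  refine (integrable_prod_iff hm).2 ⟨?_, ?_⟩
  · filter_upwards [hf.supp] with z hz
    by_cases hzR : |z.1| ≤ R
    · exact (hi z hzR).const_mul _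
    · simp [hz (not_le.1 hzR)]
  · refine (hf.integrable.abs.mul_const C).mono' hm.norm.integral_prod_right' ?_
    filter_upwards [hf.supp] with z hz
    by_cases hzR : |z.1| ≤ R
    · simp only [norm_mul (f z), Real.norm_eq_abs]
      rw [integral_const_mul, abs_mul, abs_abs, abs_of_nonneg (integral_nonneg fun ξ => abs_nonneg _)]
      exact mul_le_mul_of_nonneg_left (hC z hzR) (abs_nonneg _)
    · simp [hz (not_le.1 hzR)]

lemma integral_conv_swap {M M' R C : ℝ} {f f' K : Cylinder → ℝ} (hf : Dens M R f)
    (hf' : Dens M' R f') (hK : Measurable K)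
    (hi : ∀ z : Cylinder, |z.1| ≤ R → Integrable (fun ξ => f' ξ • K (z - ξ)) volume)
    (hC : ∀ z : Cylinder, |z.1| ≤ R → ∫ ξ, |f' ξ • K (z - ξ)| ≤ C) :
    ∫ z, f z * conv K f' z = ∫ z, f' z * conv (fun ζ => K (-ζ)) f z := by
  have h := integral_integral_swap (f := fun z ξ => f z * (f' ξ • K (z - ξ)))
    (integrable_pair hf hf' hK hi hC)
  simp only [conv]
  simp only [integral_const_mul] at h
  rw [h]
  refine integral_congr_ae (Eventually.of_forall fun ξ => ?_)
  simp only
  rw [← integral_const_mul]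
  refine integral_congr_ae (Eventually.of_forall fun z => ?_)
  simp only [smul_eq_mul, neg_sub]
  ring

/-- The double integral changes sign when its variables are exchanged, `k₁` being odd. The bound
`hb` justifies Fubini for the singular kernel. -/
lemma integral_conv_K₁_eq_zero {M R : ℝ} {f : Cylinder → ℝ} (hf : Dens M R f) :
    ∫ z, f z * conv (K₁ 0) f z = 0 := by
  have hb : ∀ z : Cylinder, ∫ ξ, |f ξ • K₁ 0 (z - ξ)| ≤
      4 * (∫ ξ, |f ξ|) + 1 * (M * ∫ ξ, wtLoc ξ) := fun z => by
    have h1 := hf.integrable_mul_weight (integrable_wtLoc.comp_sub_left z)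
    calc ∫ ξ, |f ξ • K₁ 0 (z - ξ)| ≤ ∫ ξ, (4 * |f ξ| + |f ξ| * wtLoc (z - ξ)) := by
          refine integral_mono (hf.integrable_K₁ le_rfl z).abs
            ((hf.integrable.abs.const_mul 4).add h1) fun ξ => ?_
          have := norm_K₁_le (le_refl (0:ℝ)) (z - ξ)
          rw [Real.norm_eq_abs] at this
          simp only [smul_eq_mul, abs_mul]
          nlinarith [mul_le_mul_of_nonneg_left this (abs_nonneg (f ξ))]
      _ = 4 * (∫ ξ, |f ξ|) + ∫ ξ, |f ξ| * wtLoc (z - ξ) := by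
          rw [integral_add (hf.integrable.abs.const_mul 4) h1, integral_const_mul]
      _ ≤ _ := by
          rw [one_mul]; gcongr; exact hf.integral_weight_le integrable_wtLoc wtLoc_nonneg z
  have h := integral_conv_swap hf hf (measurable_K₁ 0) (fun z _ => hf.integrable_K₁ le_rfl z)
    (fun z _ => hb z)
  have h2 : conv (fun ζ => K₁ 0 (-ζ)) f = fun z => -conv (K₁ 0) f z := by
    funext z
    simp only [conv, K₁_neg, smul_neg, integral_neg]
  rw [h2] at h
  simp only [mul_neg, integral_neg] at h
  linarith

lemma integral_conv_smooth_swap {M M' R : ℝ} {f f' K : Cylinder → ℝ} (hf : Dens M R f)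
    (hf' : Dens M' R f') (hK : Smooth K) (heven : ∀ z, K (-z) = K z) :
    ∫ z, f z * conv K f' z = ∫ z, f' z * conv K f z := by
  obtain ⟨C, hC0, hC⟩ := hK.exists_bound (R + R)
  have h := integral_conv_swap hf hf' hK.continuous.measurable
    (fun z _ => hf'.integrable_conv hK z) (C := (∫ ξ, |f' ξ|) * C) fun z hz => by
      rw [← integral_mul_const]
      refine integral_mono_ae (hf'.integrable_conv hK z).abs (hf'.integrable.abs.mul_const C) ?_
      filter_upwards [hf'.supp] with ξ hξ
      rw [smul_eq_mul, abs_mul]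
      by_cases hξR : |ξ.1| ≤ R
      · refine mul_le_mul_of_nonneg_left (hC _ ?_) (abs_nonneg _)
        exact (abs_sub _ _).trans (add_le_add hz hξR)
      · simp [hξ (not_le.1 hξR)]
  simpa only [heven] using h

/-! ### Conservation laws -/

section Solution

variable {θ₀ : Cylinder → ℝ} {θ : ℝ → Cylinder → ℝ} {M R T M₀ R₀ : ℝ}

lemma IsSolution.mass_eq (h : IsSolution θ₀ θ) (h₀ : Dens M₀ R₀ θ₀) {t : ℝ} (ht : 0 ≤ t) :
    ∫ z, θ t z = ∫ z, θ₀ z := by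
  have hg : Smooth (fun _ : Cylinder => (1:ℝ)) := contDiff_const
  have h1 := h.pairing_eq h₀ hg ht
  have hr : ∀ s, rate (θ s) (fun _ => 1) = 0 := fun s => by
    have : ∀ z, grad (fun _ : Cylinder => (1:ℝ)) z = 0 := fun z => by simp [grad]
    simp [rate, this]
  simpa [hr] using h1

lemma IsSolution.center_eq (h : IsSolution θ₀ θ) (h₀ : Dens M₀ R₀ θ₀) {t : ℝ} (ht : 0 ≤ t) :
    ∫ z, θ t z * z.1 = ∫ z, θ₀ z * z.1 := by
  have hg : Smooth (fun z : Cylinder => z.1) := contDiff_fst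
  have h1 := h.pairing_eq h₀ hg ht
  have hgrad : ∀ z, grad (fun z : Cylinder => z.1) z = ContinuousLinearMap.fst ℝ ℝ ℝ := fun z => by
    obtain ⟨p, rfl⟩ := proj_surjective z
    exact grad_eq_of_hasFDerivAt (F := fun z : Cylinder => z.1) (hasFDerivAt_fst (𝕜 := ℝ) (p := p))
  obtain ⟨M, R, hR, hd⟩ := h.exists_dens t
  have hr : ∫ s in (0:ℝ)..t, rate (θ s) (fun z => z.1) = 0 := by
    refine (intervalIntegral.integral_congr (g := fun _ => 0) fun s hs => ?_).trans (by simp)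
    rw [uIcc_of_le ht] at hs
    simp only [rate, hgrad]
    exact integral_conv_K₁_eq_zero (hd s hs)
  rw [h1, hr, add_zero]

/-- The regularised energy. -/
noncomputable def energy (δ : ℝ) (f : Cylinder → ℝ) : ℝ := ∫ z, f z * conv (green δ) f z

/-- The regularised kernel is the perpendicular gradient of `green δ`. So the differential along `w`
is a cross product, which vanishes when `w` is the velocity itself. -/
lemma Dens.grad_conv_green {δ : ℝ} (hδ : 0 < δ) {f : Cylinder → ℝ} (hf : Dens M R f) (z : Cylinder)
    (w : ℝ × ℝ) : grad (conv (green δ) f) z w =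
      (vel δ f z).2 * w.1 - (vel δ f z).1 * w.2 := by
  have hg := smooth_green hδ
  rw [hf.grad_conv hg, conv, ContinuousLinearMap.integral_apply (hf.integrable_conv hg.grad z)]
  have h1 : ∀ ξ, grad (green δ) ξ w = K₂ δ ξ * w.1 - K₁ δ ξ * w.2 := fun ξ => by
    obtain ⟨p, rfl⟩ := proj_surjective ξ
    rw [grad_eq_of_hasFDerivAt (hasFDerivAt_lift_green hδ p), form_apply]
    ring
  have i1 := (hf.integrable_K₁ hδ.le z).mul_const w.2
  have i2 := (hf.integrable_K₂ hδ.le z).mul_const w.1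
  rw [vel, conv, conv]
  simp only
  rw [← integral_mul_const, ← integral_mul_const, ← integral_sub i2 i1]
  refine integral_congr_ae (Eventually.of_forall fun ξ => ?_)
  simp only [smul_apply, h1, smul_eq_mul]
  ring

lemma abs_cross_le (v w : ℝ × ℝ) : |v.2 * w.1 - v.1 * w.2| ≤ 2 * ‖v‖ * ‖w‖ := by
  have h1 := norm_fst_le v
  have h2 := norm_snd_le v
  have h3 := norm_fst_le w
  have h4 := norm_snd_le w
  refine (abs_sub _ _).trans ?_
  rw [abs_mul, abs_mul]
  have h5 := mul_le_mul h2 h3 (norm_nonneg _) (norm_nonneg _)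
  have h6 := mul_le_mul h1 h4 (norm_nonneg _) (norm_nonneg _)
  simp only [Real.norm_eq_abs] at h5 h6
  linarith

lemma IsSolution.abs_rate_green_le (h : IsSolution θ₀ θ) (h₀ : Dens M₀ R₀ θ₀) (hR : 0 ≤ R)
    (hd : ∀ t ∈ Icc 0 T, Dens M R (θ t)) {σ C : ℝ} (hσ : 0 < σ)
    (hC : ∀ z, ‖grad (kernel (σ ^ 4)) z‖ ≤ C) {τ r D : ℝ} (hτ : τ ∈ Icc 0 T) (hr : r ∈ Icc 0 T)
    (hD : |r - τ| ≤ D) :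
    |rate (θ τ) (conv (green (σ ^ 4)) (θ r))| ≤ 4 * Real.pi * R * M * (2 * velBound M R *
      (D * (4 * Real.pi * R * M * (C * velBound M R)) + σ * velErr M R)) := by
  have hδ : 0 < σ ^ 4 := by positivity
  have hdτ := hd τ hτ
  have hV := hdτ.velBound_nonneg hR
  have hM := hdτ.M_nonneg
  have hC0 := (norm_nonneg _).trans (hC 0)
  have hD0 := (abs_nonneg _).trans hD
  set V := velBound M R
  set X := 4 * Real.pi * R * M * (C * V)
  have hX : 0 ≤ X := by positivity
  have hlip : ∀ z, ‖vel (σ ^ 4) (θ r) z - vel (σ ^ 4) (θ τ) z‖ ≤ D * X := fun z => by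
    rcases le_total r τ with hle | hle
    · rw [norm_sub_rev]
      refine (h.norm_vel_sub_le h₀ hR hd hr.1 hle hτ.2 hδ hC z).trans ?_
      gcongr
      rw [abs_sub_comm] at hD
      exact (le_abs_self _).trans hD
    · refine (h.norm_vel_sub_le h₀ hR hd hτ.1 hle hr.2 hδ hC z).trans ?_
      gcongr
      exact (le_abs_self _).trans hD
  have hE : 0 ≤ σ * velErr M R := (norm_nonneg _).trans (hdτ.norm_vel_sub_le hR hσ 0)
  rw [rate, ← Real.norm_eq_abs]
  refine hdτ.norm_integral_smul_le hR (by positivity) fun z _ => ?_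
  rw [(hd r hr).grad_conv_green hδ, Real.norm_eq_abs]
  set v := vel (σ ^ 4) (θ r) z
  set w := vel (σ ^ 4) (θ τ) z
  set u := vel 0 (θ τ) z
  -- The cross product of `w` with itself is zero. The two terms left measure the change of the
  -- velocity in time and its regularisation.
  have e : v.2 * u.1 - v.1 * u.2 =
      ((v - w).2 * u.1 - (v - w).1 * u.2) + (w.2 * (u - w).1 - w.1 * (u - w).2) := by
    simp only [Prod.fst_sub, Prod.snd_sub]; ring
  have hu : ‖u‖ ≤ V := hdτ.norm_vel_le hR le_rfl z
  have hw : ‖w‖ ≤ V := hdτ.norm_vel_le hR hδ.le z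
  have huw : ‖u - w‖ ≤ σ * velErr M R := hdτ.norm_vel_sub_le hR hσ z
  rw [e]
  refine (abs_add_le _ _).trans ((add_le_add (abs_cross_le _ _) (abs_cross_le _ _)).trans ?_)
  have h1 := mul_le_mul (hlip z) hu (norm_nonneg _) (by positivity)
  have h2 := mul_le_mul hw huw (norm_nonneg _) hV
  linarith

/-- By evenness of `green`, the increment of the quadratic energy is the increment of `θ` paired
with the potentials at `t` and at `s`. These potentials are fixed smooth functions, to which the
weak equation applies. -/
lemma IsSolution.abs_energy_sub_le (h : IsSolution θ₀ θ) (h₀ : Dens M₀ R₀ θ₀) (hR : 0 ≤ R)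
    (hd : ∀ t ∈ Icc 0 T, Dens M R (θ t)) {σ C : ℝ} (hσ : 0 < σ)
    (hC : ∀ z, ‖grad (kernel (σ ^ 4)) z‖ ≤ C) {s t : ℝ} (hs : 0 ≤ s) (hst : s ≤ t) (ht : t ≤ T) :
    |energy (σ ^ 4) (θ t) - energy (σ ^ 4) (θ s)| ≤
      2 * ((t - s) * (4 * Real.pi * R * M * (2 * velBound M R *
      ((t - s) * (4 * Real.pi * R * M * (C * velBound M R)) + σ * velErr M R)))) := by
  have hδ : 0 < σ ^ 4 := by positivity
  have hg := smooth_green hδ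
  have hsT : s ∈ Icc 0 T := ⟨hs, hst.trans ht⟩
  have htT : t ∈ Icc 0 T := ⟨hs.trans hst, ht⟩
  have hds := hd s hsT
  have hdt := hd t htT
  set Y := 4 * Real.pi * R * M * (2 * velBound M R *
      ((t - s) * (4 * Real.pi * R * M * (C * velBound M R)) + σ * velErr M R))
  have key : ∀ r ∈ Icc s t, |(∫ z, θ t z * conv (green (σ ^ 4)) (θ r) z) -
      ∫ z, θ s z * conv (green (σ ^ 4)) (θ r) z| ≤ (t - s) * Y := fun r hr => by
    have hrT : r ∈ Icc 0 T := ⟨hs.trans hr.1, hr.2.trans ht⟩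
    rw [h.pairing_sub_eq h₀ ((hd r hrT).smooth_conv hg) hs hst, ← Real.norm_eq_abs]
    have := intervalIntegral.norm_integral_le_of_norm_le_const (a := s) (b := t)
      (f := fun τ => rate (θ τ) (conv (green (σ ^ 4)) (θ r))) (C := Y) fun τ hτ => by
        rw [uIoc_of_le hst] at hτ
        refine h.abs_rate_green_le h₀ hR hd hσ hC ⟨hs.trans hτ.1.le, hτ.2.trans ht⟩ hrT ?_
        rw [abs_le]; constructor <;> linarith [hτ.1, hτ.2, hr.1, hr.2]
    rwa [abs_of_nonneg (sub_nonneg.2 hst), mul_comm] at this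
  have h1 := key t ⟨hst, le_rfl⟩
  have h2 := key s ⟨le_rfl, hst⟩
  have h3 := integral_conv_smooth_swap hds hdt hg (green_neg _)
  have e : energy (σ ^ 4) (θ t) - energy (σ ^ 4) (θ s) =
      ((∫ z, θ t z * conv (green (σ ^ 4)) (θ t) z) - ∫ z, θ s z * conv (green (σ ^ 4)) (θ t) z) +
      ((∫ z, θ t z * conv (green (σ ^ 4)) (θ s) z) - ∫ z, θ s z * conv (green (σ ^ 4)) (θ s) z) := by
    rw [energy, energy, h3]; ring
  rw [e]
  exact (abs_add_le _ _).trans ((add_le_add h1 h2).trans (two_mul _).ge)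

/-- Summation over `n` equal intervals at fixed `σ`: the quadratic part is `O(1/n)`, and letting `n`
tend to infinity eliminates the constant `C`. -/
lemma IsSolution.abs_energy_sub_zero_le (h : IsSolution θ₀ θ) (h₀ : Dens M₀ R₀ θ₀) (hR : 0 ≤ R)
    (hT : 0 ≤ T) (hd : ∀ t ∈ Icc 0 T, Dens M R (θ t)) {σ : ℝ} (hσ : 0 < σ) :
    |energy (σ ^ 4) (θ T) - energy (σ ^ 4) (θ 0)| ≤
      σ * (4 * (T * (4 * Real.pi * R * M * (velBound M R * velErr M R)))) := by
  obtain ⟨C, -, hC, -⟩ := exists_field hσ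
  set m := 4 * Real.pi * R * M
  set V := velBound M R
  set E := velErr M R
  have key : ∀ n : ℕ, 1 ≤ n → |energy (σ ^ 4) (θ T) - energy (σ ^ 4) (θ 0)| ≤
      σ * (4 * (T * (m * (V * E)))) + 4 * T ^ 2 * m ^ 2 * V ^ 2 * C / n := fun n hn => by
    have hn0 : (0:ℝ) < n := by exact_mod_cast hn
    set Y := 2 * (T / n * (m * (2 * V * (T / n * (m * (C * V)) + σ * E)))) with hY
    have hk : ∀ k : ℕ, k ≤ n →
        |energy (σ ^ 4) (θ (k * (T / n))) - energy (σ ^ 4) (θ 0)| ≤ k * Y := by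
      intro k
      induction k with
      | zero => intro _; simp
      | succ k ih =>
        intro hkn
        have h1 := ih (by omega)
        have hTn : 0 ≤ T / n := by positivity
        have hle : ((k + 1 : ℕ) : ℝ) * (T / n) ≤ T := by
          have : ((k + 1 : ℕ) : ℝ) ≤ n := by exact_mod_cast hkn
          calc ((k + 1 : ℕ) : ℝ) * (T / n) ≤ n * (T / n) := by gcongr
            _ = T := by field_simp
        have h2 := h.abs_energy_sub_le h₀ hR hd hσ hC (s := k * (T / n))
          (t := ((k + 1 : ℕ) : ℝ) * (T / n)) (by positivity)
          (by push_cast; linarith) hle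
        rw [show ((k + 1 : ℕ) : ℝ) * (T / n) - k * (T / n) = T / n by push_cast; ring] at h2
        have h3 := abs_sub_le (energy (σ ^ 4) (θ (((k + 1 : ℕ) : ℝ) * (T / n))))
          (energy (σ ^ 4) (θ (k * (T / n)))) (energy (σ ^ 4) (θ 0))
        refine h3.trans ((add_le_add h2 h1).trans (le_of_eq ?_))
        push_cast
        ring
    have h4 := hk n le_rfl
    rw [show (n:ℝ) * (T / n) = T by field_simp] at h4
    refine h4.trans (le_of_eq ?_)
    rw [hY]
    field_simp
    ring
  have hlim : Tendsto (fun n : ℕ => σ * (4 * (T * (m * (V * E)))) +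
      4 * T ^ 2 * m ^ 2 * V ^ 2 * C / n) atTop (𝓝 (σ * (4 * (T * (m * (V * E)))) + 0)) :=
    (tendsto_const_div_atTop_nhds_zero_nat _).const_add _
  rw [add_zero] at hlim
  refine ge_of_tendsto hlim ?_
  filter_upwards [eventually_ge_atTop 1] with n hn using key n hn

lemma IsSolution.pairing_zero (h : IsSolution θ₀ θ) (h₀ : Dens M₀ R₀ θ₀) {g : Cylinder → ℝ}
    (hg : Smooth g) : ∫ z, θ 0 z * g z = ∫ z, θ₀ z * g z := by
  simpa using h.pairing_eq h₀ hg le_rfl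

lemma IsSolution.energy_zero (h : IsSolution θ₀ θ) (h₀ : Dens M₀ R₀ θ₀) {δ : ℝ} (hδ : 0 < δ) :
    energy δ (θ 0) = energy δ θ₀ := by
  have hg := smooth_green hδ
  have hconv : conv (green δ) (θ 0) = conv (green δ) θ₀ := by
    funext z
    exact h.pairing_zero h₀ (hg.reflect z)
  rw [energy, energy, hconv]
  exact h.pairing_zero h₀ (h₀.smooth_conv hg)

end Solution

/-! ### Bounds of the Green function -/

lemma cosh_le_exp_abs (x : ℝ) : Real.cosh x ≤ Real.exp |x| := by
  rw [← Real.cosh_abs, Real.cosh_eq]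
  have : Real.exp (-|x|) ≤ Real.exp |x| := Real.exp_le_exp.2 (by linarith [abs_nonneg x])
  linarith

lemma green_le {δ : ℝ} (hδ : 0 < δ) (hδ1 : δ ≤ 1) (z : Cylinder) : green δ z ≤ (|z.1| + 2) / 2 := by
  have h1 : den z + δ ≤ Real.exp (|z.1| + 2) := by
    have h2 := cosh_le_exp_abs z.1
    have h3 := neg_one_le_cosC z.2
    have h4 := Real.add_one_le_exp (2:ℝ)
    have h5 := Real.one_le_exp (abs_nonneg z.1)
    rw [Real.exp_add]
    unfold den
    nlinarith
  have h0 : 0 < den z + δ := by have := den_nonneg z; positivity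
  have := Real.log_le_log h0 h1
  rw [Real.log_exp] at this
  unfold green
  linarith

/-- Away from the axis `den ≥ e^{|x| - 9}`; near it the logarithmic singularity is absorbed by
`wtLoc`. The constants do not depend on `δ`, and the excluded set is null. -/
lemma abs_le_green {δ : ℝ} (hδ : 0 < δ) {z : Cylinder} (hz : z.1 ≠ 0) :
    |z.1| ≤ 2 * green δ z + (10 + 4 * wtLoc z) := by
  have hden : 0 < den z := by
    have h1 := sq_add_le_den z
    have h2 := cosC_le_one z.2
    have h3 : 0 < z.1 ^ 2 := by positivity
    linarith
  have hlog : Real.log (den z) ≤ 2 * green δ z := by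
    unfold green
    have := Real.log_le_log hden (by linarith : den z ≤ den z + δ)
    linarith
  by_cases hzs : z ∈ strip 1
  · have hz1 : |z.1| ≤ 1 := hzs
    obtain ⟨r, hr, h1, h2⟩ := exists_wt_root hden
    have h3 : wtLoc z = r ^ 3 := by simp [wtLoc, hzs, h2]
    have h4 : Real.log (den z) = -(4 * Real.log r) := by
      rw [eq_inv_of_mul_eq_one_left h1, Real.log_inv, Real.log_pow]
      norm_num
    have h5 := Real.log_le_sub_one_of_pos hr
    have h6 : r ≤ 1 + r ^ 3 := by
      nlinarith [sq_nonneg (r - 1), mul_nonneg hr.le (sq_nonneg (r - 1))]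
    rw [h3]
    linarith
  · have hz1 : 1 < |z.1| := not_le.1 hzs
    have h1 : Real.exp (|z.1| - 9) ≤ den z := by
      have h2 : Real.exp |z.1| / 2 ≤ Real.cosh z.1 := by
        rw [← Real.cosh_abs, Real.cosh_eq]
        linarith [Real.exp_pos (-|z.1|)]
      have h3 := cosC_le_one z.2
      have h4 : Real.exp 1 ≤ Real.exp |z.1| := Real.exp_le_exp.2 hz1.le
      have h5 := Real.exp_one_gt_d9
      have h6 : (10:ℝ) ≤ Real.exp 9 := by linarith [Real.add_one_le_exp (9:ℝ)]
      have h7 : Real.exp (|z.1| - 9) ≤ Real.exp |z.1| / 10 := by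
        rw [Real.exp_sub]
        gcongr
      unfold den
      linarith
    have h8 := Real.log_le_log (Real.exp_pos _) h1
    rw [Real.log_exp] at h8
    have := wtLoc_nonneg z
    linarith

lemma ae_sub_fst_ne_zero (z : Cylinder) : ∀ᵐ ξ : Cylinder, (z - ξ).1 ≠ 0 :=
  (volume.measurePreserving_sub_left z).quasiMeasurePreserving.ae
    (ae_snd_ne_zero.mono fun _ h => h.1)

/-- Since the centre is `0`, the mass times `x` is `∫ (x - ξ₁) f(ξ) dξ`; non-negativity of `f` then
allows the pointwise bound of `|x - ξ₁|` by the Green function. -/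
lemma Dens.mass_mul_abs_le {M R δ : ℝ} {f : Cylinder → ℝ} (hf : Dens M R f) (hδ : 0 < δ)
    (hpos : ∀ᵐ z, 0 ≤ f z) (hcen : ∫ z, f z * z.1 = 0) (z : Cylinder) :
    (∫ ξ, f ξ) * |z.1| ≤
      2 * conv (green δ) f z + (10 * (∫ ξ, f ξ) + 4 * (M * ∫ ξ, wtLoc ξ)) := by
  have hw := hf.integrable_mul_weight (integrable_wtLoc.comp_sub_left z)
  have hg := hf.integrable_conv (smooth_green hδ) z
  have hx1 : Smooth (fun z : Cylinder => z.1) := contDiff_fst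
  have hix : Integrable (fun ξ : Cylinder => f ξ • ξ.1) volume :=
    hf.integrable_smul hx1.continuous.aestronglyMeasurable (C := R) fun ξ hξ => hξ
  have hix' : Integrable (fun ξ : Cylinder => f ξ • (z - ξ).1) volume :=
    hf.integrable_conv hx1 z
  have hcenter : ∫ ξ, f ξ • (z - ξ).1 = (∫ ξ, f ξ) * z.1 := by
    have : ∀ ξ : Cylinder, f ξ • (z - ξ).1 = f ξ * z.1 - f ξ • ξ.1 := fun ξ => by
      simp only [smul_eq_mul, Prod.fst_sub]; ring
    simp only [this]
    rw [integral_sub (hf.integrable.mul_const _) hix, integral_mul_const]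
    simp only [smul_eq_mul]
    rw [hcen, sub_zero]
  have hm : 0 ≤ ∫ ξ, f ξ := integral_nonneg_of_ae hpos
  calc (∫ ξ, f ξ) * |z.1| = |∫ ξ, f ξ • (z - ξ).1| := by
        rw [hcenter, abs_mul, abs_of_nonneg hm]
    _ ≤ ∫ ξ, |f ξ • (z - ξ).1| := abs_integral_le_integral_abs
    _ ≤ ∫ ξ, (2 * (f ξ • green δ (z - ξ)) + (10 * f ξ + 4 * (|f ξ| * wtLoc (z - ξ)))) := by
        refine integral_mono_ae hix'.abs
          ((hg.const_mul 2).add ((hf.integrable.const_mul 10).add (hw.const_mul 4))) ?_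
        filter_upwards [hpos, ae_sub_fst_ne_zero z] with ξ h1 h2
        have h3 := mul_le_mul_of_nonneg_left (abs_le_green hδ h2) h1
        simp only [smul_eq_mul, abs_mul, abs_of_nonneg h1]
        linarith
    _ = 2 * conv (green δ) f z + (10 * (∫ ξ, f ξ) + 4 * ∫ ξ, |f ξ| * wtLoc (z - ξ)) := by
        have h1 := integral_add (hg.const_mul 2) ((hf.integrable.const_mul 10).add (hw.const_mul 4))
        have h2 := integral_add (hf.integrable.const_mul 10) (hw.const_mul 4)
        simp only [Pi.add_apply] at h1
        rw [h1, h2, integral_const_mul, integral_const_mul, integral_const_mul]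
        rfl
    _ ≤ _ := by
        gcongr
        exact hf.integral_weight_le integrable_wtLoc wtLoc_nonneg z

lemma Dens.mass_mul_moment_le {M R δ : ℝ} {f : Cylinder → ℝ} (hf : Dens M R f) (hδ : 0 < δ)
    (hpos : ∀ᵐ z, 0 ≤ f z) (hcen : ∫ z, f z * z.1 = 0) :
    (∫ ξ, f ξ) * ∫ z, |z.1| * f z ≤
      2 * energy δ f + (∫ ξ, f ξ) * (10 * (∫ ξ, f ξ) + 4 * (M * ∫ ξ, wtLoc ξ)) := by
  have hc := hf.smooth_conv (smooth_green hδ)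
  have i1 : Integrable (fun z : Cylinder => f z • |z.1|) volume :=
    hf.integrable_smul (continuous_fst.abs.aestronglyMeasurable) (C := R) fun z hz => by
      simpa using hz
  have i2 : Integrable (fun z => f z • conv (green δ) f z) volume := by
    obtain ⟨C, _, hC⟩ := hc.exists_bound R
    exact hf.integrable_smul hc.continuous.aestronglyMeasurable hC
  simp only [smul_eq_mul] at i1 i2
  rw [energy, ← integral_const_mul, ← integral_const_mul, ← integral_mul_const, ← integral_add
    (i2.const_mul 2) (hf.integrable.mul_const _)]
  refine integral_mono_ae ?_ ((i2.const_mul 2).add (hf.integrable.mul_const _)) ?_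
  · refine (i1.const_mul (∫ ξ, f ξ)).congr (Eventually.of_forall fun z => ?_)
    ring
  · filter_upwards [hpos] with z hz
    have := mul_le_mul_of_nonneg_left (hf.mass_mul_abs_le hδ hpos hcen z) hz
    linarith

/-! ### The initial data -/

section Initial

variable {f : Cylinder → ℝ}

lemma abs_sub_le_horizDiam (hs : IsCompact (essSupport f)) {z ξ : Cylinder}
    (hz : z ∈ essSupport f) (hξ : ξ ∈ essSupport f) : |z.1 - ξ.1| ≤ horizDiam f := by
  obtain ⟨R, hR, hKR⟩ := exists_bound_fst hs
  refine le_csSup ⟨R + R, ?_⟩ ⟨z, hz, ξ, hξ, rfl⟩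
  rintro r ⟨z, hz, ξ, hξ, rfl⟩
  exact (abs_sub _ _).trans (add_le_add (hKR z hz) (hKR ξ hξ))

lemma horizDiam_nonneg (f : Cylinder → ℝ) : 0 ≤ horizDiam f :=
  Real.sSup_nonneg (by rintro r ⟨z, -, ξ, -, rfl⟩; exact abs_nonneg _)

lemma Dens.energy_le {M R δ : ℝ} (hf : Dens M R f) (hδ : 0 < δ) (hδ1 : δ ≤ 1)
    (hpos : ∀ᵐ z, 0 ≤ f z) (hs : IsCompact (essSupport f)) :
    energy δ f ≤ (∫ ξ, f ξ) * ((∫ ξ, f ξ) * ((horizDiam f + 2) / 2)) := by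
  have hc := hf.smooth_conv (smooth_green hδ)
  have i2 : Integrable (fun z => f z • conv (green δ) f z) volume := by
    obtain ⟨C, _, hC⟩ := hc.exists_bound R
    exact hf.integrable_smul hc.continuous.aestronglyMeasurable hC
  have hconv : ∀ z ∈ essSupport f, conv (green δ) f z ≤ (∫ ξ, f ξ) * ((horizDiam f + 2) / 2) := by
    intro z hz
    rw [conv, ← integral_mul_const]
    refine integral_mono_ae (hf.integrable_conv (smooth_green hδ) z)
      (hf.integrable.mul_const _) ?_
    filter_upwards [hpos, ae_eq_zero_of_notMem_essSupport f] with ξ h1 h2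
    by_cases hξ : ξ ∈ essSupport f
    · have h3 := abs_sub_le_horizDiam hs hz hξ
      have h4 := green_le hδ hδ1 (z - ξ)
      rw [Prod.fst_sub] at h4
      exact mul_le_mul_of_nonneg_left (by linarith) h1
    · simp [h2 hξ]
  rw [energy, ← integral_mul_const]
  refine integral_mono_ae i2 (hf.integrable.mul_const _) ?_
  filter_upwards [hpos, ae_eq_zero_of_notMem_essSupport f] with z h1 h2
  by_cases hz : z ∈ essSupport f
  · exact mul_le_mul_of_nonneg_left (hconv z hz) h1
  · simp [h2 hz]

/-- The essential support lies within horizontal distance `d` of any of its points, hence in a slab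
of area `2d · 2π`. -/
lemma Dens.mass_le {M R : ℝ} (hf : Dens M R f) (hs : IsCompact (essSupport f)) :
    ∫ z, f z ≤ 4 * Real.pi * horizDiam f * M := by
  have hM := hf.M_nonneg
  have hd := horizDiam_nonneg f
  rcases (essSupport f).eq_empty_or_nonempty with he | ⟨w, hw⟩
  · have : ∫ z, f z = 0 := by
      refine integral_eq_zero_of_ae ?_
      filter_upwards [ae_eq_zero_of_notMem_essSupport f] with z hz
      exact hz (by rw [he]; exact notMem_empty z)
    rw [this]; positivity
  · set S := (Icc (w.1 - horizDiam f) (w.1 + horizDiam f)) ×ˢ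
      (univ : Set (AddCircle (2 * Real.pi)))
    have hSm : MeasurableSet S := measurableSet_Icc.prod MeasurableSet.univ
    have hvol : volume S = ENNReal.ofReal (w.1 + horizDiam f - (w.1 - horizDiam f)) *
        ENNReal.ofReal (2 * Real.pi) := volume_slab _ _
    have hfin : volume S ≠ ⊤ := by
      rw [hvol]; exact (ENNReal.mul_lt_top ENNReal.ofReal_lt_top ENNReal.ofReal_lt_top).ne
    calc ∫ z, f z ≤ ∫ z, S.indicator (fun _ => M) z := by
          refine integral_mono_ae hf.integrable
            ((integrable_indicator_iff hSm).2 (integrableOn_const hfin)) ?_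
          filter_upwards [hf.bound, ae_eq_zero_of_notMem_essSupport f] with z h1 h2
          by_cases hz : z ∈ essSupport f
          · have h3 := abs_le.1 (abs_sub_le_horizDiam hs hz hw)
            have : z ∈ S := ⟨⟨by linarith [h3.1], by linarith [h3.2]⟩, mem_univ _⟩
            rw [indicator_of_mem this]
            exact (le_abs_self _).trans h1
          · rw [h2 hz]; exact indicator_nonneg (fun _ _ => hM) z
      _ = 4 * Real.pi * horizDiam f * M := by
          rw [integral_indicator hSm, setIntegral_const, Measure.real, hvol, ENNReal.toReal_mul,
            ENNReal.toReal_ofReal (by linarith), ENNReal.toReal_ofReal Real.two_pi_pos.le,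
            smul_eq_mul]
          ring

end Initial

end CylEuler

/-! ### The moment bound. -/

open CylEuler in
theorem proposition3p1 :
    ∃ C : ℝ → ℝ → ℝ, ∀ (θ₀ : CylEuler.Cylinder → ℝ) (θ : ℝ → CylEuler.Cylinder → ℝ),
      MemLp θ₀ ∞ volume →
      (∀ᵐ z : CylEuler.Cylinder, 0 ≤ θ₀ z) →
      IsCompact (CylEuler.essSupport θ₀) →
      (∫ z : CylEuler.Cylinder, z.1 * θ₀ z) = 0 →
      CylEuler.IsSolution θ₀ θ →
      ∀ t : ℝ, 0 ≤ t →
        Integrable (fun z : CylEuler.Cylinder => |z.1| * θ t z) volume ∧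
        (∫ z : CylEuler.Cylinder, |z.1| * θ t z) ≤
          C (CylEuler.horizDiam θ₀) (CylEuler.supNorm θ₀) := by
  -- This is `m (d + 2) + 10 m + 4 s W` with the mass `m` replaced by its bound `4 π d s`.
  refine ⟨fun d s => 4 * Real.pi * d * s * (d + 2) +
    (10 * (4 * Real.pi * d * s) + 4 * (s * ∫ ξ, wtLoc ξ)), ?_⟩
  intro θ₀ θ hL hpos hsupp hcen h t ht
  obtain ⟨R₀, -, h₀⟩ := exists_dens_of_memLp hL hsupp
  obtain ⟨M, R, hR, hd⟩ := h.exists_dens t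
  have hdt := hd t ⟨ht, le_rfl⟩
  obtain ⟨hpt, hbt⟩ := h.ae_bounds h₀ hpos ht
  -- The local bound `M` is replaced by the initial sup norm, so the moment estimate does not depend
  -- on the solution's a priori bounds.
  have hdt' : Dens (supNorm θ₀) R (θ t) := by
    refine ⟨hdt.meas, ?_, hdt.supp⟩
    filter_upwards [hpt, hbt] with z h1 h2
    rwa [abs_of_nonneg h1]
  have hint : Integrable (fun z : Cylinder => |z.1| * θ t z) volume := by
    refine (hdt.integrable_smul (g := fun z : Cylinder => |z.1|)
      (continuous_fst.abs.aestronglyMeasurable) (C := R) fun z hz => by simpa using hz).congr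
      (Eventually.of_forall fun z => ?_)
    simp only [smul_eq_mul, mul_comm]
  refine ⟨hint, ?_⟩
  have hM := h₀.M_nonneg
  have hdiam := horizDiam_nonneg θ₀
  have hw := integral_wtLoc_nonneg
  set s := supNorm θ₀
  set d := horizDiam θ₀
  set W := ∫ ξ, wtLoc ξ
  have hmass := h.mass_eq h₀ ht
  have hcent : ∫ z, θ t z * z.1 = 0 := by
    rw [h.center_eq h₀ ht, ← hcen]; simp only [mul_comm]
  set m := ∫ z, θ₀ z with hm
  have hm0 : 0 ≤ m := integral_nonneg_of_ae hpos
  have hmle : m ≤ 4 * Real.pi * d * s := h₀.mass_le hsupp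
  have hmul : m * ∫ z, |z.1| * θ t z ≤ m * (m * (d + 2) + (10 * m + 4 * (s * W))) := by
    set D := 4 * (t * (4 * Real.pi * R * M * (velBound M R * velErr M R)))
    have key : ∀ σ : ℝ, 0 < σ → σ ≤ 1 → m * ∫ z, |z.1| * θ t z ≤
        m * (m * (d + 2) + (10 * m + 4 * (s * W))) + 2 * D * σ := fun σ hσ hσ1 => by
      have hδ : 0 < σ ^ 4 := by positivity
      have h1 := hdt'.mass_mul_moment_le hδ hpt hcent
      have h2 := (abs_le.1 (h.abs_energy_sub_zero_le h₀ hR ht hd hσ)).2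
      have h3 := h₀.energy_le hδ (pow_le_one₀ hσ.le hσ1) hpos hsupp
      rw [h.energy_zero h₀ hδ] at h2
      rw [hmass] at h1
      linarith
    have hlim : Tendsto (fun n : ℕ => m * (m * (d + 2) + (10 * m + 4 * (s * W))) +
        2 * D * (1 / ((n : ℝ) + 1))) atTop
        (𝓝 (m * (m * (d + 2) + (10 * m + 4 * (s * W))) + 2 * D * 0)) :=
      (tendsto_one_div_add_atTop_nhds_zero_nat.const_mul _).const_add _
    rw [mul_zero, add_zero] at hlim
    refine ge_of_tendsto' hlim fun n => key _ Nat.one_div_pos_of_nat ?_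
    rw [div_le_one (by positivity)]
    linarith [Nat.cast_nonneg (α := ℝ) n]
  -- Division by `m` requires `m > 0`; if `m = 0`, then `θ t` is non-negative with zero mass and
  -- vanishes almost everywhere.
  rcases hm0.eq_or_lt with hz | hz
  · have h0 : θ t =ᵐ[volume] 0 := by
      rw [← integral_eq_zero_iff_of_nonneg_ae hpt hdt.integrable, hmass, ← hz]
    have : ∫ z : Cylinder, |z.1| * θ t z = 0 := by
      refine integral_eq_zero_of_ae ?_
      filter_upwards [h0] with z hz
      simp [hz]
    rw [this]
    positivity
  · refine (le_of_mul_le_mul_left hmul hz).trans ?_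
    have := mul_le_mul_of_nonneg_right hmle (by linarith : 0 ≤ d + 2)
    simp only
    linarith
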